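/- Let $k$ be an algebraically closed field of characteristic $0$, let $X$ be a smooth scheme over $k$ (for instance a smooth projective variety), with sheaf of Kähler differentials $\Omega_X=\Omega_{X/k}$ and universal derivation $d:\mathcal O_X\to\Omega_X$, and let $E$ be a vector bundle (a locally free $\mathcal O_X$-module of finite rank) on $X$. Write $D(X)$ for the derived category of $\mathcal O_X$-modules. *Atiyah class.* Let $E_A$ be the abelian sheaf $E\oplus(\Omega_X\otimes E)$ with the $\mathcal O_X$-module structure $a\cdot(e,w)=(ae,\;aw+da\otimes e)$. It fits into an exact sequence of $\mathcal O_X$-modules $0\to\Omega_X\otimes E\to E_A\to E\to 0$, which defines a class in $\mathrm{Ext}^1(E,\Omega_X\otimes E)\cong\mathrm{Ext}^1(\mathcal Hom(E,E),\Omega_X)$. Here the class on the right is obtained by applying $\mathcal Hom(E,-)$ to the sequence, taking the connecting morphism $\mathcal Hom(E,E)\to\mathcal Hom(E,\Omega_X\otimes E)[1]$, and composing with the trace $\mathcal Hom(E,\Omega_X\otimes E)\cong \mathcal Hom(E,\mathcal O_X)\otimes\Omega_X\otimes E\to\Omega_X$, $\;l\otimes s\otimes e\mapsto l(e)\,s$.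 Regard it as a morphism $\alpha(E):\mathcal Hom(E,E)[-1]\to\Omega_X$ in $D(X)$, and let $G^\bullet$ be its cone, that is, any complex of $\mathcal O_X$-modules in a distinguished triangle $$\mathcal Hom(E,E)[-1]\xrightarrow{\;\alpha(E)\;}\Omega_X\to G^\bullet\to\mathcal Hom(E,E).$$ *Differential operators.* Let $\mathcal D(E)$ be the sheaf of first-order differential operators on $E$ with diagonal symbol: its sections over an open $U$ are the pairs $(t,\varphi)$ with $t\in\mathrm{Hom}_{\mathcal O_U}(\Omega_U,\mathcal O_U)$ and $\varphi:E|_U\to E|_U$ a $k$-linear morphism of sheaves such that $\varphi(ae)=a\varphi(e)+t(da)\,e$ for all local sections $a$ of $\mathcal O_X$ and $e$ of $E$; the $\mathcal O_X$-module structure is $a\cdot(t,\varphi)=(at,a\varphi)$. Then $\mathcal D(E)$ is locally free of finite rank, and the derived dual $(G^\bullet)^\vee=R\mathcal Hom(G^\bullet,\mathcal O_X)$ is isomorphic in $D(X)$ to the one-term complex $\mathcal D(E)$ placed in degree $0$. (The derived dual is represented by $\mathcal Hom^\bullet(G^\bullet,I^\bullet)$, for any injective resolution $I^\bullet$ of $\mathcal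 O_X$.) -/

import Mathlib

open CategoryTheory AlgebraicGeometry Opposite TopologicalSpace Limits
open scoped TensorProduct
universe w u

namespace AtiyahDual

noncomputable section

/-- Restriction of functions. -/
def resO (X : Scheme.{u}) {V U : X.Opens} (h : V ≤ U) : Γ(X, U) →+* Γ(X, V) :=
  (X.presheaf.map (homOfLE h).op).hom

/-- Restriction of sections of a sheaf of modules. -/
def res {X : Scheme.{u}} (M : X.Modules) {V U : X.Opens} (h : V ≤ U) : Γ(M, U) →+ Γ(M, V) :=
  (M.presheaf.map (homOfLE h).op).hom

section basics
variable {X : Scheme.{u}} (M : X.Modules) {W V U : X.Opens}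

lemma res_smul (h : V ≤ U) (a : Γ(X, U)) (m : Γ(M, U)) :
    res M h (a • m) = resO X h a • res M h m :=
  Scheme.Modules.map_smul M (homOfLE h) a m

lemma res_res (h : V ≤ U) (h' : W ≤ V) (m : Γ(M, U)) :
    res M h' (res M h m) = res M (h'.trans h) m := by
  simp only [res, ← AddCommGrpCat.comp_apply, ← Functor.map_comp]; rfl

lemma res_self (h : U ≤ U) (m : Γ(M, U)) : res M h m = m := by
  have : (homOfLE h).op = 𝟙 (op U) := rfl
  simp only [res, this, CategoryTheory.Functor.map_id]; rfl

lemma resO_resO (h : V ≤ U) (h' : W ≤ V) (a : Γ(X, U)) :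
    resO X h' (resO X h a) = resO X (h'.trans h) a := by
  simp only [resO, ← CommRingCat.comp_apply, ← Functor.map_comp]; rfl

lemma resO_self (h : U ≤ U) (a : Γ(X, U)) : resO X h a = a := by
  have : (homOfLE h).op = 𝟙 (op U) := rfl
  simp only [resO, this, CategoryTheory.Functor.map_id]; rfl

lemma app_res {M N : X.Modules} (f : M ⟶ N) (h : V ≤ U) (m : Γ(M, U)) :
    f.app V (res M h m) = res N h (f.app U m) :=
  PresheafOfModules.naturality_apply f.val (homOfLE h).op m

/-- Sections glue uniquely. -/
lemma glue {ι : Type u} (U : ι → X.Opens) {V : X.Opens} (hU : ∀ i, U i ≤ V)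
    (hV : V ≤ iSup U) (s : ∀ i, Γ(M, U i))
    (hs : ∀ i j, res M (inf_le_left : U i ⊓ U j ≤ U i) (s i) =
      res M (inf_le_right : U i ⊓ U j ≤ U j) (s j)) :
    ∃! t : Γ(M, V), ∀ i, res M (hU i) t = s i :=
  TopCat.Sheaf.existsUnique_gluing' (⟨M.presheaf, M.isSheaf⟩ : TopCat.Sheaf Ab X) U V
    (fun i => homOfLE (hU i)) hV s hs

lemma eq_of_res {ι : Type u} (U : ι → X.Opens) {V : X.Opens} (hU : ∀ i, U i ≤ V)
    (hV : V ≤ iSup U) (s t : Γ(M, V)) (h : ∀ i, res M (hU i) s = res M (hU i) t) : s = t :=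
  TopCat.Sheaf.eq_of_locally_eq' (⟨M.presheaf, M.isSheaf⟩ : TopCat.Sheaf Ab X) U V
    (fun i => homOfLE (hU i)) hV s t h

end basics

/-- Constructor for sheaves of modules out of sections, restrictions and unique gluing. -/
structure Data (X : Scheme.{u}) where
  sec : X.Opens → Type u
  [grp : ∀ U, AddCommGroup (sec U)]
  [mod : ∀ U, Module Γ(X, U) (sec U)]
  rs : ∀ {V U : X.Opens}, V ≤ U → (sec U →+ sec V)
  rs_self : ∀ {U : X.Opens} (h : U ≤ U) (s : sec U), rs h s = s
  rs_rs : ∀ {W V U : X.Opens} (h : V ≤ U) (h' : W ≤ V) (s : sec U),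
    rs h' (rs h s) = rs (h'.trans h) s
  rs_smul : ∀ {V U : X.Opens} (h : V ≤ U) (a : Γ(X, U)) (s : sec U),
    rs h (a • s) = resO X h a • rs h s
  rs_glue : ∀ {ι : Type u} (U : ι → X.Opens) (s : ∀ i, sec (U i)),
    (∀ i j, rs (inf_le_left : U i ⊓ U j ≤ U i) (s i) =
      rs (inf_le_right : U i ⊓ U j ≤ U j) (s j)) →
    ∃! t : sec (iSup U), ∀ i, rs (le_iSup U i) t = s i

attribute [instance] Data.grp Data.mod

namespace Data

/-- The underlying presheaf of abelian groups. -/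
def toPsh {X : Scheme.{u}} (D : Data X) : X.Opensᵒᵖ ⥤ Ab.{u} where
  obj U := AddCommGrpCat.of (D.sec U.unop)
  map f := AddCommGrpCat.ofHom (D.rs (leOfHom f.unop))
  map_id U := by ext s; exact D.rs_self _ s
  map_comp f g := by ext s; exact (D.rs_rs (leOfHom f.unop) (leOfHom g.unop) s).symm

instance {X : Scheme.{u}} (D : Data X) (U : X.Opensᵒᵖ) :
    Module (X.ringCatSheaf.obj.obj U) (D.toPsh.obj U) :=
  inferInstanceAs (Module Γ(X, U.unop) (D.sec U.unop))

/-- The associated sheaf of modules. -/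
def toModules {X : Scheme.{u}} (D : Data X) : X.Modules where
  val := PresheafOfModules.ofPresheaf (R := X.ringCatSheaf.obj) D.toPsh
    (fun _ _ f a m => D.rs_smul (leOfHom f.unop) a m)
  isSheaf := by
    refine (TopCat.Presheaf.isSheaf_iff_isSheafUniqueGluing (X := X.carrier) D.toPsh).2 ?_
    intro ι U s hs
    exact D.rs_glue U s hs

end Data

/-- The structure sheaf, as a sheaf of modules over itself. -/
def structureSheaf (X : Scheme.{u}) : X.Modules := SheafOfModules.unit X.ringCatSheaf

/-- Constructor for morphisms of sheaves of modules. -/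
def mkHom {X : Scheme.{u}} {M N : X.Modules} (f : ∀ U, Γ(M, U) →+ Γ(N, U))
    (hf : ∀ U (a : Γ(X, U)) m, f U (a • m) = a • f U m)
    (hr : ∀ {V U : X.Opens} (h : V ≤ U) m, f V (res M h m) = res N h (f U m)) : M ⟶ N where
  val := { 
    app := fun U => ModuleCat.ofHom { 
      toFun := f U.unop
      map_add' := map_add (f U.unop)
      map_smul' := hf U.unop}
    naturality := fun {U V} i => by
      ext m
      exact hr (leOfHom i.unop) m }

lemma mkHom_app {X : Scheme.{u}} {M N : X.Modules} (f : ∀ U, Γ(M, U) →+ Γ(N, U)) (hf)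
    (hr) (U : X.Opens) (m : Γ(M, U)) :
    (mkHom (M := M) (N := N) f hf hr).app U m = f U m := rfl

lemma hom_ext' {X : Scheme.{u}} {M N : X.Modules} {f g : M ⟶ N}
    (h : ∀ (U : X.Opens) (m : Γ(M, U)), f.app U m = g.app U m) : f = g := by
  apply Scheme.Modules.hom_ext
  intro U
  ext m
  exact h U m

/-- Families of additive maps `Γ(M, V) → Γ(N, V)`, `V ≤ U`, compatible with restriction: homomorphisms `M|_U → N|_U` of abelian sheaves. -/
def localAddHom {X : Scheme.{u}} (M N : X.Modules) (U : X.Opens) :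
    AddSubgroup (∀ V : {V : X.Opens // V ≤ U}, Γ(M, V.1) →+ Γ(N, V.1)) where
  carrier := {φ | ∀ (V W : {V : X.Opens // V ≤ U}) (h : W.1 ≤ V.1) (m : Γ(M, V.1)),
    φ W (res M h m) = res N h (φ V m)}
  zero_mem' := by intro V W h m; simp
  add_mem' := by
    intro φ ψ hφ hψ V W h m
    simp only [Pi.add_apply, AddMonoidHom.add_apply, map_add, hφ V W h m, hψ V W h m]
  neg_mem' := by
    intro φ hφ V W h m
    simp only [Pi.neg_apply, AddMonoidHom.neg_apply, map_neg, hφ V W h m]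

/-- Homomorphisms `M|_U → N|_U` of `O_U`-modules: compatible families of linear maps
`Γ(M, V) → Γ(N, V)`, `V ≤ U`. -/
def localHom {X : Scheme.{u}} (M N : X.Modules) (U : X.Opens) :
    AddSubgroup (∀ V : {V : X.Opens // V ≤ U}, Γ(M, V.1) →+ Γ(N, V.1)) where
  carrier := {φ | φ ∈ localAddHom M N U ∧ ∀ (V : {V : X.Opens // V ≤ U}) (a : Γ(X, V.1)) (m : Γ(M, V.1)),
    φ V (a • m) = a • φ V m}
  zero_mem' := ⟨zero_mem _, by intro V a m; simp⟩
  add_mem' := by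
    intro φ ψ hφ hψ
    refine ⟨add_mem hφ.1 hψ.1, fun V a m => ?_⟩
    simp only [Pi.add_apply, AddMonoidHom.add_apply, hφ.2, hψ.2, smul_add]
  neg_mem' := by
    intro φ hφ
    refine ⟨neg_mem hφ.1, fun V a m => ?_⟩
    simp only [Pi.neg_apply, AddMonoidHom.neg_apply, hφ.2, smul_neg]

section localHom
variable {X : Scheme.{u}} {M N : X.Modules} {U V : X.Opens}

/-- The family of additive maps obtained by multiplying the values by a function. -/
def famSmul (a : Γ(X, U)) : (∀ V : {V : X.Opens // V ≤ U}, Γ(M, V.1) →+ Γ(N, V.1)) →+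
    (∀ V : {V : X.Opens // V ≤ U}, Γ(M, V.1) →+ Γ(N, V.1)) where
  toFun φ V := AddMonoidHom.mk' (fun m => resO X V.2 a • φ V m) (by intros; simp)
  map_zero' := by ext; simp
  map_add' _ _ := by ext; simp

lemma famSmul_apply (a : Γ(X, U)) (φ : ∀ V : {V : X.Opens // V ≤ U}, Γ(M, V.1) →+ Γ(N, V.1)) (V : {V : X.Opens // V ≤ U})
    (m : Γ(M, V.1)) : famSmul a φ V m = resO X V.2 a • φ V m := rfl

/-- Restriction of families to a smaller open subset. -/
def famRes (h : V ≤ U) : (∀ W : {V : X.Opens // V ≤ U}, Γ(M, W.1) →+ Γ(N, W.1)) →+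
    (∀ W : {W : X.Opens // W ≤ V}, Γ(M, W.1) →+ Γ(N, W.1)) where
  toFun φ W := φ ⟨W.1, le_trans W.2 h⟩
  map_zero' := rfl
  map_add' _ _ := rfl

lemma famRes_apply (h : V ≤ U) (φ : ∀ W : {V : X.Opens // V ≤ U}, Γ(M, W.1) →+ Γ(N, W.1)) (W : {W : X.Opens // W ≤ V}) :
    famRes h φ W = φ ⟨W.1, le_trans W.2 h⟩ := rfl

lemma famSmul_mem_localAddHom (a : Γ(X, U)) {φ : ∀ V : {V : X.Opens // V ≤ U}, Γ(M, V.1) →+ Γ(N, V.1)}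
    (hφ : φ ∈ localAddHom M N U) : famSmul a φ ∈ localAddHom M N U := by
  intro V W h m
  rw [famSmul_apply, famSmul_apply, hφ V W h m, res_smul, resO_resO]

lemma famSmul_mem_localHom (a : Γ(X, U)) {φ : ∀ V : {V : X.Opens // V ≤ U}, Γ(M, V.1) →+ Γ(N, V.1)}
    (hφ : φ ∈ localHom M N U) : famSmul a φ ∈ localHom M N U := by
  refine ⟨famSmul_mem_localAddHom a hφ.1, fun V b m => ?_⟩
  rw [famSmul_apply, famSmul_apply, hφ.2, smul_comm]

lemma famRes_mem_localAddHom (h : V ≤ U) {φ : ∀ V : {V : X.Opens // V ≤ U}, Γ(M, V.1) →+ Γ(N, V.1)}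
    (hφ : φ ∈ localAddHom M N U) : famRes h φ ∈ localAddHom M N V :=
  fun W W' h' m => hφ ⟨W.1, le_trans W.2 h⟩ ⟨W'.1, le_trans W'.2 h⟩ h' m

lemma famRes_mem_localHom (h : V ≤ U) {φ : ∀ V : {V : X.Opens // V ≤ U}, Γ(M, V.1) →+ Γ(N, V.1)}
    (hφ : φ ∈ localHom M N U) : famRes h φ ∈ localHom M N V :=
  ⟨famRes_mem_localAddHom h hφ.1, fun W a m => hφ.2 ⟨W.1, le_trans W.2 h⟩ a m⟩

instance : Module Γ(X, U) (localAddHom M N U) where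
  smul a φ := ⟨famSmul a φ.1, famSmul_mem_localAddHom a φ.2⟩
  one_smul φ := by
    ext V m; change resO X V.2 1 • φ.1 V m = _; rw [map_one, one_smul]
  mul_smul a b φ := by
    ext V m
    change resO X V.2 (a * b) • φ.1 V m = resO X V.2 a • resO X V.2 b • φ.1 V m
    rw [map_mul, mul_smul]
  smul_zero a := by ext V m; change resO X V.2 a • (0 : Γ(N, V.1)) = 0; rw [smul_zero]
  smul_add a φ ψ := by
    ext V m
    change resO X V.2 a • (φ.1 V m + ψ.1 V m) = resO X V.2 a • φ.1 V m + resO X V.2 a • ψ.1 V m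
    rw [smul_add]
  add_smul a b φ := by
    ext V m
    change resO X V.2 (a + b) • φ.1 V m = resO X V.2 a • φ.1 V m + resO X V.2 b • φ.1 V m
    rw [map_add, add_smul]
  zero_smul φ := by ext V m; change resO X V.2 0 • φ.1 V m = 0; rw [map_zero, zero_smul]

instance : Module Γ(X, U) (localHom M N U) where
  smul a φ := ⟨famSmul a φ.1, famSmul_mem_localHom a φ.2⟩
  one_smul φ := by
    ext V m; change resO X V.2 1 • φ.1 V m = _; rw [map_one, one_smul]
  mul_smul a b φ := by
    ext V m
    change resO X V.2 (a * b) • φ.1 V m = resO X V.2 a • resO X V.2 b • φ.1 V m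
    rw [map_mul, mul_smul]
  smul_zero a := by ext V m; change resO X V.2 a • (0 : Γ(N, V.1)) = 0; rw [smul_zero]
  smul_add a φ ψ := by
    ext V m
    change resO X V.2 a • (φ.1 V m + ψ.1 V m) = resO X V.2 a • φ.1 V m + resO X V.2 a • ψ.1 V m
    rw [smul_add]
  add_smul a b φ := by
    ext V m
    change resO X V.2 (a + b) • φ.1 V m = resO X V.2 a • φ.1 V m + resO X V.2 b • φ.1 V m
    rw [map_add, add_smul]
  zero_smul φ := by ext V m; change resO X V.2 0 • φ.1 V m = 0; rw [map_zero, zero_smul]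

lemma famRes_famSmul (h : V ≤ U) (a : Γ(X, U)) (φ : ∀ W : {V : X.Opens // V ≤ U}, Γ(M, W.1) →+ Γ(N, W.1)) :
    famRes h (famSmul a φ) = famSmul (resO X h a) (famRes h φ) := by
  funext W; ext m
  rw [famRes_apply, famSmul_apply, famSmul_apply, resO_resO]
  rfl

/-- Homomorphisms of abelian sheaves glue uniquely. -/
lemma localAddHom_glue {ι : Type u} (U : ι → X.Opens)
    (s : ∀ i, ∀ V : {V : X.Opens // V ≤ U i}, Γ(M, V.1) →+ Γ(N, V.1)) (hs : ∀ i, s i ∈ localAddHom M N (U i))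
    (hc : ∀ i j, famRes (inf_le_left : U i ⊓ U j ≤ U i) (s i) =
      famRes (inf_le_right : U i ⊓ U j ≤ U j) (s j)) :
    ∃ t ∈ localAddHom M N (iSup U), ∀ i, famRes (le_iSup U i) t = s i := by
  have cov : ∀ W : {V : X.Opens // V ≤ iSup U}, W.1 ≤ ⨆ i, W.1 ⊓ U i := by
    intro W
    rw [← inf_iSup_eq]
    exact le_inf le_rfl W.2
  have hc' : ∀ i j (W : X.Opens) (hi : W ≤ U i) (hj : W ≤ U j), s i ⟨W, hi⟩ = s j ⟨W, hj⟩ := by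
    intro i j W hi hj
    exact congr_fun (hc i j) ⟨W, le_inf hi hj⟩
  have ex : ∀ (W : {V : X.Opens // V ≤ iSup U}) (m : Γ(M, W.1)), ∃! n : Γ(N, W.1), ∀ i,
      res N (inf_le_left : W.1 ⊓ U i ≤ W.1) n =
        s i ⟨W.1 ⊓ U i, inf_le_right⟩ (res M inf_le_left m) := by
    intro W m
    refine glue N (fun i => W.1 ⊓ U i) (fun i => inf_le_left) (cov W) _ ?_
    intro i j
    have hl : (W.1 ⊓ U i) ⊓ (W.1 ⊓ U j) ≤ U i := inf_le_left.trans inf_le_right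
    have hr : (W.1 ⊓ U i) ⊓ (W.1 ⊓ U j) ≤ U j := inf_le_right.trans inf_le_right
    rw [← hs i ⟨_, inf_le_right⟩ ⟨_, hl⟩ inf_le_left, ← hs j ⟨_, inf_le_right⟩ ⟨_, hr⟩ inf_le_right,
      res_res, res_res, hc' i j _ hl hr]
  choose f hf hf' using ex
  have huniq : ∀ (W : {V : X.Opens // V ≤ iSup U}) (n n' : Γ(N, W.1)), (∀ i,
      res N (inf_le_left : W.1 ⊓ U i ≤ W.1) n = res N (inf_le_left : W.1 ⊓ U i ≤ W.1) n') →
      n = n' := fun W n n' h =>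
    eq_of_res N (fun i => W.1 ⊓ U i) (fun i => inf_le_left) (cov W) n n' h
  refine ⟨fun W => AddMonoidHom.mk' (f W) ?_, ?_, ?_⟩
  · intro m m'
    apply huniq
    intro i
    simp only [map_add, hf]
  · intro V W h m
    apply huniq
    intro i
    have e : W.1 ⊓ U i ≤ V.1 ⊓ U i := inf_le_inf_right _ h
    simp only [AddMonoidHom.mk'_apply, hf]
    rw [res_res, res_res, ← res_res N (inf_le_left : V.1 ⊓ U i ≤ V.1) e, hf,
      ← hs i ⟨_, inf_le_right⟩ ⟨_, inf_le_right⟩ e, res_res]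
  · intro i
    funext W
    ext m
    rw [famRes_apply, AddMonoidHom.mk'_apply]
    have hW : W.1 ≤ W.1 ⊓ U i := le_inf le_rfl W.2
    have h2 := hf ⟨W.1, le_trans W.2 (le_iSup U i)⟩ m i
    have h3 := congr_arg (res N hW) h2
    rw [← hs i ⟨_, inf_le_right⟩ ⟨W.1, W.2⟩ hW, res_res, res_res, res_self, res_self] at h3
    exact h3

/-- Families are determined by their restrictions to an open cover. -/
lemma localAddHom_eq_of_famRes {ι : Type u} (U : ι → X.Opens)
    {s t : ∀ V : {V : X.Opens // V ≤ iSup U}, Γ(M, V.1) →+ Γ(N, V.1)}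
    (hs : s ∈ localAddHom M N (iSup U)) (ht : t ∈ localAddHom M N (iSup U))
    (h : ∀ i, famRes (le_iSup U i) s = famRes (le_iSup U i) t) : s = t := by
  funext W
  ext m
  refine eq_of_res N (fun i => W.1 ⊓ U i) (fun i => inf_le_left) ?_ _ _ ?_
  · rw [← inf_iSup_eq]
    exact le_inf le_rfl W.2
  · intro i
    have := DFunLike.congr_fun (congr_fun (h i) ⟨W.1 ⊓ U i, inf_le_right⟩) (res M inf_le_left m)
    rw [famRes_apply, famRes_apply] at this
    have e : W.1 ⊓ U i ≤ iSup U := inf_le_left.trans W.2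
    rw [← hs W ⟨W.1 ⊓ U i, e⟩ inf_le_left, ← ht W ⟨W.1 ⊓ U i, e⟩ inf_le_left]
    exact this

/-- Linearity is a local property. -/
lemma localHom_of_famRes {ι : Type u} (U : ι → X.Opens)
    {t : ∀ V : {V : X.Opens // V ≤ iSup U}, Γ(M, V.1) →+ Γ(N, V.1)} (ht : t ∈ localAddHom M N (iSup U))
    (h : ∀ i, famRes (le_iSup U i) t ∈ localHom M N (U i)) : t ∈ localHom M N (iSup U) := by
  refine ⟨ht, fun W a m => ?_⟩
  refine eq_of_res N (fun i => W.1 ⊓ U i) (fun i => inf_le_left) ?_ _ _ ?_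
  · rw [← inf_iSup_eq]
    exact le_inf le_rfl W.2
  · intro i
    have e : W.1 ⊓ U i ≤ iSup U := inf_le_left.trans W.2
    have := (h i).2 ⟨W.1 ⊓ U i, inf_le_right⟩ (resO X inf_le_left a) (res M inf_le_left m)
    rw [famRes_apply] at this
    rw [res_smul, ← ht W ⟨W.1 ⊓ U i, e⟩ inf_le_left, ← ht W ⟨W.1 ⊓ U i, e⟩ inf_le_left, res_smul]
    exact this

end localHom

/-- The sheaf `Hom(M, N)`, with sections `Hom_{O_U}(M|_U, N|_U)` over `U`. -/
def ihom {X : Scheme.{u}} (M N : X.Modules) : X.Modules :=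
  Data.toModules
  { sec := fun U => localHom M N U
    rs := fun h => AddMonoidHom.mk' (fun φ => ⟨famRes h φ.1, famRes_mem_localHom h φ.2⟩)
      (fun _ _ => rfl)
    rs_self := fun _ _ => rfl
    rs_rs := fun _ _ _ => rfl
    rs_smul := fun h a φ => Subtype.ext (famRes_famSmul h a φ.1)
    rs_glue := by
      intro ι U s hs
      obtain ⟨t, ht, hts⟩ := localAddHom_glue U (fun i => (s i).1) (fun i => (s i).2.1)
        (fun i j => congr_arg Subtype.val (hs i j))
      refine ⟨⟨t, localHom_of_famRes U ht (fun i => by rw [hts]; exact (s i).2)⟩,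
        fun i => Subtype.ext (hts i), fun t' ht' => Subtype.ext ?_⟩
      refine localAddHom_eq_of_famRes U t'.2.1 ht fun i => ?_
      rw [hts]
      exact congr_arg Subtype.val (ht' i) }

/-- Application of a local homomorphism to a section. -/
def ev {X : Scheme.{u}} {M N : X.Modules} {U : X.Opens} (φ : Γ(ihom M N, U)) {V : X.Opens}
    (h : V ≤ U) : Γ(M, V) →+ Γ(N, V) :=
  (show localHom M N U from φ).1 ⟨V, h⟩

section ev
variable {X : Scheme.{u}} {M N : X.Modules} {U V W : X.Opens}

/-- Constructor for sections of `Hom(M, N)`. -/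
def mkLocal (f : ∀ V : X.Opens, V ≤ U → (Γ(M, V) →+ Γ(N, V)))
    (hf : ∀ (V : X.Opens) (h : V ≤ U) (a : Γ(X, V)) m, f V h (a • m) = a • f V h m)
    (hr : ∀ (V W : X.Opens) (h : V ≤ U) (h' : W ≤ V) m,
      f W (h'.trans h) (res M h' m) = res N h' (f V h m)) : Γ(ihom M N, U) :=
  (⟨fun V => f V.1 V.2, fun V W h m => hr V.1 W.1 V.2 h m, fun V a m => hf V.1 V.2 a m⟩ :
    localHom M N U)

lemma ev_mkLocal (f : ∀ V : X.Opens, V ≤ U → (Γ(M, V) →+ Γ(N, V))) (hf) (hr) (h : V ≤ U)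
    (m : Γ(M, V)) : ev (mkLocal (M := M) (N := N) f hf hr) h m = f V h m := rfl

lemma local_ext {φ ψ : Γ(ihom M N, U)}
    (H : ∀ (V : X.Opens) (h : V ≤ U) (m : Γ(M, V)), ev φ h m = ev ψ h m) : φ = ψ := by
  refine Subtype.ext (funext fun V => ?_)
  ext m
  exact H V.1 V.2 m

lemma ev_smul_right (φ : Γ(ihom M N, U)) (h : V ≤ U) (a : Γ(X, V)) (m : Γ(M, V)) :
    ev φ h (a • m) = a • ev φ h m :=
  (show localHom M N U from φ).2.2 ⟨V, h⟩ a m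

lemma ev_res_right (φ : Γ(ihom M N, U)) (h : V ≤ U) (h' : W ≤ V) (m : Γ(M, V)) :
    ev φ (h'.trans h) (res M h' m) = res N h' (ev φ h m) :=
  (show localHom M N U from φ).2.1 ⟨V, h⟩ ⟨W, h'.trans h⟩ h' m

lemma ev_add (φ ψ : Γ(ihom M N, U)) (h : V ≤ U) (m : Γ(M, V)) :
    ev (φ + ψ) h m = ev φ h m + ev ψ h m := rfl

lemma ev_zero (h : V ≤ U) (m : Γ(M, V)) : ev (0 : Γ(ihom M N, U)) h m = 0 := rfl

lemma ev_smul (a : Γ(X, U)) (φ : Γ(ihom M N, U)) (h : V ≤ U) (m : Γ(M, V)) :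
    ev (a • φ) h m = resO X h a • ev φ h m := rfl

lemma ev_res (φ : Γ(ihom M N, U)) (h : V ≤ U) (h' : W ≤ V) (m : Γ(M, W)) :
    ev (res (ihom M N) h φ) h' m = ev φ (h'.trans h) m := rfl

end ev

/-- Functoriality of `Hom(-, -)`: composition on both sides. -/
def ihomMap {X : Scheme.{u}} {M M' N N' : X.Modules} (f : M' ⟶ M) (g : N ⟶ N') :
    ihom M N ⟶ ihom M' N' :=
  mkHom (fun U => AddMonoidHom.mk' (fun φ => mkLocal
      (fun V h => (g.app V).hom.comp ((ev φ h).comp (f.app V).hom))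
      (fun V h a m => by
        change g.app V (ev φ h (f.app V (a • m))) = a • g.app V (ev φ h (f.app V m))
        rw [Scheme.Modules.Hom.app_smul, ev_smul_right, Scheme.Modules.Hom.app_smul])
      (fun V W h h' m => by
        change g.app W (ev φ _ (f.app W (res M' h' m))) = res N' h' (g.app V (ev φ h (f.app V m)))
        rw [app_res, ev_res_right φ h h', app_res]))
      (fun φ ψ => local_ext fun V h m => by
        simp only [ev_mkLocal, ev_add]
        exact map_add (g.app V).hom _ _))
    (fun U a φ => local_ext fun V h m => by
      change g.app V (ev (a • φ) h (f.app V m)) = resO X h a • g.app V (ev φ h (f.app V m))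
      rw [ev_smul, Scheme.Modules.Hom.app_smul])
    (fun h φ => rfl)

section ihomMap
variable {X : Scheme.{u}}

lemma ihomMap_app {M M' N N' : X.Modules} (f : M' ⟶ M) (g : N ⟶ N') {U V : X.Opens}
    (φ : Γ(ihom M N, U)) (h : V ≤ U) (m : Γ(M', V)) :
    ev ((ihomMap f g).app U φ) h m = g.app V (ev φ h (f.app V m)) := rfl

lemma ihom_hom_ext {P M N : X.Modules} {f g : P ⟶ ihom M N}
    (H : ∀ (U : X.Opens) (p : Γ(P, U)) (V : X.Opens) (h : V ≤ U) (m : Γ(M, V)),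
      ev (f.app U p) h m = ev (g.app U p) h m) : f = g :=
  hom_ext' fun U p => local_ext fun V h m => H U p V h m

lemma ihomMap_comp {M M' M'' N N' N'' : X.Modules} (f : M' ⟶ M) (f' : M'' ⟶ M') (g : N ⟶ N')
    (g' : N' ⟶ N'') : ihomMap f g ≫ ihomMap f' g' = ihomMap (f' ≫ f) (g ≫ g') := rfl

lemma ihomMap_zero_left {M M' N N' : X.Modules} (g : N ⟶ N') :
    ihomMap (0 : M' ⟶ M) g = 0 :=
  ihom_hom_ext fun U p V h m => by
    rw [ihomMap_app]
    change g.app V (ev p h 0) = 0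
    rw [map_zero, map_zero]

lemma ihomMap_zero_right {M M' N N' : X.Modules} (f : M' ⟶ M) :
    ihomMap f (0 : N ⟶ N') = 0 :=
  rfl

end ihomMap

/-- The sheafification of a presheaf of modules. -/
def shf {X : Scheme.{u}} (P : X.PresheafOfModules) : X.Modules :=
  (PresheafOfModules.sheafification (𝟙 X.ringCatSheaf.obj)).obj P

/-- The canonical map from a presheaf of modules to its sheafification, on sections. -/
def toShf {X : Scheme.{u}} (P : X.PresheafOfModules) (U : X.Opens) :
    P.obj (op U) →+ Γ(shf P, U) :=
  (((PresheafOfModules.sheafificationAdjunction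
    (𝟙 X.ringCatSheaf.obj)).unit.app P).app (op U)).hom.toAddMonoidHom

/-- The morphism from the sheafification induced by a morphism to a sheaf. -/
def shfLift {X : Scheme.{u}} {P : X.PresheafOfModules} {N : X.Modules} (f : P ⟶ N.val) :
    shf P ⟶ N :=
  (PresheafOfModules.sheafificationHomEquiv (𝟙 X.ringCatSheaf.obj)).symm f

section shf
variable {X : Scheme.{u}} {P : X.PresheafOfModules} {U V : X.Opens}

lemma toShf_res (h : V ≤ U) (p : P.obj (op U)) :
    toShf P V (P.map (homOfLE h).op p) = res (shf P) h (toShf P U p) :=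
  PresheafOfModules.naturality_apply ((PresheafOfModules.sheafificationAdjunction
    (𝟙 X.ringCatSheaf.obj)).unit.app P) (homOfLE h).op p

lemma toShf_smul (a : Γ(X, U)) (p : P.obj (op U)) :
    toShf P U ((show X.ringCatSheaf.obj.obj (op U) from a) • p) = a • toShf P U p :=
  map_smul (((PresheafOfModules.sheafificationAdjunction
    (𝟙 X.ringCatSheaf.obj)).unit.app P).app (op U)).hom _ p

lemma shfLift_toShf {N : X.Modules} (f : P ⟶ N.val) (p : P.obj (op U)) :
    (shfLift f).app U (toShf P U p) = f.app (op U) p := by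
  have h := (PresheafOfModules.sheafificationHomEquiv (𝟙 X.ringCatSheaf.obj)).apply_symm_apply f
  have h2 := congr_arg (fun g => g.app (op U)) h
  exact congr_arg (fun g => g.hom p) h2

lemma isIso_sheafificationHomEquiv_symm {C : Type u} [Category.{u} C] {J : GrothendieckTopology C}
    {R : Sheaf J RingCat.{u}} [J.WEqualsLocallyBijective AddCommGrpCat.{u}]
    [HasSheafify J AddCommGrpCat.{u}] {P : PresheafOfModules.{u} R.obj} {N : SheafOfModules.{u} R}
    (f : P ⟶ N.val) (hW : J.W ((PresheafOfModules.toPresheaf _).map f)) :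
    IsIso ((PresheafOfModules.sheafificationHomEquiv (𝟙 R.obj) (F := N)).symm f) := by
  have : IsIso ((SheafOfModules.toSheaf.{u} R).map
      ((PresheafOfModules.sheafificationHomEquiv (𝟙 R.obj) (F := N)).symm f)) := by
    have e := PresheafOfModules.toSheaf_map_sheafificationHomEquiv_symm (𝟙 R.obj) (F := N) f
    have e2 := e.trans (((sheafificationAdjunction J AddCommGrpCat.{u}).homEquiv_counit
      (X := P.presheaf) (Y := (SheafOfModules.toSheaf R).obj N)
      (g := (PresheafOfModules.toPresheaf _).map f)))
    have h1 : IsIso ((presheafToSheaf J AddCommGrpCat.{u}).map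
        ((PresheafOfModules.toPresheaf _).map f)) := (GrothendieckTopology.W_iff _ _).1 hW
    refine @Eq.ndrec _ _ (fun g => IsIso g) ?_ _ e2.symm
    exact @IsIso.comp_isIso _ _ _ _ _ _ _ h1 (inferInstance)
  exact isIso_of_reflects_iso _ (SheafOfModules.toSheaf.{u} R)

lemma isIso_shfLift {N : X.Modules} (f : P ⟶ N.val)
    (hinj : ∀ (U : X.Opens) (p : P.obj (op U)), f.app (op U) p = 0 →
      ∀ x ∈ U, ∃ (V : X.Opens) (h : V ≤ U), x ∈ V ∧ P.map (homOfLE h).op p = 0)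
    (hsurj : ∀ (U : X.Opens) (n : Γ(N, U)), ∀ x ∈ U, ∃ (V : X.Opens) (h : V ≤ U), x ∈ V ∧
      ∃ p : P.obj (op V), f.app (op V) p = res N h n) : IsIso (shfLift f) := by
  have hW : (Opens.grothendieckTopology X).W ((PresheafOfModules.toPresheaf _).map f) := by
    rw [GrothendieckTopology.W_iff_isLocallyBijective]
    constructor
    · constructor
      intro U p q hpq x hx
      have h0 : f.app U ((show P.obj U from p) - (show P.obj U from q)) = 0 := by
        rw [map_sub]
        exact sub_eq_zero.2 hpq
      obtain ⟨V, h, hxV, hp⟩ := hinj U.unop _ h0 x hx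
      refine ⟨V, homOfLE h, ?_, hxV⟩
      rw [map_sub] at hp
      exact sub_eq_zero.1 hp
    · constructor
      intro U n x hx
      obtain ⟨V, h, hxV, p, hp⟩ := hsurj U n x hx
      exact ⟨V, homOfLE h, ⟨p, hp⟩, hxV⟩
  exact isIso_sheafificationHomEquiv_symm (J := Opens.grothendieckTopology X)
    (R := X.ringCatSheaf) f hW

end shf

/-- The morphism `M ⟶ Hom(N, P)` given by a bilinear map of sheaves `M × N → P`. -/
def ofBilin {X : Scheme.{u}} {M N P : X.Modules} (b : ∀ U : X.Opens, Γ(M, U) → Γ(N, U) → Γ(P, U))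
    (hal : ∀ U m m' n, b U (m + m') n = b U m n + b U m' n)
    (har : ∀ U m n n', b U m (n + n') = b U m n + b U m n')
    (hsl : ∀ U (a : Γ(X, U)) m n, b U (a • m) n = a • b U m n)
    (hsr : ∀ U (a : Γ(X, U)) m n, b U m (a • n) = a • b U m n)
    (hr : ∀ {V U : X.Opens} (h : V ≤ U) m n, b V (res M h m) (res N h n) = res P h (b U m n)) :
    M ⟶ ihom N P :=
  mkHom (fun U => AddMonoidHom.mk' (fun m => mkLocal
      (fun V h => AddMonoidHom.mk' (fun n => b V (res M h m) n) (fun n n' => har _ _ _ _))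
      (fun V h a n => hsr _ _ _ _)
      (fun V W h h' n => by
        simp only [AddMonoidHom.mk'_apply]
        rw [← res_res M h h', hr]))
      (fun m m' => local_ext fun V h n => by
        change b V (res M h (m + m')) n = b V (res M h m) n + b V (res M h m') n
        rw [map_add, hal]))
    (fun U a m => local_ext fun V h n => by
      change b V (res M h (a • m)) n = resO X h a • b V (res M h m) n
      rw [res_smul, hsl])
    (fun h m => local_ext fun V h' n => by
      change b V (res M h' (res M h m)) n = b V (res M (h'.trans h) m) n
      rw [res_res])

section tensor
variable {X : Scheme.{u}} {M N P : X.Modules} {U V : X.Opens}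

lemma ofBilin_app (b : ∀ U : X.Opens, Γ(M, U) → Γ(N, U) → Γ(P, U)) (hal) (har) (hsl) (hsr) (hr)
    (m : Γ(M, U)) (h : V ≤ U) (n : Γ(N, V)) :
    ev ((ofBilin (M := M) (N := N) (P := P) b hal har hsl hsr hr).app U m) h n =
      b V (res M h m) n := rfl

lemma ev_app_res (f : M ⟶ ihom N P) (m : Γ(M, U)) (h : V ≤ U) {W : X.Opens} (h' : W ≤ V)
    (n : Γ(N, W)) : ev (f.app V (res M h m)) h' n = ev (f.app U m) (h'.trans h) n := by
  rw [app_res, ev_res]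

/-- Exchange of the two arguments of a bilinear map. -/
def flip (f : M ⟶ ihom N P) : N ⟶ ihom M P :=
  ofBilin (fun U n m => ev (f.app U m) le_rfl n)
    (fun U n n' m => map_add _ _ _)
    (fun U n m m' => by rw [map_add, ev_add])
    (fun U a n m => ev_smul_right _ _ _ _)
    (fun U a n m => by rw [Scheme.Modules.Hom.app_smul, ev_smul, resO_self])
    (fun h n m => by rw [ev_app_res, ev_res_right _ le_rfl h])

lemma flip_app (f : M ⟶ ihom N P) (n : Γ(N, U)) (h : V ≤ U) (m : Γ(M, V)) :
    ev ((flip f).app U n) h m = ev (f.app V m) le_rfl (res N h n) := rfl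

variable (M N) in
/-- The tensor product of two presheaves of modules. -/
def tensorPsh : X.PresheafOfModules :=
  PresheafOfModules.Monoidal.tensorObj (R := X.presheaf) M.val N.val

variable (M N) in
/-- The tensor product of sheaves of modules, the sheafification of the tensor product presheaf. -/
def tensor : X.Modules := shf (tensorPsh M N)

/-- The section `m ⊗ n` of the tensor product. -/
def tmul (m : Γ(M, U)) (n : Γ(N, U)) : Γ(tensor M N, U) :=
  toShf (tensorPsh M N) U (show Γ(M, U) ⊗[Γ(X, U)] Γ(N, U) from m ⊗ₜ[Γ(X, U)] n)

lemma add_tmul (m m' : Γ(M, U)) (n : Γ(N, U)) : tmul (m + m') n = tmul m n + tmul m' n := by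
  unfold tmul
  rw [TensorProduct.add_tmul]
  exact map_add (toShf (tensorPsh M N) U) _ _

lemma tmul_add (m : Γ(M, U)) (n n' : Γ(N, U)) : tmul m (n + n') = tmul m n + tmul m n' := by
  unfold tmul
  rw [TensorProduct.tmul_add]
  exact map_add (toShf (tensorPsh M N) U) _ _

lemma smul_tmul (a : Γ(X, U)) (m : Γ(M, U)) (n : Γ(N, U)) : tmul (a • m) n = a • tmul m n := by
  refine Eq.trans ?_ (toShf_smul (P := tensorPsh M N) a
    (show Γ(M, U) ⊗[Γ(X, U)] Γ(N, U) from m ⊗ₜ[Γ(X, U)] n))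
  rfl

lemma tmul_smul (a : Γ(X, U)) (m : Γ(M, U)) (n : Γ(N, U)) : tmul m (a • n) = a • tmul m n := by
  rw [← smul_tmul]
  unfold tmul
  rw [TensorProduct.smul_tmul]

lemma res_tmul (h : V ≤ U) (m : Γ(M, U)) (n : Γ(N, U)) :
    res (tensor M N) h (tmul m n) = tmul (res M h m) (res N h n) :=
  (toShf_res (P := tensorPsh M N) h _).symm

/-- The linear map on sections over `U` given by a bilinear map. -/
def tensorLin (f : M ⟶ ihom N P) (U : X.Opens) :
    (Γ(M, U) ⊗[Γ(X, U)] Γ(N, U)) →ₗ[Γ(X, U)] Γ(P, U) :=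
  TensorProduct.lift (LinearMap.mk₂ Γ(X, U)
      (fun (m : Γ(M, U)) (n : Γ(N, U)) => (ev (f.app U m) le_rfl n : Γ(P, U)))
      (fun m m' n => by rw [map_add, ev_add])
      (fun a m n => by rw [Scheme.Modules.Hom.app_smul, ev_smul, resO_self])
      (fun m n n' => map_add _ _ _)
      (fun a m n => ev_smul_right _ _ _ _))

lemma tensorLin_tmul (f : M ⟶ ihom N P) (U : X.Opens) (m : Γ(M, U)) (n : Γ(N, U)) :
    tensorLin f U (m ⊗ₜ n) = ev (f.app U m) le_rfl n := rfl

/-- The morphism of presheaves out of the tensor product presheaf given by a bilinear map. -/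
def tensorPshLift (f : M ⟶ ihom N P) : tensorPsh M N ⟶ P.val where
  app U := ModuleCat.ofHom (R := X.ringCatSheaf.obj.obj U) (X := (tensorPsh M N).obj U)
    (Y := P.val.obj U)
    { toFun := fun z => tensorLin f U.unop z
      map_add' := map_add (tensorLin f U.unop)
      map_smul' := map_smul (tensorLin f U.unop) }
  naturality {U V} i := by
    refine ModuleCat.MonoidalCategory.tensor_ext (fun m n => ?_)
    have h : V.unop ≤ U.unop := leOfHom i.unop
    exact (ev_app_res f (show Γ(M, U.unop) from m) h le_rfl _).trans
      (ev_res_right (f.app U.unop (show Γ(M, U.unop) from m)) le_rfl h _)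

/-- The morphism out of the tensor product given by a bilinear map. -/
def tensorLift (f : M ⟶ ihom N P) : tensor M N ⟶ P := shfLift (tensorPshLift f)

lemma tensorLift_tmul (f : M ⟶ ihom N P) (m : Γ(M, U)) (n : Γ(N, U)) :
    (tensorLift f).app U (tmul m n) = ev (f.app U m) le_rfl n :=
  shfLift_toShf (tensorPshLift f) (show Γ(M, U) ⊗[Γ(X, U)] Γ(N, U) from m ⊗ₜ[Γ(X, U)] n)

end tensor

/-- The dual `Hom(E, O_X)`. -/
def dual {X : Scheme.{u}} (E : X.Modules) : X.Modules := ihom E (structureSheaf X)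

/-- The value of a functional on a section, as a function. -/
def evO {X : Scheme.{u}} {E : X.Modules} {U V : X.Opens} (l : Γ(dual E, U)) (h : V ≤ U) :
    Γ(E, V) →ₗ[Γ(X, V)] Γ(X, V) where
  toFun e := ev (N := structureSheaf X) l h e
  map_add' e e' := map_add (ev (N := structureSheaf X) l h) e e'
  map_smul' a e := ev_smul_right (N := structureSheaf X) l h a e

section dual
variable {X : Scheme.{u}} {E : X.Modules} {U V W : X.Opens}

lemma evO_res_right (l : Γ(dual E, U)) (h : V ≤ U) (h' : W ≤ V) (e : Γ(E, V)) :
    evO l (h'.trans h) (res E h' e) = resO X h' (evO l h e) :=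
  ev_res_right (N := structureSheaf X) l h h' e

lemma evO_add (l l' : Γ(dual E, U)) (h : V ≤ U) (e : Γ(E, V)) :
    evO (l + l') h e = evO l h e + evO l' h e := rfl

lemma evO_smul (a : Γ(X, U)) (l : Γ(dual E, U)) (h : V ≤ U) (e : Γ(E, V)) :
    evO (a • l) h e = resO X h a * evO l h e := rfl

lemma evO_res (l : Γ(dual E, U)) (h : V ≤ U) (h' : W ≤ V) (e : Γ(E, W)) :
    evO (res (dual E) h l) h' e = evO l (h'.trans h) e := rfl

/-- The local homomorphism `e ↦ l(e) f`. -/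
def rankOne {F : X.Modules} (l : Γ(dual E, U)) (f : Γ(F, U)) : Γ(ihom E F, U) :=
  mkLocal (fun V h => AddMonoidHom.mk' (fun e => evO l h e • res F h f)
      (fun e e' => by rw [map_add, add_smul]))
    (fun V h a e => by simp only [AddMonoidHom.mk'_apply, map_smul, smul_assoc])
    (fun V W h h' e => by
      simp only [AddMonoidHom.mk'_apply, evO_res_right l h h', res_smul, res_res])

lemma rankOne_ev {F : X.Modules} (l : Γ(dual E, U)) (f : Γ(F, U)) (h : V ≤ U) (e : Γ(E, V)) :
    ev (rankOne l f) h e = evO l h e • res F h f := rfl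

/-- The bilinear map `(l, f) ↦ (e ↦ l(e) f)`. -/
def rankOneHom (E F : X.Modules) : dual E ⟶ ihom F (ihom E F) :=
  ofBilin (fun _ l f => rankOne l f)
    (fun U l l' f => local_ext fun V h e => by
      simp only [rankOne_ev, ev_add, evO_add, add_smul])
    (fun U l f f' => local_ext fun V h e => by
      simp only [rankOne_ev, ev_add, map_add, smul_add])
    (fun U a l f => local_ext fun V h e => by
      simp only [rankOne_ev, ev_smul, evO_smul, mul_smul])
    (fun U a l f => local_ext fun V h e => by
      simp only [rankOne_ev, ev_smul, res_smul]; rw [smul_comm])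
    (fun h l f => local_ext fun V h' e => by
      simp only [rankOne_ev, ev_res, evO_res, res_res])

/-- The canonical morphism `Hom(E, O_X) ⊗ F ⟶ Hom(E, F)`, `l ⊗ f ↦ (e ↦ l(e) f)`. -/
def dualTensorHom (E F : X.Modules) : tensor (dual E) F ⟶ ihom E F :=
  tensorLift (rankOneHom E F)

/-- The local homomorphism `l ↦ l(e) s`. -/
def evalAt {L : X.Modules} (s : Γ(L, U)) (e : Γ(E, U)) : Γ(ihom (dual E) L, U) :=
  mkLocal (fun V h => AddMonoidHom.mk' (fun l => evO l le_rfl (res E h e) • res L h s)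
      (fun l l' => by rw [evO_add, add_smul]))
    (fun V h a l => by
      simp only [AddMonoidHom.mk'_apply, evO_smul, resO_self, mul_smul])
    (fun V W h h' l => by
      simp only [AddMonoidHom.mk'_apply, evO_res, res_smul, res_res]
      rw [← evO_res_right l le_rfl h', res_res])

lemma evalAt_ev {L : X.Modules} (s : Γ(L, U)) (e : Γ(E, U)) (h : V ≤ U) (l : Γ(dual E, V)) :
    ev (evalAt s e) h l = evO l le_rfl (res E h e) • res L h s := rfl

/-- The morphism `L ⊗ E ⟶ Hom(Hom(E, O_X), L)`, `s ⊗ e ↦ (l ↦ l(e) s)`. -/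
def tensorToHomDual (L E : X.Modules) : tensor L E ⟶ ihom (dual E) L :=
  tensorLift (ofBilin (fun _ s e => evalAt s e)
    (fun U s s' e => local_ext fun V h l => by
      simp only [evalAt_ev, ev_add, map_add, smul_add])
    (fun U s e e' => local_ext fun V h l => by
      simp only [evalAt_ev, ev_add, map_add, add_smul])
    (fun U a s e => local_ext fun V h l => by
      simp only [evalAt_ev, ev_smul, res_smul]; rw [smul_comm])
    (fun U a s e => local_ext fun V h l => by
      simp only [evalAt_ev, ev_smul, res_smul, map_smul, smul_assoc])
    (fun h s e => local_ext fun V h' l => by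
      simp only [evalAt_ev, ev_res, res_res]))

/-- The contraction `Hom(E, O_X) ⊗ (L ⊗ E) ⟶ L`, `l ⊗ (s ⊗ e) ↦ l(e) s`. -/
def contraction (L E : X.Modules) : tensor (dual E) (tensor L E) ⟶ L :=
  tensorLift (flip (tensorToHomDual L E))

lemma contraction_tmul {L : X.Modules} (l : Γ(dual E, U)) (s : Γ(L, U)) (e : Γ(E, U)) :
    (contraction L E).app U (tmul l (tmul s e)) = evO l le_rfl e • s := by
  rw [contraction, tensorLift_tmul, flip_app, res_self, tensorToHomDual, tensorLift_tmul,
    ofBilin_app, evalAt_ev, res_self, res_self, res_self]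

end dual

/-- A frame of `E` over `U`: sections `e₁, …, eₙ` of `E` over `U` whose restrictions to every open
`V ≤ U` form a basis of `Γ(E, V)` over `Γ(X, V)`, that is, an isomorphism `O_U ^ n ≅ E|_U`. -/
structure IsFrame {X : Scheme.{u}} {E : X.Modules} {U : X.Opens} {n : ℕ}
    (e : Fin n → Γ(E, U)) : Prop where
  linearIndependent : ∀ (V : X.Opens) (h : V ≤ U),
    LinearIndependent Γ(X, V) (fun i => (res E h (e i) : Γ(E, V)))
  span_eq_top : ∀ (V : X.Opens) (h : V ≤ U),
    Submodule.span Γ(X, V) (Set.range (fun i => (res E h (e i) : Γ(E, V)))) = ⊤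

/-- Vector bundles: sheaves of modules that are locally free of finite rank. -/
def IsVectorBundle {X : Scheme.{u}} (E : X.Modules) : Prop :=
  ∀ x : X, ∃ U : X.Opens, x ∈ U ∧ ∃ (n : ℕ) (e : Fin n → Γ(E, U)), IsFrame e

section frame
variable {X : Scheme.{u}} {E : X.Modules} {U V W : X.Opens} {n : ℕ} {e : Fin n → Γ(E, U)}

lemma IsFrame.res (he : IsFrame e) (h : V ≤ U) : IsFrame (fun i => res E h (e i)) where
  linearIndependent W h' := by
    simp only [res_res]
    exact he.linearIndependent W (h'.trans h)
  span_eq_top W h' := by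
    simp only [res_res]
    exact he.span_eq_top W (h'.trans h)

/-- The basis of the sections over a smaller open subset given by a frame. -/
def IsFrame.basis (he : IsFrame e) (h : V ≤ U) : Module.Basis (Fin n) Γ(X, V) Γ(E, V) :=
  Module.Basis.mk (he.linearIndependent V h) (he.span_eq_top V h).ge

lemma IsFrame.basis_apply (he : IsFrame e) (h : V ≤ U) (i : Fin n) :
    he.basis h i = AtiyahDual.res E h (e i) := by
  simp [IsFrame.basis]

lemma IsFrame.coord_res (he : IsFrame e) (h : V ≤ U) (h' : W ≤ V) (i : Fin n) (s : Γ(E, V)) :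
    (he.basis (h'.trans h)).coord i (AtiyahDual.res E h' s) =
      resO X h' ((he.basis h).coord i s) := by
  have hs := (he.basis h).sum_repr s
  conv_lhs => rw [← hs]
  simp only [map_sum, res_smul, he.basis_apply, res_res]
  simp only [← he.basis_apply (h'.trans h), map_smul, Module.Basis.coord_apply,
    Module.Basis.repr_self, smul_eq_mul]
  rw [Finset.sum_eq_single i]
  · simp
  · intro j _ hj
    simp [hj]
  · simp

/-- The dual frame. -/
def IsFrame.dualFrame (he : IsFrame e) (i : Fin n) : Γ(dual E, U) :=
  mkLocal (N := structureSheaf X) (fun _ h => ((he.basis h).coord i).toAddMonoidHom)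
    (fun _ h a m => map_smul ((he.basis h).coord i) a m)
    (fun _ _ h h' m => he.coord_res h h' i m)

lemma IsFrame.evO_dualFrame (he : IsFrame e) (i : Fin n) (h : V ≤ U) (s : Γ(E, V)) :
    evO (he.dualFrame i) h s = (he.basis h).coord i s := rfl

lemma IsFrame.expand (he : IsFrame e) (h : V ≤ U) (s : Γ(E, V)) :
    ∑ i, evO (he.dualFrame i) h s • AtiyahDual.res E h (e i) = s := by
  conv_rhs => rw [← (he.basis h).sum_repr s]
  simp only [he.evO_dualFrame, he.basis_apply, Module.Basis.coord_apply]

lemma ev_sum {M N : X.Modules} {ι : Type*} (t : Finset ι) (φ : ι → Γ(ihom M N, U)) (h : V ≤ U)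
    (m : Γ(M, V)) : ev (∑ i ∈ t, φ i) h m = ∑ i ∈ t, ev (φ i) h m := by
  classical
  induction t using Finset.induction_on with
  | empty => simp [ev_zero]
  | insert a t ha ih => rw [Finset.sum_insert ha, Finset.sum_insert ha, ev_add, ih]

lemma IsFrame.sum_rankOne (he : IsFrame e) {F : X.Modules} (φ : Γ(ihom E F, U)) :
    ∑ i, rankOne (he.dualFrame i) (ev φ le_rfl (e i)) = φ := by
  refine local_ext fun V h s => ?_
  conv_rhs => rw [← he.expand h s, map_sum]
  rw [ev_sum]
  refine Finset.sum_congr rfl fun i _ => ?_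
  rw [rankOne_ev, ev_smul_right, ev_res_right φ le_rfl h]

lemma IsFrame.eq_sum_tmul (he : IsFrame e) {F : X.Modules} (z : Γ(dual E, U) ⊗[Γ(X, U)] Γ(F, U)) :
    z = ∑ i, he.dualFrame i ⊗ₜ[Γ(X, U)] ev (tensorLin (rankOneHom E F) U z) le_rfl (e i) := by
  induction z using TensorProduct.induction_on with
  | zero =>
    simp only [map_zero, ev_zero, TensorProduct.tmul_zero, Finset.sum_const_zero]
  | add z w hz hw =>
    simp only [map_add, ev_add, TensorProduct.tmul_add, Finset.sum_add_distrib]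
    rw [← hz, ← hw]
  | tmul l f =>
    have h1 : tensorLin (rankOneHom E F) U (l ⊗ₜ f) = rankOne l f := by
      rw [tensorLin_tmul, rankOneHom, ofBilin_app, res_self]
    have h2 : ∑ i, evO l le_rfl (e i) • he.dualFrame i = l := by
      refine local_ext (N := structureSheaf X) fun V h s => ?_
      refine (ev_sum (N := structureSheaf X) Finset.univ _ h s).trans ?_
      change ∑ i, evO (evO l le_rfl (e i) • he.dualFrame i) h s = evO l h s
      conv_rhs => rw [← he.expand h s, map_sum]
      refine Finset.sum_congr rfl fun i _ => ?_
      rw [evO_smul, map_smul, smul_eq_mul, mul_comm, ← evO_res_right l le_rfl h]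
    rw [h1]
    simp only [rankOne_ev, res_self, ← TensorProduct.smul_tmul]
    rw [← TensorProduct.sum_tmul, h2]

end frame

/-- For a vector bundle `E`, the canonical morphism `Hom(E, O_X) ⊗ F ⟶ Hom(E, F)` is an
isomorphism. -/
lemma isIso_dualTensorHom {X : Scheme.{u}} {E : X.Modules} (hE : IsVectorBundle E)
    (F : X.Modules) : IsIso (dualTensorHom E F) := by
  refine isIso_shfLift _ ?_ ?_
  · intro U z hz x hx
    obtain ⟨U', hx', n, e, he⟩ := hE x
    have he' := he.res (inf_le_left : U' ⊓ U ≤ U')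
    refine ⟨U' ⊓ U, inf_le_right, ⟨hx', hx⟩, ?_⟩
    have hz' : tensorLin (rankOneHom E F) (U' ⊓ U)
        ((tensorPsh (dual E) F).map (homOfLE (inf_le_right : U' ⊓ U ≤ U)).op z) = 0 := by
      refine (PresheafOfModules.naturality_apply (tensorPshLift (rankOneHom E F))
        (homOfLE (inf_le_right : U' ⊓ U ≤ U)).op z).trans ?_
      rw [hz]
      exact map_zero (res (ihom E F) (inf_le_right : U' ⊓ U ≤ U))
    refine (he'.eq_sum_tmul (F := F) ((tensorPsh (dual E) F).map
      (homOfLE (inf_le_right : U' ⊓ U ≤ U)).op z)).trans ?_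
    rw [hz']
    simp only [ev_zero, TensorProduct.tmul_zero, Finset.sum_const_zero]
    rfl
  · intro U φ x hx
    obtain ⟨U', hx', n, e, he⟩ := hE x
    have he' := he.res (inf_le_left : U' ⊓ U ≤ U')
    refine ⟨U' ⊓ U, inf_le_right, ⟨hx', hx⟩, ?_⟩
    let φ' : Γ(ihom E F, U' ⊓ U) := res (ihom E F) inf_le_right φ
    refine ⟨(∑ i, he'.dualFrame i ⊗ₜ[Γ(X, U' ⊓ U)] ev φ' le_rfl (res E inf_le_left (e i)) :
      Γ(dual E, U' ⊓ U) ⊗[Γ(X, U' ⊓ U)] Γ(F, U' ⊓ U)), ?_⟩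
    change tensorLin (rankOneHom E F) (U' ⊓ U) _ = φ'
    rw [map_sum]
    refine Eq.trans (Finset.sum_congr rfl fun i _ => ?_) (he'.sum_rankOne φ')
    rw [tensorLin_tmul, rankOneHom, ofBilin_app, res_self]

/-- For a vector bundle `E`, the trace `Hom(E, L ⊗ E) ⟶ L`, that is, the contraction
`Hom(E, O_X) ⊗ (L ⊗ E) ⟶ L` under `Hom(E, L ⊗ E) ≅ Hom(E, O_X) ⊗ (L ⊗ E)`. -/
def trace {X : Scheme.{u}} {E : X.Modules} (hE : IsVectorBundle E) (L : X.Modules) :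
    ihom E (tensor L E) ⟶ L :=
  haveI := isIso_dualTensorHom hE (tensor L E)
  inv (dualTensorHom E (tensor L E)) ≫ contraction L E

/-- The trace sends `e ↦ l(e) (s ⊗ e')` to `l(e') s`. -/
lemma trace_rankOne {X : Scheme.{u}} {E : X.Modules} (hE : IsVectorBundle E) {L : X.Modules}
    {U : X.Opens} (l : Γ(dual E, U)) (s : Γ(L, U)) (e : Γ(E, U)) :
    (trace hE L).app U (rankOne l (tmul s e)) = evO l le_rfl e • s := by
  have : IsIso (dualTensorHom E (tensor L E)) := isIso_dualTensorHom hE (tensor L E)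
  have h1 : (dualTensorHom E (tensor L E)).app U (tmul l (tmul s e)) = rankOne l (tmul s e) := by
    rw [dualTensorHom, tensorLift_tmul, rankOneHom, ofBilin_app, res_self]
  have h2 : dualTensorHom E (tensor L E) ≫ trace hE L = contraction L E := by
    rw [trace, IsIso.hom_inv_id_assoc]
  rw [← h1, ← contraction_tmul, ← h2]
  rfl

/-- A criterion for short exactness on sections. -/
lemma shortExact_of_sections {X : Scheme.{u}} (S : ShortComplex X.Modules)
    (hf : ∀ (U : X.Opens) (m : Γ(S.X₁, U)), S.f.app U m = 0 → m = 0)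
    (hfg : ∀ (U : X.Opens) (m : Γ(S.X₂, U)), S.g.app U m = 0 → ∃ m', S.f.app U m' = m)
    (hg : ∀ (U : X.Opens) (m : Γ(S.X₃, U)), ∀ x ∈ U, ∃ (V : X.Opens) (h : V ≤ U), x ∈ V ∧
      ∃ m', S.g.app V m' = res S.X₃ h m) : S.ShortExact := by
  have hinj : ∀ (U : X.Opens) (m m' : Γ(S.X₁, U)), S.f.app U m = S.f.app U m' → m = m' := by
    intro U m m' h
    refine sub_eq_zero.1 (hf U _ ?_)
    rw [map_sub, h, sub_self]
  have hmono : Mono S.f := ⟨fun a b hab => hom_ext' fun U m => hinj U _ _ (by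
    have := congr_arg (fun k => k.app U m) hab
    exact this)⟩
  have hepi : Epi S.g := ⟨fun {Z} a b hab => hom_ext' fun U m => by
    choose V hV hxV m' hm' using fun x : U => hg U m x.1 x.2
    refine eq_of_res Z (fun x : U => V x) (fun x => hV x) ?_ _ _ ?_
    · intro x hx
      exact Opens.mem_iSup.2 ⟨⟨x, hx⟩, hxV ⟨x, hx⟩⟩
    · intro x
      rw [← app_res, ← app_res, ← hm' x]
      exact congr_arg (fun k => k.app (V x) (m' x)) hab⟩
  refine { exact := ?_, mono_f := hmono, epi_g := hepi }
  refine S.exact_of_f_is_kernel (KernelFork.IsLimit.ofι' S.f S.zero fun {A} k hk => ?_)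
  have hk' : ∀ (U : X.Opens) (a : Γ(A, U)), S.g.app U (k.app U a) = 0 := fun U a =>
    congr_arg (fun l => l.app U a) hk
  choose l hl using fun (U : X.Opens) (a : Γ(A, U)) => hfg U (k.app U a) (hk' U a)
  refine ⟨mkHom (fun U => AddMonoidHom.mk' (l U) fun a b => hinj U _ _ (by
      rw [map_add, hl, hl, hl, map_add])) (fun U a m => hinj U _ _ ?_)
      (fun h m => hinj _ _ _ ?_), hom_ext' fun U a => hl U a⟩
  · simp only [AddMonoidHom.mk'_apply, Scheme.Modules.Hom.app_smul, hl]
  · simp only [AddMonoidHom.mk'_apply, app_res, hl]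

/-- The structure morphism of a `k`-scheme, as a morphism from the constant presheaf `k` to the
structure presheaf. -/
def constMap {k : Type u} [Field k] {X : Scheme.{u}} (f : X ⟶ Spec (CommRingCat.of k)) :
    (Functor.const X.Opensᵒᵖ).obj (CommRingCat.of k) ⟶ X.presheaf where
  app U := (Scheme.ΓSpecIso (CommRingCat.of k)).inv ≫ f.appTop ≫
    X.presheaf.map (homOfLE (le_top : U.unop ≤ ⊤)).op
  naturality U V i := by
    simp only [Functor.const_obj_obj, Functor.const_obj_map, Category.id_comp, Category.assoc,
      ← Functor.map_comp]
    rfl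

/-- The function on `U` given by a constant. -/
def const {k : Type u} [Field k] {X : Scheme.{u}} (f : X ⟶ Spec (CommRingCat.of k))
    (U : X.Opens) : k →+* Γ(X, U) := ((constMap f).app (op U)).hom

/-- The presheaf of Kähler differentials `U ↦ Ω_{Γ(X, U) / k}`. -/
def kaehlerPsh {k : Type u} [Field k] {X : Scheme.{u}} (f : X ⟶ Spec (CommRingCat.of k)) :
    X.PresheafOfModules :=
  PresheafOfModules.DifferentialsConstruction.relativeDifferentials' (constMap f)

/-- The sheaf of differentials `Ω_{X / k}`. -/
def Omega {k : Type u} [Field k] {X : Scheme.{u}} (f : X ⟶ Spec (CommRingCat.of k)) :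
    X.Modules := shf (kaehlerPsh f)

/-- The universal derivation `d : O_X → Ω_{X / k}`. -/
def dOmega {k : Type u} [Field k] {X : Scheme.{u}} (f : X ⟶ Spec (CommRingCat.of k))
    (U : X.Opens) : Γ(X, U) →+ Γ(Omega f, U) :=
  (toShf (kaehlerPsh f) U).comp
    (PresheafOfModules.DifferentialsConstruction.derivation' (constMap f)).d

section dOmega
variable {k : Type u} [Field k] {X : Scheme.{u}} (f : X ⟶ Spec (CommRingCat.of k))
  {U V : X.Opens}

lemma dOmega_mul (a b : Γ(X, U)) :
    dOmega f U (a * b) = a • dOmega f U b + b • dOmega f U a := by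
  have h := (PresheafOfModules.DifferentialsConstruction.derivation' (constMap f)).d_mul
    (X := op U) a b
  have h2 := congr_arg (toShf (kaehlerPsh f) U) h
  refine h2.trans ((map_add (toShf (kaehlerPsh f) U) _ _).trans ?_)
  exact congr_arg₂ (· + ·) (toShf_smul (P := kaehlerPsh f) a _)
    (toShf_smul (P := kaehlerPsh f) b _)

lemma dOmega_one : dOmega f U 1 = 0 := by
  have h := dOmega_mul f (U := U) 1 1
  rw [mul_one, one_smul] at h
  exact left_eq_add.1 h

lemma dOmega_res (h : V ≤ U) (a : Γ(X, U)) :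
    dOmega f V (resO X h a) = res (Omega f) h (dOmega f U a) := by
  have e := (PresheafOfModules.DifferentialsConstruction.derivation' (constMap f)).d_map
    (homOfLE h).op a
  exact (congr_arg (toShf (kaehlerPsh f) V) e).trans (toShf_res (P := kaehlerPsh f) h _)

end dOmega

/-- Sections over `U` of the Atiyah extension: pairs of a section of `E` and one of `Ω ⊗ E`. -/
@[ext]
structure AtiyahSec {k : Type u} [Field k] {X : Scheme.{u}} (f : X ⟶ Spec (CommRingCat.of k))
    (E : X.Modules) (U : X.Opens) where
  fst : Γ(E, U)
  snd : Γ(tensor (Omega f) E, U)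

section AtiyahSec
variable {k : Type u} [Field k] {X : Scheme.{u}} {f : X ⟶ Spec (CommRingCat.of k)}
  {E : X.Modules} {U V : X.Opens}

/-- As abelian groups, the sections of the Atiyah extension are a direct sum. -/
def AtiyahSec.equiv : AtiyahSec f E U ≃ Γ(E, U) × Γ(tensor (Omega f) E, U) where
  toFun s := (s.fst, s.snd)
  invFun p := ⟨p.1, p.2⟩

instance : AddCommGroup (AtiyahSec f E U) := AtiyahSec.equiv.addCommGroup

lemma AtiyahSec.add_fst (s t : AtiyahSec f E U) : (s + t).fst = s.fst + t.fst := rfl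
lemma AtiyahSec.add_snd (s t : AtiyahSec f E U) : (s + t).snd = s.snd + t.snd := rfl
lemma AtiyahSec.zero_fst : (0 : AtiyahSec f E U).fst = 0 := rfl
lemma AtiyahSec.zero_snd : (0 : AtiyahSec f E U).snd = 0 := rfl

/-- The module structure `a (e, w) = (a e, a w + da ⊗ e)`. -/
instance : SMul Γ(X, U) (AtiyahSec f E U) where
  smul a s := ⟨a • s.fst, a • s.snd + tmul (dOmega f U a) s.fst⟩

lemma AtiyahSec.smul_fst (a : Γ(X, U)) (s : AtiyahSec f E U) : (a • s).fst = a • s.fst := rfl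
lemma AtiyahSec.smul_snd (a : Γ(X, U)) (s : AtiyahSec f E U) :
    (a • s).snd = a • s.snd + tmul (dOmega f U a) s.fst := rfl

lemma zero_tmul {M N : X.Modules} (n : Γ(N, U)) : tmul (0 : Γ(M, U)) n = 0 := by
  have := add_tmul (0 : Γ(M, U)) 0 n
  rw [add_zero] at this
  exact left_eq_add.1 this

lemma tmul_zero {M N : X.Modules} (m : Γ(M, U)) : tmul m (0 : Γ(N, U)) = 0 := by
  have := tmul_add m (0 : Γ(N, U)) 0
  rw [add_zero] at this
  exact left_eq_add.1 this

instance : Module Γ(X, U) (AtiyahSec f E U) where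
  one_smul s := by
    ext
    · rw [AtiyahSec.smul_fst, one_smul]
    · rw [AtiyahSec.smul_snd, one_smul, dOmega_one, zero_tmul, add_zero]
  mul_smul a b s := by
    ext
    · simp only [AtiyahSec.smul_fst, mul_smul]
    · simp only [AtiyahSec.smul_snd, AtiyahSec.smul_fst, dOmega_mul, add_tmul, smul_tmul,
        tmul_smul, mul_smul, smul_add]
      abel
  smul_zero a := by
    ext
    · rw [AtiyahSec.smul_fst, AtiyahSec.zero_fst, smul_zero]
    · rw [AtiyahSec.smul_snd, AtiyahSec.zero_fst, AtiyahSec.zero_snd, smul_zero, tmul_zero,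
        add_zero]
  smul_add a s t := by
    ext
    · simp only [AtiyahSec.smul_fst, AtiyahSec.add_fst, smul_add]
    · simp only [AtiyahSec.smul_snd, AtiyahSec.add_fst, AtiyahSec.add_snd, smul_add, tmul_add]
      abel
  add_smul a b s := by
    ext
    · simp only [AtiyahSec.smul_fst, AtiyahSec.add_fst, add_smul]
    · simp only [AtiyahSec.smul_snd, AtiyahSec.add_snd, add_smul, map_add, add_tmul]
      abel
  zero_smul s := by
    ext
    · rw [AtiyahSec.smul_fst, zero_smul, AtiyahSec.zero_fst]
    · rw [AtiyahSec.smul_snd, zero_smul, map_zero, zero_tmul, AtiyahSec.zero_snd, add_zero]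

end AtiyahSec

/-- The Atiyah extension `E_A`, an extension of `E` by `Ω ⊗ E`. -/
def atiyahExt {k : Type u} [Field k] {X : Scheme.{u}} (f : X ⟶ Spec (CommRingCat.of k))
    (E : X.Modules) : X.Modules :=
  Data.toModules
  { sec := fun U => AtiyahSec f E U
    rs := fun h => AddMonoidHom.mk' (fun s => ⟨res E h s.fst, res _ h s.snd⟩) (fun s t => by
      ext <;> simp only [AtiyahSec.add_fst, AtiyahSec.add_snd, map_add])
    rs_self := fun h s => by
      ext <;> simp only [AddMonoidHom.mk'_apply, res_self]
    rs_rs := fun h h' s => by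
      ext <;> simp only [AddMonoidHom.mk'_apply, res_res]
    rs_smul := fun h a s => by
      ext <;> simp only [AddMonoidHom.mk'_apply, res_smul, AtiyahSec.smul_fst, AtiyahSec.smul_snd,
        map_add, res_tmul, dOmega_res]
    rs_glue := by
      intro ι U s hs
      obtain ⟨t, ht, ht'⟩ := glue E U (fun i => le_iSup U i) le_rfl (fun i => (s i).fst)
        (fun i j => congr_arg AtiyahSec.fst (hs i j))
      obtain ⟨w, hw, hw'⟩ := glue (tensor (Omega f) E) U (fun i => le_iSup U i) le_rfl
        (fun i => (s i).snd) (fun i j => congr_arg AtiyahSec.snd (hs i j))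
      refine ⟨⟨t, w⟩, fun i => AtiyahSec.ext (ht i) (hw i), fun p hp => AtiyahSec.ext ?_ ?_⟩
      · exact ht' _ fun i => congr_arg AtiyahSec.fst (hp i)
      · exact hw' _ fun i => congr_arg AtiyahSec.snd (hp i) }

section atiyahExt
variable {k : Type u} [Field k] {X : Scheme.{u}} (f : X ⟶ Spec (CommRingCat.of k))
  (E : X.Modules)

/-- The inclusion `Ω ⊗ E ⟶ E_A`. -/
def atiyahIncl : tensor (Omega f) E ⟶ atiyahExt f E :=
  mkHom (N := atiyahExt f E)
    (fun U => AddMonoidHom.mk' (fun w => (⟨0, w⟩ : AtiyahSec f E U))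
      (fun _ _ => AtiyahSec.ext (add_zero 0).symm rfl))
    (fun U a w => AtiyahSec.ext (smul_zero a).symm
      ((congr_arg (a • w + ·) (tmul_zero (dOmega f U a))).trans (add_zero (a • w))).symm)
    (fun h _ => AtiyahSec.ext (map_zero (res E h)).symm rfl)

/-- The projection `E_A ⟶ E`. -/
def atiyahProj : atiyahExt f E ⟶ E :=
  mkHom (M := atiyahExt f E)
    (fun U => AddMonoidHom.mk' (fun s : AtiyahSec f E U => s.fst) (fun _ _ => rfl))
    (fun _ _ _ => rfl) (fun _ _ => rfl)

/-- The Atiyah sequence `0 ⟶ Ω ⊗ E ⟶ E_A ⟶ E ⟶ 0`. -/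
def atiyahSeq : ShortComplex X.Modules :=
  ShortComplex.mk (atiyahIncl f E) (atiyahProj f E) rfl

/-- The Atiyah sequence after applying `Hom(E, -)`:
`0 ⟶ Hom(E, Ω ⊗ E) ⟶ Hom(E, E_A) ⟶ Hom(E, E) ⟶ 0`. -/
def homAtiyahSeq : ShortComplex X.Modules :=
  ShortComplex.mk (ihomMap (𝟙 E) (atiyahIncl f E)) (ihomMap (𝟙 E) (atiyahProj f E)) rfl

lemma atiyahSeq_shortExact : (atiyahSeq f E).ShortExact := by
  refine shortExact_of_sections _ ?_ ?_ ?_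
  · intro U w hw
    exact congr_arg AtiyahSec.snd hw
  · intro U s hs
    exact ⟨(show AtiyahSec f E U from s).snd, AtiyahSec.ext hs.symm rfl⟩
  · intro U e x hx
    refine ⟨U, le_rfl, hx, (⟨e, 0⟩ : AtiyahSec f E U), ?_⟩
    exact (res_self E le_rfl e).symm

variable {E}

lemma homAtiyahSeq_shortExact (hE : IsVectorBundle E) : (homAtiyahSeq f E).ShortExact := by
  refine shortExact_of_sections _ ?_ ?_ ?_
  · intro U φ hφ
    refine local_ext fun V h e => ?_
    have := congr_arg (fun ψ : Γ(ihom E (atiyahExt f E), U) => ev ψ h e) hφ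
    exact congr_arg AtiyahSec.snd this
  · intro U φ hφ
    have h0 : ∀ (V : X.Opens) (h : V ≤ U) (e : Γ(E, V)),
        (show AtiyahSec f E V from ev φ h e).fst = 0 := fun V h e =>
      congr_arg (fun ψ : Γ(ihom E E, U) => ev ψ h e) hφ
    refine ⟨mkLocal (fun V h => AddMonoidHom.mk'
      (fun e => (show AtiyahSec f E V from ev φ h e).snd) (fun e e' => ?_)) (fun V h a e => ?_)
      (fun V W h h' e => ?_), ?_⟩
    · exact congr_arg AtiyahSec.snd (map_add (ev φ h) e e')
    · have h1 : (show AtiyahSec f E V from ev φ h (a • e)).snd =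
          a • (show AtiyahSec f E V from ev φ h e).snd +
            tmul (dOmega f V a) (show AtiyahSec f E V from ev φ h e).fst :=
        congr_arg AtiyahSec.snd (ev_smul_right φ h a e)
      rw [h0, tmul_zero, add_zero] at h1
      exact h1
    · exact congr_arg AtiyahSec.snd (ev_res_right φ h h' e)
    · exact local_ext fun V h e => AtiyahSec.ext (h0 V h e).symm rfl
  · intro U φ x hx
    obtain ⟨U', hx', n, e, he⟩ := hE x
    have he' := he.res (inf_le_left : U' ⊓ U ≤ U')
    refine ⟨U' ⊓ U, inf_le_right, ⟨hx', hx⟩, ?_⟩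
    let φ' : Γ(ihom E E, U' ⊓ U) := res (ihom E E) inf_le_right φ
    let v : Fin n → Γ(atiyahExt f E, U' ⊓ U) := fun i =>
      (⟨ev φ' le_rfl (res E inf_le_left (e i)), 0⟩ : AtiyahSec f E (U' ⊓ U))
    refine ⟨∑ i, rankOne (he'.dualFrame i) (v i), ?_⟩
    refine (map_sum ((homAtiyahSeq f E).g.app (U' ⊓ U)).hom _ _).trans ?_
    exact he'.sum_rankOne φ'

end atiyahExt

/-- Differential operators of order `≤ 1` with diagonal symbol over `U`: pairs `(t, φ)` of
an `O_U`-linear map `t : Ω_U → O_U` and a `k`-linear map `φ : E|_U → E|_U` such that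
`φ (a e) = a φ(e) + t(da) e`. -/
def diffOpSec {k : Type u} [Field k] {X : Scheme.{u}} (f : X ⟶ Spec (CommRingCat.of k))
    (E : X.Modules) (U : X.Opens) :
    Submodule Γ(X, U) (Γ(dual (Omega f), U) × localAddHom E E U) where
  carrier := {p |
    (∀ (V : {V : X.Opens // V ≤ U}) (c : k) (e : Γ(E, V.1)),
      p.2.1 V (const f V.1 c • e) = const f V.1 c • p.2.1 V e) ∧
    ∀ (V : {V : X.Opens // V ≤ U}) (a : Γ(X, V.1)) (e : Γ(E, V.1)),
      p.2.1 V (a • e) = a • p.2.1 V e + evO p.1 V.2 (dOmega f V.1 a) • e}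
  zero_mem' := by
    refine ⟨fun V c e => (smul_zero _).symm, fun V a e => ?_⟩
    change (0 : Γ(E, V.1)) = a • (0 : Γ(E, V.1)) + (0 : Γ(X, V.1)) • e
    rw [smul_zero, zero_smul, add_zero]
  add_mem' := by
    rintro ⟨t, φ⟩ ⟨t', φ'⟩ ⟨h1, h2⟩ ⟨h1', h2'⟩
    refine ⟨fun V c e => ?_, fun V a e => ?_⟩
    · change φ.1 V _ + φ'.1 V _ = const f V.1 c • (φ.1 V e + φ'.1 V e)
      rw [smul_add]
      exact congr_arg₂ (· + ·) (h1 V c e) (h1' V c e)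
    · change φ.1 V (a • e) + φ'.1 V (a • e) = a • (φ.1 V e + φ'.1 V e) +
        (evO t V.2 (dOmega f V.1 a) + evO t' V.2 (dOmega f V.1 a)) • e
      refine (congr_arg₂ (· + ·) (h2 V a e) (h2' V a e)).trans ?_
      simp only [smul_add, add_smul]
      abel
  smul_mem' := by
    rintro b ⟨t, φ⟩ ⟨h1, h2⟩
    refine ⟨fun V c e => ?_, fun V a e => ?_⟩
    · change resO X V.2 b • φ.1 V _ = const f V.1 c • resO X V.2 b • φ.1 V e
      rw [smul_comm]
      exact congr_arg (resO X V.2 b • ·) (h1 V c e)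
    · change resO X V.2 b • φ.1 V (a • e) = a • resO X V.2 b • φ.1 V e +
        (resO X V.2 b * evO t V.2 (dOmega f V.1 a)) • e
      refine (congr_arg (resO X V.2 b • ·) (h2 V a e)).trans ?_
      simp only [smul_add, mul_smul]
      rw [smul_comm a]

section diffOp
variable {k : Type u} [Field k] {X : Scheme.{u}} (f : X ⟶ Spec (CommRingCat.of k))
  (E : X.Modules)

/-- Restriction of differential operators. -/
def diffOpRes {U V : X.Opens} (h : V ≤ U) : diffOpSec f E U →+ diffOpSec f E V where
  toFun p := ⟨(res (dual (Omega f)) h p.1.1, ⟨famRes h p.1.2.1, famRes_mem_localAddHom h p.1.2.2⟩),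
    fun W c e => p.2.1 ⟨W.1, W.2.trans h⟩ c e, fun W a e => p.2.2 ⟨W.1, W.2.trans h⟩ a e⟩
  map_zero' := Subtype.ext (Prod.ext (map_zero (res (dual (Omega f)) h)) rfl)
  map_add' p q := Subtype.ext (Prod.ext (map_add (res (dual (Omega f)) h) p.1.1 q.1.1) rfl)

lemma diffOpRes_fst {U V : X.Opens} (h : V ≤ U) (p : diffOpSec f E U) :
    (diffOpRes f E h p).1.1 = res (dual (Omega f)) h p.1.1 := rfl

lemma diffOpRes_snd {U V : X.Opens} (h : V ≤ U) (p : diffOpSec f E U) :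
    (diffOpRes f E h p).1.2.1 = famRes h p.1.2.1 := rfl

lemma diffOpSec_ext {U : X.Opens} {p q : diffOpSec f E U} (h1 : p.1.1 = q.1.1)
    (h2 : p.1.2.1 = q.1.2.1) : p = q := Subtype.ext (Prod.ext h1 (Subtype.ext h2))

lemma const_res {U V : X.Opens} (h : V ≤ U) (c : k) : resO X h (const f U c) = const f V c :=
  (congr_arg (fun g => g.hom c) ((constMap f).naturality (homOfLE h).op)).symm

lemma mem_diffOpSec_of_res {ι : Type u} (U : ι → X.Opens)
    (t : Γ(dual (Omega f), iSup U)) (φ : localAddHom E E (iSup U))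
    (s : ∀ i, diffOpSec f E (U i))
    (ht : ∀ i, res (dual (Omega f)) (le_iSup U i) t = (s i).1.1)
    (hφ : ∀ i, famRes (le_iSup U i) φ.1 = (s i).1.2.1) :
    (t, φ) ∈ diffOpSec f E (iSup U) := by
  have cov : ∀ W : X.Opens, W ≤ iSup U → W ≤ ⨆ i, W ⊓ U i := by
    intro W hW
    rw [← inf_iSup_eq]
    exact le_inf le_rfl hW
  have key : ∀ (i : ι) (W : X.Opens) (hW : W ≤ iSup U) (e : Γ(E, W)),
      res E (inf_le_left : W ⊓ U i ≤ W) (φ.1 ⟨W, hW⟩ e) =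
        (s i).1.2.1 ⟨W ⊓ U i, inf_le_right⟩ (res E inf_le_left e) := by
    intro i W hW e
    rw [← φ.2 ⟨W, hW⟩ ⟨W ⊓ U i, inf_le_left.trans hW⟩ inf_le_left, ← hφ i]
    rfl
  constructor
  · intro W c e
    refine eq_of_res E (fun i => W.1 ⊓ U i) (fun i => inf_le_left) (cov W.1 W.2) _ _
      fun i => ?_
    rw [key, res_smul, res_smul, key, const_res]
    exact (s i).2.1 _ c _
  · intro W a e
    refine eq_of_res E (fun i => W.1 ⊓ U i) (fun i => inf_le_left) (cov W.1 W.2) _ _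
      fun i => ?_
    rw [key, map_add, res_smul, res_smul, res_smul, key]
    refine ((s i).2.2 _ _ _).trans ?_
    rw [dOmega_res, ← evO_res_right t W.2 (inf_le_left : W.1 ⊓ U i ≤ W.1), ← ht i]
    rfl

lemma diffOp_glue {ι : Type u} (U : ι → X.Opens) (s : ∀ i, diffOpSec f E (U i))
    (hs : ∀ i j, diffOpRes f E (inf_le_left : U i ⊓ U j ≤ U i) (s i) =
      diffOpRes f E (inf_le_right : U i ⊓ U j ≤ U j) (s j)) :
    ∃! t : diffOpSec f E (iSup U), ∀ i, diffOpRes f E (le_iSup U i) t = s i := by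
  have hs1 : ∀ i j, res (dual (Omega f)) (inf_le_left : U i ⊓ U j ≤ U i) (s i).1.1 =
      res (dual (Omega f)) (inf_le_right : U i ⊓ U j ≤ U j) (s j).1.1 := fun i j =>
    congr_arg (fun p : diffOpSec f E (U i ⊓ U j) => p.1.1) (hs i j)
  have hs2 : ∀ i j, famRes (inf_le_left : U i ⊓ U j ≤ U i) (s i).1.2.1 =
      famRes (inf_le_right : U i ⊓ U j ≤ U j) (s j).1.2.1 := fun i j =>
    congr_arg (fun p : diffOpSec f E (U i ⊓ U j) => p.1.2.1) (hs i j)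
  obtain ⟨t, ht, ht'⟩ := glue (dual (Omega f)) U (fun i => le_iSup U i) le_rfl _ hs1
  have hs3 : ∀ i, (s i).1.2.1 ∈ localAddHom E E (U i) := fun i => (s i).1.2.2
  have H := localAddHom_glue (M := E) (N := E) U (fun i => (s i).1.2.1) hs3 hs2
  obtain ⟨φ, hφ, hφs⟩ := H
  refine ⟨⟨(t, ⟨φ, hφ⟩), mem_diffOpSec_of_res f E U t ⟨φ, hφ⟩ s ht hφs⟩, ?_, ?_⟩
  · intro i
    exact diffOpSec_ext f E (ht i) (hφs i)
  · intro p hp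
    have h1 : p.1.1 = t := ht' _ fun i =>
      congr_arg (fun q : diffOpSec f E (U i) => q.1.1) (hp i)
    have h2 : p.1.2.1 = φ := localAddHom_eq_of_famRes U p.1.2.2 hφ fun i =>
      (congr_arg (fun q : diffOpSec f E (U i) => q.1.2.1) (hp i)).trans (hφs i).symm
    exact diffOpSec_ext f E h1 h2

/-- The sheaf `D(E)` of differential operators of order `≤ 1` on `E` with diagonal symbol. -/
def diffOp : X.Modules :=
  Data.toModules
  { sec := fun U => diffOpSec f E U
    rs := fun h => diffOpRes f E h
    rs_self := fun h p => diffOpSec_ext f E (res_self (dual (Omega f)) h p.1.1) rfl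
    rs_rs := fun h h' p => diffOpSec_ext f E (res_res (dual (Omega f)) h h' p.1.1) rfl
    rs_smul := fun h a p => diffOpSec_ext f E (res_smul (dual (Omega f)) h a p.1.1)
      (famRes_famSmul h a p.1.2.1)
    rs_glue := fun U s hs => diffOp_glue f E U s hs }

end diffOp

/-- The indices of the factors of `Hom(G, I)` in degree `n`. -/
abbrev HomIdx (n : ℤ) : Type := {pq : ℤ × ℤ // pq.1 + n = pq.2}

/-- The differential of the complex of sheaves `Hom(G, I)`, from degree `n` to degree `m = n + 1`:
the family `g` is sent to `d ∘ g - (-1) ^ n g ∘ d`. -/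
def homD {X : Scheme.{u}} (G I : CochainComplex X.Modules ℤ) (n m : ℤ) (h : n + 1 = m) :
    (∏ᶜ fun i : HomIdx n => ihom (G.X i.1.1) (I.X i.1.2)) ⟶
      ∏ᶜ fun i : HomIdx m => ihom (G.X i.1.1) (I.X i.1.2) :=
  Pi.lift fun i =>
    Pi.π (fun i : HomIdx n => ihom (G.X i.1.1) (I.X i.1.2)) ⟨(i.1.1, i.1.2 - 1), by
        have := i.2; simp only; lia⟩ ≫ ihomMap (𝟙 _) (I.d (i.1.2 - 1) i.1.2) +
    m.negOnePow • (Pi.π (fun i : HomIdx n => ihom (G.X i.1.1) (I.X i.1.2))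
        ⟨(i.1.1 + 1, i.1.2), by have := i.2; simp only; lia⟩ ≫
      ihomMap (G.d i.1.1 (i.1.1 + 1)) (𝟙 _))

/-- The complex of sheaves `Hom(G, I)`, with `∏_p Hom(G^p, I^(p + n))` in degree `n`. -/
def homComplex {X : Scheme.{u}} (G I : CochainComplex X.Modules ℤ) :
    CochainComplex X.Modules ℤ where
  X n := ∏ᶜ fun i : HomIdx n => ihom (G.X i.1.1) (I.X i.1.2)
  d n m := if h : n + 1 = m then homD G I n m h else 0
  shape n m h := dif_neg h
  d_comp_d' n m l hnm hml := by
    have hnm' : n + 1 = m := hnm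
    have hml' : m + 1 = l := hml
    rw [dif_pos hnm', dif_pos hml']
    subst hnm' hml'
    refine Pi.hom_ext _ _ fun i => ?_
    simp only [homD, Category.assoc, Pi.lift_π, zero_comp, Preadditive.comp_add,
      Pi.lift_π_assoc, Preadditive.add_comp, ihomMap_comp, Linear.comp_units_smul,
      Linear.units_smul_comp, Category.comp_id, Category.id_comp, HomologicalComplex.d_comp_d,
      ihomMap_zero_left, ihomMap_zero_right, comp_zero]
    simp [Int.negOnePow_succ]

section derived
variable {X : Scheme.{u}}

/-- The derived dual `R Hom(G, O_X)` of a complex `G`, computed with an injective resolution `I`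
of `O_X`, as an object of the derived category of sheaves of modules on `X`. Up to isomorphism it
depends neither on `I` nor on the complex representing the class of `G`. -/
def derivedDual [HasDerivedCategory.{w} X.Modules] (I : InjectiveResolution (structureSheaf X))
    (G : CochainComplex X.Modules ℤ) : DerivedCategory X.Modules :=
  DerivedCategory.Q.obj (homComplex G I.cochainComplex)

variable {k : Type u} [Field k] (f : X ⟶ Spec (CommRingCat.of k)) {E : X.Modules}
  (hE : IsVectorBundle E) [HasDerivedCategory.{w} X.Modules]

/-- The Atiyah class of a vector bundle `E` as a morphism `Hom(E, E) ⟶ Ω[1]` in the derived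
category. It is the image of the class of the Atiyah sequence under the canonical isomorphism
`Ext¹(E, Ω ⊗ E) ≅ Ext¹(Hom(E, E), Ω)`: apply `Hom(E, -)` to the sequence, and compose its
connecting morphism `Hom(E, E) ⟶ Hom(E, Ω ⊗ E)[1]` with the trace `Hom(E, Ω ⊗ E) ⟶ Ω`. -/
def atiyahClass : (DerivedCategory.singleFunctor X.Modules 0).obj (ihom E E) ⟶
    ((DerivedCategory.singleFunctor X.Modules 0).obj (Omega f))⟦(1 : ℤ)⟧ :=
  (homAtiyahSeq_shortExact f hE).singleδ ≫
    ((DerivedCategory.singleFunctor X.Modules 0).map (trace hE (Omega f)))⟦(1 : ℤ)⟧'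

/-- The Atiyah class as a morphism `Hom(E, E)[-1] ⟶ Ω`. -/
def atiyahMap : ((DerivedCategory.singleFunctor X.Modules 0).obj (ihom E E))⟦(-1 : ℤ)⟧ ⟶
    (DerivedCategory.singleFunctor X.Modules 0).obj (Omega f) :=
  (atiyahClass f hE)⟦(-1 : ℤ)⟧' ≫
    (shiftFunctorCompIsoId (DerivedCategory X.Modules) (1 : ℤ) (-1) (by norm_num)).hom.app _

/-- A complex `G` is a mapping cone of the Atiyah class if it fits in a distinguished triangle
`Hom(E, E)[-1] ⟶ Ω ⟶ G ⟶ Hom(E, E)[-1][1]` whose first morphism is the Atiyah class. -/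
def IsAtiyahCone (G : CochainComplex X.Modules ℤ) : Prop :=
  ∃ (i : (DerivedCategory.singleFunctor X.Modules 0).obj (Omega f) ⟶ DerivedCategory.Q.obj G)
    (p : DerivedCategory.Q.obj G ⟶
      (((DerivedCategory.singleFunctor X.Modules 0).obj (ihom E E))⟦(-1 : ℤ)⟧)⟦(1 : ℤ)⟧),
    Pretriangulated.Triangle.mk (atiyahMap f hE) i p ∈
      Pretriangulated.distinguishedTriangles

end derived

end

end AtiyahDual

/-!
# The derived dual of the cone of the Atiyah class

The Atiyah class and the sheaf `D(E)` are two descriptions of one extension. A frame of `E` gives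
a flat connection (`IsFrame.nabla`), so that locally `D(E)` is the direct sum of the dual of `Ω` and
of `Hom(E, E)`; since `Ω` is a vector bundle (`isVectorBundle_Omega`), so is `D(E)`
(`isVectorBundle_diffOp`). Dualizing the symbol sequence `0 ⟶ Hom(E, E) ⟶ D(E) ⟶ Hom(Ω, O_X) ⟶ 0`
and identifying `Hom(E, E)` with its own dual by the trace pairing (`isIso_traceForm`) gives an
extension `0 ⟶ Ω ⟶ Hom(D(E), O_X) ⟶ Hom(E, E) ⟶ 0` (`dualSeq_shortExact`).

The sequence `0 ⟶ Hom(E, Ω ⊗ E) ⟶ Hom(E, E_A) ⟶ Hom(E, E) ⟶ 0` maps to this extension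
(`homAtiyahSeqToDualSeq`): by the trace on the left, by the identity on the right, and in the middle
by sending `h = (h₁, h₂)` to the functional `(t, φ) ↦ tr((t ⊗ 1) h₂ - φ h₁)`. Neither `h₂` nor `φ`
is linear, but the difference is, as both failures are `t(da) h₁(e)`. By naturality of connecting
morphisms the Atiyah class is the class of the dual extension (`atiyahClass_eq_singleδ`), so every
cone of it is isomorphic to `Hom(D(E), O_X)` in the derived category
(`nonempty_iso_of_isAtiyahCone`).

There remains the derived dual of this vector bundle. If `I` is an injective resolution of `O_X`,
the complex `Hom(-, I)` preserves quasi-isomorphisms (`quasiIso_homComplexMap`): its sections over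
`U` are the cochains from the extension by zero of the restriction to `U`, an exact functor, with
values in a K-injective complex. Hence the derived dual depends only on the object of the derived
category (`nonempty_derivedDual_iso`). As `Hom(P, -)` is exact for a vector bundle `P`, the derived
dual of `P` is its dual (`nonempty_derivedDual_single_iso`). For `P = Hom(D(E), O_X)` this is the
double dual of `D(E)`, which is `D(E)` itself (`isIso_toDoubleDual`).
-/

namespace AtiyahDual

noncomputable section

/-! ### Subsheaves and local criteria for exactness -/

section local_sections
variable {X : Scheme.{u}}

/-- Sections that agree locally are equal. -/
lemma eq_of_locally_eq (M : X.Modules) {U : X.Opens} (s t : Γ(M, U))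
    (h : ∀ x ∈ U, ∃ (V : X.Opens) (hV : V ≤ U), x ∈ V ∧ res M hV s = res M hV t) : s = t := by
  choose V hV hx hst using fun x : U => h x.1 x.2
  exact eq_of_res M V hV (fun x hxU => Opens.mem_iSup.2 ⟨⟨x, hxU⟩, hx ⟨x, hxU⟩⟩) s t hst

/-- A section with a given property exists if it exists locally, provided the property is local and
determines the section. -/
lemma exists_of_locally_exists (M : X.Modules) {U : X.Opens}
    (P : ∀ V : X.Opens, V ≤ U → Γ(M, V) → Prop)
    (hres : ∀ (V W : X.Opens) (hV : V ≤ U) (hW : W ≤ V) (m : Γ(M, V)),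
      P V hV m → P W (hW.trans hV) (res M hW m))
    (hloc : ∀ m : Γ(M, U), (∀ x ∈ U, ∃ (V : X.Opens) (hV : V ≤ U), x ∈ V ∧ P V hV (res M hV m)) →
      P U le_rfl m)
    (huniq : ∀ (V : X.Opens) (hV : V ≤ U) (m m' : Γ(M, V)), P V hV m → P V hV m' → m = m')
    (hex : ∀ x ∈ U, ∃ (V : X.Opens) (hV : V ≤ U), x ∈ V ∧ ∃ m, P V hV m) :
    ∃ m : Γ(M, U), P U le_rfl m := by
  choose V hV hx m hm using fun x : U => hex x.1 x.2
  obtain ⟨t, ht, -⟩ := glue M V hV (fun x hxU => Opens.mem_iSup.2 ⟨⟨x, hxU⟩, hx ⟨x, hxU⟩⟩) m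
    (fun i j => huniq _ (inf_le_left.trans (hV i)) _ _ (hres _ _ _ _ _ (hm i))
      (hres _ _ _ _ _ (hm j)))
  refine ⟨t, hloc _ fun x hxU => ⟨V ⟨x, hxU⟩, hV _, hx ⟨x, hxU⟩, ?_⟩⟩
  rw [ht]
  exact hm _

/-- A subsheaf of a sheaf of modules `M`: a family of submodules of sections that is stable under
restriction and defined by a local condition. -/
structure Subsheaf (M : X.Modules) where
  sec : ∀ U : X.Opens, Submodule Γ(X, U) Γ(M, U)
  res_mem : ∀ {V U : X.Opens} (h : V ≤ U) (m : Γ(M, U)), m ∈ sec U → res M h m ∈ sec V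
  mem_of_locally : ∀ (U : X.Opens) (m : Γ(M, U)), (∀ x ∈ U, ∃ (V : X.Opens) (h : V ≤ U), x ∈ V ∧
      res M h m ∈ sec V) → m ∈ sec U

namespace Subsheaf
variable {M : X.Modules} (S : Subsheaf M)

/-- A subsheaf as a sheaf of modules. -/
def toModules : X.Modules :=
  Data.toModules
  { sec := fun U => S.sec U
    rs := fun h => AddMonoidHom.mk' (fun m => ⟨res M h m.1, S.res_mem h m.1 m.2⟩)
      (fun m m' => Subtype.ext (map_add (res M h) m.1 m'.1))
    rs_self := fun h m => Subtype.ext (res_self M h m.1)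
    rs_rs := fun h h' m => Subtype.ext (res_res M h h' m.1)
    rs_smul := fun h a m => Subtype.ext (res_smul M h a m.1)
    rs_glue := by
      intro ι U s hs
      obtain ⟨t, ht, ht'⟩ := glue M U (fun i => le_iSup U i) le_rfl (fun i => (s i).1)
        (fun i j => congr_arg Subtype.val (hs i j))
      refine ⟨⟨t, S.mem_of_locally _ _ fun x hx => ?_⟩, fun i => Subtype.ext (ht i),
        fun t' h' => Subtype.ext (ht' _ fun i => congr_arg Subtype.val (h' i))⟩
      obtain ⟨i, hi⟩ := Opens.mem_iSup.1 hx
      refine ⟨U i, le_iSup U i, hi, ?_⟩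
      rw [ht]
      exact (s i).2 }

/-- The inclusion of a subsheaf. -/
def incl : S.toModules ⟶ M :=
  mkHom (M := S.toModules) (fun U => (S.sec U).subtype.toAddMonoidHom) (fun _ _ _ => rfl)
    (fun _ _ => rfl)

lemma incl_injective {U : X.Opens} {m m' : Γ(S.toModules, U)}
    (h : S.incl.app U m = S.incl.app U m') : m = m' :=
  Subtype.ext h

lemma incl_mem {U : X.Opens} (m : Γ(S.toModules, U)) : S.incl.app U m ∈ S.sec U := Subtype.prop m

lemma exists_incl {U : X.Opens} (m : Γ(M, U)) (hm : m ∈ S.sec U) : ∃ z, S.incl.app U z = m :=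
  ⟨(⟨m, hm⟩ : S.sec U), rfl⟩

/-- The morphism to a subsheaf given by a morphism with values in it. -/
def lift {N : X.Modules} (f : N ⟶ M) (hf : ∀ (U : X.Opens) (n : Γ(N, U)), f.app U n ∈ S.sec U) :
    N ⟶ S.toModules :=
  mkHom (N := S.toModules)
    (fun U => AddMonoidHom.mk' (fun n => (⟨f.app U n, hf U n⟩ : S.sec U))
      (fun n n' => Subtype.ext (map_add (f.app U).hom n n')))
    (fun _ a n => Subtype.ext (Scheme.Modules.Hom.app_smul f a n))
    (fun h n => Subtype.ext (app_res f h n))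

lemma lift_incl {N : X.Modules} (f : N ⟶ M)
    (hf : ∀ (U : X.Opens) (n : Γ(N, U)), f.app U n ∈ S.sec U) :
    S.lift f hf ≫ S.incl = f := rfl

end Subsheaf

section morphisms
variable {M N P : X.Modules}

lemma comp_app_apply (f : M ⟶ N) (g : N ⟶ P) {U : X.Opens} (m : Γ(M, U)) :
    (f ≫ g).app U m = g.app U (f.app U m) := rfl

lemma app_eq_of_eq {f g : M ⟶ N} (h : f = g) {U : X.Opens} (m : Γ(M, U)) :
    f.app U m = g.app U m := by rw [h]

lemma mono_of_sections (f : M ⟶ N) (hf : ∀ (U : X.Opens) (m : Γ(M, U)), f.app U m = 0 → m = 0) :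
    Mono f :=
  Preadditive.mono_of_cancel_zero _ fun _ hg => hom_ext' fun U m =>
    hf U _ (app_eq_of_eq hg m)

lemma epi_of_sections (f : M ⟶ N) (hf : ∀ (U : X.Opens) (n : Γ(N, U)), ∀ x ∈ U,
      ∃ (V : X.Opens) (h : V ≤ U), x ∈ V ∧ ∃ m, f.app V m = res N h n) : Epi f :=
  Preadditive.epi_of_cancel_zero _ fun {Q} _ hg => hom_ext' fun U n =>
    eq_of_locally_eq Q _ _ fun x hx => by
      obtain ⟨V, h, hxV, m, hm⟩ := hf U n x hx
      refine ⟨V, h, hxV, ?_⟩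
      rw [← app_res, ← hm, ← comp_app_apply, hg]
      exact (map_zero (res Q h)).symm

/-- The kernel of a morphism. -/
def kerSubsheaf (f : M ⟶ N) : Subsheaf M where
  sec U :=
    { carrier := {m | f.app U m = 0}
      zero_mem' := map_zero (f.app U).hom
      add_mem' := fun {a b} ha hb => by
        change f.app U (a + b) = 0
        rw [map_add, show f.app U a = 0 from ha, show f.app U b = 0 from hb, add_zero]
      smul_mem' := fun c a ha => by
        change f.app U (c • a) = 0
        rw [Scheme.Modules.Hom.app_smul, show f.app U a = 0 from ha, smul_zero] }
  res_mem h m hm := by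
    change f.app _ (res M h m) = 0
    rw [app_res, show f.app _ m = 0 from hm, map_zero]
  mem_of_locally _ m hm := eq_of_locally_eq N _ _ fun x hx => by
    obtain ⟨V, h, hxV, hV⟩ := hm x hx
    refine ⟨V, h, hxV, ?_⟩
    rw [← app_res, map_zero]
    exact hV

lemma kerSubsheaf_incl_comp (f : M ⟶ N) : (kerSubsheaf f).incl ≫ f = 0 :=
  hom_ext' fun _ m => (kerSubsheaf f).incl_mem m

/-- The image of a morphism: the sections locally in the image. -/
def imSubsheaf (f : M ⟶ N) : Subsheaf N where
  sec U :=
    { carrier := {n | ∀ x ∈ U, ∃ (V : X.Opens) (h : V ≤ U), x ∈ V ∧ ∃ m, f.app V m = res N h n}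
      zero_mem' := fun x hx => ⟨U, le_rfl, hx, 0, by rw [map_zero, map_zero]⟩
      add_mem' := fun {a b} ha hb x hx => by
        obtain ⟨V, h, hxV, m, hm⟩ := ha x hx
        obtain ⟨V', h', hxV', m', hm'⟩ := hb x hx
        refine ⟨V ⊓ V', inf_le_left.trans h, ⟨hxV, hxV'⟩,
          res M inf_le_left m + res M inf_le_right m', ?_⟩
        rw [map_add, app_res, app_res, hm, hm', res_res, res_res, map_add]
      smul_mem' := fun c a ha x hx => by
        obtain ⟨V, h, hxV, m, hm⟩ := ha x hx
        refine ⟨V, h, hxV, resO X h c • m, ?_⟩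
        rw [Scheme.Modules.Hom.app_smul, hm, res_smul] }
  res_mem {V U} h n hn x hx := by
    obtain ⟨V', h', hxV', m, hm⟩ := hn x (h hx)
    refine ⟨V' ⊓ V, inf_le_right, ⟨hxV', hx⟩, res M inf_le_left m, ?_⟩
    rw [app_res, hm, res_res, res_res]
  mem_of_locally U n hn x hx := by
    obtain ⟨V, h, hxV, hV⟩ := hn x hx
    obtain ⟨W, hW, hxW, m, hm⟩ := hV x hxV
    refine ⟨W, hW.trans h, hxW, m, ?_⟩
    rw [hm, res_res]

/-- The image of a morphism, as a sheaf of modules. -/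
def imSheaf (f : M ⟶ N) : X.Modules := (imSubsheaf f).toModules

/-- The inclusion of the image. -/
def imIncl (f : M ⟶ N) : imSheaf f ⟶ N := (imSubsheaf f).incl

/-- The projection to the image. -/
def imProj (f : M ⟶ N) : M ⟶ imSheaf f :=
  (imSubsheaf f).lift f fun U m _ hx => ⟨U, le_rfl, hx, m, (res_self _ _ _).symm⟩

lemma imProj_incl (f : M ⟶ N) : imProj f ≫ imIncl f = f := (imSubsheaf f).lift_incl f _

lemma imIncl_app_locally (f : M ⟶ N) {U : X.Opens} (n : Γ(imSheaf f, U)) : ∀ x ∈ U,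
    ∃ (V : X.Opens) (h : V ≤ U), x ∈ V ∧ ∃ m, f.app V m = res N h ((imIncl f).app U n) :=
  (imSubsheaf f).incl_mem n

lemma imIncl_injective (f : M ⟶ N) {U : X.Opens} {m m' : Γ(imSheaf f, U)}
    (h : (imIncl f).app U m = (imIncl f).app U m') : m = m' := (imSubsheaf f).incl_injective h

instance (f : M ⟶ N) : Mono (imIncl f) :=
  mono_of_sections _ fun _ _ hm => imIncl_injective f (hm.trans (map_zero _).symm)

instance (f : M ⟶ N) : Epi (imProj f) :=
  epi_of_sections _ fun U n x hx => by
    obtain ⟨V, h, hxV, m, hm⟩ := imIncl_app_locally f n x hx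
    refine ⟨V, h, hxV, m, imIncl_injective f ?_⟩
    rw [app_res, ← hm, ← comp_app_apply, imProj_incl]

lemma app_injective_of_mono (f : M ⟶ N) [Mono f] {U : X.Opens} {m m' : Γ(M, U)}
    (h : f.app U m = f.app U m') : m = m' := by
  have h0 : (kerSubsheaf f).incl = 0 := by
    rw [← cancel_mono f, kerSubsheaf_incl_comp, zero_comp]
  obtain ⟨z, hz⟩ := (kerSubsheaf f).exists_incl (m - m') (show f.app U _ = 0 by
    rw [map_sub, h, sub_self])
  rw [h0] at hz
  exact sub_eq_zero.1 hz.symm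

/-- Epimorphisms are surjective on sections, locally. -/
lemma app_locally_surjective_of_epi (f : M ⟶ N) [Epi f] {U : X.Opens} (n : Γ(N, U)) : ∀ x ∈ U,
    ∃ (V : X.Opens) (h : V ≤ U), x ∈ V ∧ ∃ m, f.app V m = res N h n := by
  have : Epi (imIncl f) := epi_of_epi_fac (imProj_incl f)
  have : IsIso (imIncl f) := isIso_of_mono_of_epi _
  have h := imIncl_app_locally f ((inv (imIncl f)).app U n)
  rw [← comp_app_apply, IsIso.inv_hom_id] at h
  exact h

/-- A morphism is an isomorphism if it is injective, and locally surjective, on sections. -/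
lemma isIso_of_sections (f : M ⟶ N) (hf : ∀ (U : X.Opens) (m : Γ(M, U)), f.app U m = 0 → m = 0)
    (hf' : ∀ (U : X.Opens) (n : Γ(N, U)), ∀ x ∈ U,
      ∃ (V : X.Opens) (h : V ≤ U), x ∈ V ∧ ∃ m, f.app V m = res N h n) : IsIso f :=
  have := mono_of_sections f hf
  have := epi_of_sections f hf'
  isIso_of_mono_of_epi _

end morphisms

/-- A sequence is exact if the sections in the kernel are locally in the image: the kernel of the
second morphism is then the image of the first one. -/
lemma exact_of_sections (S : ShortComplex X.Modules)
    (h : ∀ (U : X.Opens) (m : Γ(S.X₂, U)), S.g.app U m = 0 → ∀ x ∈ U,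
      ∃ (V : X.Opens) (hV : V ≤ U), x ∈ V ∧ ∃ m', S.f.app V m' = res S.X₂ hV m) : S.Exact := by
  have h0 : imIncl S.f ≫ S.g = 0 := by
    rw [← cancel_epi (imProj S.f), reassoc_of% (imProj_incl S.f), S.zero, comp_zero]
  let S' : ShortComplex X.Modules := ShortComplex.mk (imIncl S.f) S.g h0
  let φ : S ⟶ S' :=
    { τ₁ := imProj S.f
      τ₂ := 𝟙 _
      τ₃ := 𝟙 _
      comm₁₂ := (imProj_incl S.f).trans (Category.comp_id _).symm }
  have : Epi φ.τ₁ := inferInstanceAs (Epi (imProj S.f))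
  have : IsIso φ.τ₂ := inferInstanceAs (IsIso (𝟙 _))
  have : Mono φ.τ₃ := inferInstanceAs (Mono (𝟙 _))
  rw [ShortComplex.exact_iff_of_epi_of_isIso_of_mono φ]
  refine S'.exact_of_f_is_kernel (KernelFork.IsLimit.ofι' S'.f S'.zero fun {A} k hk => ?_)
  have hk' : ∀ (U : X.Opens) (a : Γ(A, U)), S.g.app U (k.app U a) = 0 := fun U a =>
    app_eq_of_eq hk a
  exact ⟨(imSubsheaf S.f).lift k fun U a => h U _ (hk' U a), Subsheaf.lift_incl _ _ _⟩

/-- Exactness on the left is exactness on sections. -/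
lemma exists_app_eq_of_shortExact {S : ShortComplex X.Modules} (hS : S.ShortExact) {U : X.Opens}
    (m : Γ(S.X₂, U)) (hm : S.g.app U m = 0) : ∃ m', S.f.app U m' = m := by
  have := hS.mono_f
  obtain ⟨z, hz⟩ := (kerSubsheaf S.g).exists_incl m hm
  refine ⟨(hS.exact.lift (kerSubsheaf S.g).incl (kerSubsheaf_incl_comp S.g)).app U z, ?_⟩
  rw [← comp_app_apply, hS.exact.lift_f, hz]

end local_sections

/-! ### Extension by zero from an open subset -/

section extension_by_zero
variable {X : Scheme.{u}} (U : X.Opens)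

/-- The sections of a sheaf of modules with support in an open subset `U`: every point outside of
`U` has a neighbourhood on which the section vanishes. -/
def supportedIn (M : X.Modules) : Subsheaf M where
  sec V :=
    { carrier := {m | ∀ x ∈ V, x ∉ U → ∃ (W : X.Opens) (h : W ≤ V), x ∈ W ∧ res M h m = 0}
      zero_mem' := fun x hx _ => ⟨V, le_rfl, hx, map_zero _⟩
      add_mem' := fun {a b} ha hb x hx hxU => by
        obtain ⟨W, h, hxW, hW⟩ := ha x hx hxU
        obtain ⟨W', h', hxW', hW'⟩ := hb x hx hxU
        refine ⟨W ⊓ W', inf_le_left.trans h, ⟨hxW, hxW'⟩, ?_⟩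
        rw [map_add, ← res_res M h inf_le_left, ← res_res M h' inf_le_right, hW, hW', map_zero,
          map_zero, add_zero]
      smul_mem' := fun c a ha x hx hxU => by
        obtain ⟨W, h, hxW, hW⟩ := ha x hx hxU
        exact ⟨W, h, hxW, by rw [res_smul, hW, smul_zero]⟩ }
  res_mem {V' V} h m hm x hx hxU := by
    obtain ⟨W, h', hxW, hW⟩ := hm x (h hx) hxU
    refine ⟨W ⊓ V', inf_le_right, ⟨hxW, hx⟩, ?_⟩
    rw [res_res, ← res_res M h' inf_le_left, hW, map_zero]
  mem_of_locally V m hm x hx hxU := by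
    obtain ⟨W, h, hxW, hW⟩ := hm x hx
    obtain ⟨W', h', hxW', hW'⟩ := hW x hxW hxU
    exact ⟨W', h'.trans h, hxW', by rw [← hW', res_res]⟩

/-- The extension by zero of the restriction of a sheaf of modules to the open subset `U`, realized
as the subsheaf of sections with support in `U`. -/
def extZero : X.Modules ⥤ X.Modules where
  obj M := (supportedIn U M).toModules
  map {M N} f := (supportedIn U N).lift ((supportedIn U M).incl ≫ f) fun V m x hx hxU => by
    obtain ⟨W, h, hxW, hW⟩ := (supportedIn U M).incl_mem m x hx hxU
    refine ⟨W, h, hxW, ?_⟩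
    rw [← app_res, comp_app_apply, app_res, hW, map_zero]

/-- The inclusion of the extension by zero. -/
def extZeroIncl (M : X.Modules) : (extZero U).obj M ⟶ M := (supportedIn U M).incl

variable {U} {M N : X.Modules}

lemma extZeroIncl_injective {V : X.Opens} {m m' : Γ((extZero U).obj M, V)}
    (h : (extZeroIncl U M).app V m = (extZeroIncl U M).app V m') : m = m' :=
  (supportedIn U M).incl_injective h

lemma extZero_map_incl (f : M ⟶ N) :
    (extZero U).map f ≫ extZeroIncl U N = extZeroIncl U M ≫ f := rfl

instance : (extZero U).Additive where
  map_add := rfl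

/-- Every section over an open subset of `U` is a section of the extension by zero. -/
def extZeroMk {V : X.Opens} (h : V ≤ U) : Γ(M, V) →+ Γ((extZero U).obj M, V) :=
  AddMonoidHom.mk' (fun m => (⟨m, fun _ hx hxU => absurd (h hx) hxU⟩ : (supportedIn U M).sec V))
    fun _ _ => rfl

lemma extZeroIncl_mk {V : X.Opens} (h : V ≤ U) (m : Γ(M, V)) :
    (extZeroIncl U M).app V (extZeroMk h m) = m := rfl

lemma extZeroMk_incl {V : X.Opens} (h : V ≤ U) (m : Γ((extZero U).obj M, V)) :
    extZeroMk h ((extZeroIncl U M).app V m) = m := rfl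

lemma extZero_locally_zero {V : X.Opens} (m : Γ((extZero U).obj M, V)) {x : X} (hx : x ∈ V)
    (hxU : x ∉ U) : ∃ (W : X.Opens) (h : W ≤ V), x ∈ W ∧ res _ h m = 0 := by
  obtain ⟨W, h, hxW, hW⟩ := (supportedIn U M).incl_mem m x hx hxU
  refine ⟨W, h, hxW, extZeroIncl_injective ?_⟩
  rw [app_res, map_zero]
  exact hW

/-- Extension by zero is exact. -/
lemma extZero_shortExact {S : ShortComplex X.Modules} (hS : S.ShortExact) :
    (S.map (extZero U)).ShortExact := by
  have := hS.mono_f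
  have := hS.epi_g
  refine shortExact_of_sections _ ?_ ?_ ?_
  · intro V (m : Γ((extZero U).obj S.X₁, V)) (hm : ((extZero U).map S.f).app V m = 0)
    change m = (0 : Γ((extZero U).obj S.X₁, V))
    refine extZeroIncl_injective (app_injective_of_mono S.f ?_)
    rw [← comp_app_apply, ← extZero_map_incl, comp_app_apply, hm, map_zero, map_zero, map_zero]
  · intro V (m : Γ((extZero U).obj S.X₂, V)) (hm : ((extZero U).map S.g).app V m = 0)
    have hm' : S.g.app V ((extZeroIncl U S.X₂).app V m) = 0 := by
      rw [← comp_app_apply, ← extZero_map_incl, comp_app_apply, hm, map_zero]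
    obtain ⟨m', h⟩ := exists_app_eq_of_shortExact hS _ hm'
    obtain ⟨z, hz⟩ := (supportedIn U S.X₁).exists_incl m' fun x hx hxU => by
      obtain ⟨W, hW, hxW, hm0⟩ := extZero_locally_zero m hx hxU
      refine ⟨W, hW, hxW, app_injective_of_mono S.f ?_⟩
      rw [app_res, h, ← app_res, hm0, map_zero, map_zero]
    refine ⟨z, extZeroIncl_injective ?_⟩
    rw [← h, ← hz]
    rfl
  · intro V (m : Γ((extZero U).obj S.X₃, V)) x hx
    by_cases hxU : x ∈ U
    · obtain ⟨W, hW, hxW, n, hn⟩ := app_locally_surjective_of_epi S.g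
        ((extZeroIncl U S.X₃).app V m) x hx
      refine ⟨W ⊓ U, inf_le_left.trans hW, ⟨hxW, hxU⟩,
        extZeroMk inf_le_right (res S.X₂ inf_le_left n), extZeroIncl_injective ?_⟩
      change S.g.app _ (res S.X₂ _ n) =
        (extZeroIncl U S.X₃).app _ (res ((extZero U).obj S.X₃) _ m)
      rw [app_res, app_res, hn, res_res]
    · obtain ⟨W, hW, hxW, hm0⟩ := extZero_locally_zero m hx hxU
      exact ⟨W, hW, hxW, 0, (map_zero _).trans hm0.symm⟩

instance : (extZero U).PreservesHomology := by
  have h := ((extZero U).exact_tfae.out 0 3).1 fun S hS => extZero_shortExact hS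
  have := h.1
  have := h.2
  infer_instance

/-- The local homomorphism over `U` given by a morphism from the extension by zero. -/
def extZeroSec : ((extZero U).obj M ⟶ N) →+ Γ(ihom M N, U) :=
  AddMonoidHom.mk' (fun g => mkLocal (fun V h => (g.app V).hom.comp (extZeroMk h))
    (fun _ h a m => Scheme.Modules.Hom.app_smul g a (extZeroMk h m))
    (fun _ _ h h' m => app_res g h' (extZeroMk h m))) fun _ _ => rfl

lemma extZeroSec_ev (g : (extZero U).obj M ⟶ N) {V : X.Opens} (h : V ≤ U) (m : Γ(M, V)) :
    ev (extZeroSec g) h m = g.app V (extZeroMk h m) := rfl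

lemma extZeroSec_injective : Function.Injective (extZeroSec (U := U) (M := M) (N := N)) := by
  rw [injective_iff_map_eq_zero]
  intro g hg
  refine hom_ext' fun V m => eq_of_locally_eq N _ _ fun x hx => ?_
  by_cases hxU : x ∈ U
  · refine ⟨V ⊓ U, inf_le_left, ⟨hx, hxU⟩, ?_⟩
    have := extZeroSec_ev g inf_le_right
      ((extZeroIncl U M).app (V ⊓ U) (res _ (inf_le_left : V ⊓ U ≤ V) m))
    rw [hg, extZeroMk_incl] at this
    exact (app_res g _ m).symm.trans (this.symm.trans (map_zero (res N inf_le_left)).symm)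
  · obtain ⟨W, hW, hxW, hm0⟩ := extZero_locally_zero m hx hxU
    refine ⟨W, hW, hxW, ?_⟩
    rw [← app_res, hm0, map_zero]
    exact (map_zero (res N hW)).symm

/-- A local homomorphism over `U` extends to the extension by zero: on sections with support in
`U`, it is glued over `U` with zero away from the support. The relation `P m n` says that `n` is
the value at `m`; it is local and determines `n` because `n` has support in `U` as well. -/
lemma extZeroSec_surjective : Function.Surjective (extZeroSec (U := U) (M := M) (N := N)) := by
  intro φ
  let P : ∀ {V : X.Opens}, Γ((extZero U).obj M, V) → ∀ {W : X.Opens}, W ≤ V → Γ(N, W) → Prop :=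
    fun {V} m {W} h n => (∀ (W' : X.Opens) (h' : W' ≤ W) (hU : W' ≤ U), res N h' n =
      ev φ hU (res M (h'.trans h) ((extZeroIncl U M).app V m))) ∧ n ∈ (supportedIn U N).sec W
  have huniq : ∀ {V : X.Opens} (m : Γ((extZero U).obj M, V)) {W : X.Opens} (h : W ≤ V)
      (n n' : Γ(N, W)), P m h n → P m h n' → n = n' := by
    intro V m W h n n' hn hn'
    refine eq_of_locally_eq N _ _ fun x hx => ?_
    by_cases hxU : x ∈ U
    · exact ⟨W ⊓ U, inf_le_left, ⟨hx, hxU⟩, (hn.1 _ inf_le_left inf_le_right).trans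
        (hn'.1 _ inf_le_left inf_le_right).symm⟩
    · obtain ⟨W₁, h₁, hx₁, e₁⟩ := Submodule.sub_mem _ hn.2 hn'.2 x hx hxU
      exact ⟨W₁, h₁, hx₁, sub_eq_zero.1 ((map_sub _ _ _).symm.trans e₁)⟩
  have hex : ∀ (V : X.Opens) (m : Γ((extZero U).obj M, V)), ∃ n : Γ(N, V), P m le_rfl n := by
    intro V m
    refine exists_of_locally_exists N (fun W h n => P m h n) ?_ ?_ (fun W h => huniq m h) ?_
    · intro W W' h h' n hn
      refine ⟨fun W₁ h₁ hU => ?_, (supportedIn U N).res_mem _ _ hn.2⟩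
      rw [res_res]
      exact hn.1 _ _ _
    · intro n hn
      refine ⟨fun W h hU => eq_of_locally_eq N _ _ fun x hx => ?_,
        (supportedIn U N).mem_of_locally _ _ fun x hx => ?_⟩
      · obtain ⟨W', h', hx', hP⟩ := hn x (h hx)
        refine ⟨W' ⊓ W, inf_le_right, ⟨hx', hx⟩, ?_⟩
        have := hP.1 (W' ⊓ W) inf_le_left (inf_le_right.trans hU)
        rw [res_res] at this
        rw [res_res, this, ← ev_res_right φ hU, res_res]
      · obtain ⟨W', h', hx', hP⟩ := hn x hx
        exact ⟨W', h', hx', hP.2⟩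
    · intro x hx
      by_cases hxU : x ∈ U
      · refine ⟨V ⊓ U, inf_le_left, ⟨hx, hxU⟩,
          ev φ inf_le_right (res M inf_le_left ((extZeroIncl U M).app V m)), ?_, ?_⟩
        · intro W' h' hU
          rw [← ev_res_right φ inf_le_right h', res_res]
        · intro y hy hyU
          exact absurd hy.2 hyU
      · obtain ⟨W, hW, hxW, hm0⟩ := extZero_locally_zero m hx hxU
        refine ⟨W, hW, hxW, 0, fun W' h' hU => ?_, Submodule.zero_mem _⟩
        rw [← app_res, ← res_res _ hW h', hm0, map_zero, map_zero, map_zero, map_zero]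
  choose F hF using hex
  refine ⟨mkHom (M := (extZero U).obj M) (fun V => AddMonoidHom.mk' (F V) fun m m' => ?_)
    (fun V a m => ?_) (fun {V W} h m => ?_), local_ext fun V h m => ?_⟩
  · refine huniq (m + m') le_rfl _ _ (hF V _) ⟨fun W h hU => ?_, Submodule.add_mem _ (hF V m).2
      (hF V m').2⟩
    rw [map_add, (hF V m).1 W h hU, (hF V m').1 W h hU, map_add, map_add, map_add]
  · refine huniq (a • m) le_rfl _ _ (hF V _) ⟨fun W h hU => ?_, Submodule.smul_mem _ a (hF V m).2⟩
    rw [res_smul, AddMonoidHom.mk'_apply, (hF V m).1 W h hU, Scheme.Modules.Hom.app_smul, res_smul,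
      ev_smul_right]
  · refine huniq (res _ h m) le_rfl _ _ (hF _ _) ⟨fun W' h' hU => ?_,
      (supportedIn U N).res_mem h _ (hF _ m).2⟩
    rw [res_res, AddMonoidHom.mk'_apply, (hF _ m).1 W' (h'.trans h) hU, app_res, res_res]
  · have := (hF V (extZeroMk h m)).1 V le_rfl h
    rw [res_self, res_self, extZeroIncl_mk] at this
    exact this

/-- Extension by zero is left adjoint to restriction: morphisms from the extension by zero are the
local homomorphisms over `U`. -/
def extZeroEquiv : ((extZero U).obj M ⟶ N) ≃+ Γ(ihom M N, U) :=
  AddEquiv.ofBijective extZeroSec ⟨extZeroSec_injective, extZeroSec_surjective⟩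

end extension_by_zero

/-! ### Quasi-isomorphisms and cochains with values in K-injective complexes -/

section homological
variable {C : Type*} [Category* C] [Abelian C]

/-- A morphism of complexes is a quasi-isomorphism if and only if its mapping cone is acyclic. -/
lemma acyclic_mappingCone_iff {K L : CochainComplex C ℤ} (s : K ⟶ L) :
    (CochainComplex.mappingCone s).Acyclic ↔ QuasiIso s := by
  rw [← HomotopyCategory.quotient_obj_mem_subcategoryAcyclic_iff_acyclic,
    ← HomologicalComplex.mem_quasiIso_iff, ← HomotopyCategory.quotient_map_mem_quasiIso_iff,
    HomotopyCategory.quasiIso_eq_trW_subcategoryAcyclic]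
  exact (ObjectProperty.trW_iff_of_distinguished _ _
    (HomotopyCategory.mappingCone_triangleh_distinguished s)).symm

open CochainComplex CochainComplex.HomComplex in
/-- Precomposition with a quasi-isomorphism `A ⟶ B` induces a quasi-isomorphism between the
complexes of cochains with values in a K-injective complex. This is the exactness of the cochains
on the mapping cone, spelled out in terms of the two components of a cochain on the cone; it is the
form in which `quasiIso_of_sections` needs it. -/
lemma exists_cochain_of_quasiIso {A B L : CochainComplex C ℤ} (s : A ⟶ B) [QuasiIso s]
    [L.IsKInjective] {n m p : ℤ} (hm : n + 1 = m) (hp : p + 1 = n) (z : Cochain B L m)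
    (hz : δ m (m + 1) z = 0) (y : Cochain A L n)
    (hy : (Cochain.ofHom s).comp z (zero_add m) = δ n m y) :
    ∃ (x : Cochain B L n) (y' : Cochain A L p),
      z = δ n m x ∧ y = (Cochain.ofHom s).comp x (zero_add n) + δ p n y' := by
  have hε : m.negOnePow = -n.negOnePow := by rw [← hm, Int.negOnePow_succ]
  have hc : (mappingCone s).Acyclic := (acyclic_mappingCone_iff s).2 inferInstance
  obtain ⟨w, hw⟩ := IsKInjective.eq_δ_of_cocycle (mappingCone.descCocycle s (m.negOnePow • y)
    (Cocycle.mk z (m + 1) rfl hz) hm (by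
      rw [δ_units_smul, ← hy]
      rfl)) hc n hm
  have hw' : δ n m w = mappingCone.descCochain s (m.negOnePow • y) z hm := hw
  refine ⟨(Cochain.ofHom (mappingCone.inr s)).comp w (zero_add n),
    m.negOnePow • (mappingCone.inl s).comp w (by lia), ?_, ?_⟩
  · rw [δ_ofHom_comp, hw', mappingCone.inr_descCochain]
  · rw [δ_units_smul, δ_comp _ w _ 0 m n hp (by lia) hm, hw', mappingCone.inl_descCochain,
      mappingCone.δ_inl, Cochain.ofHom_comp, Cochain.comp_assoc_of_first_is_zero_cochain, smul_add,
      smul_smul, smul_smul, Int.units_mul_self, hε, neg_mul, Int.units_mul_self]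
    simp

end homological

section sections
variable {X : Scheme.{u}}

lemma add_app_apply {M N : X.Modules} (f g : M ⟶ N) {U : X.Opens} (m : Γ(M, U)) :
    (f + g).app U m = f.app U m + g.app U m := rfl

lemma sub_app_apply {M N : X.Modules} (f g : M ⟶ N) {U : X.Opens} (m : Γ(M, U)) :
    (f - g).app U m = f.app U m - g.app U m := rfl

lemma neg_app_apply {M N : X.Modules} (f : M ⟶ N) {U : X.Opens} (m : Γ(M, U)) :
    (-f).app U m = -f.app U m := rfl

lemma id_app_apply {M : X.Modules} {U : X.Opens} (m : Γ(M, U)) : (𝟙 M : M ⟶ M).app U m = m := rfl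

lemma units_smul_app_apply {M N : X.Modules} (ε : ℤˣ) (f : M ⟶ N) {U : X.Opens} (m : Γ(M, U)) :
    (ε • f).app U m = ε • f.app U m := by
  obtain rfl | rfl := Int.units_eq_one_or ε
  · rw [one_smul, one_smul]
  · rw [Units.neg_smul, one_smul, Units.neg_smul, one_smul, neg_app_apply]

/-- A morphism of complexes of sheaves that is a quasi-isomorphism on the sections over every open
subset is a quasi-isomorphism. The hypothesis says that the sections of its mapping cone form an
exact complex. -/
lemma quasiIso_of_sections {K L : CochainComplex X.Modules ℤ} (φ : K ⟶ L)
    (H : ∀ (U : X.Opens) (n m p : ℤ), n + 1 = m → p + 1 = n →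
      ∀ (b : Γ(K.X m, U)) (a : Γ(L.X n, U)), (K.d m (m + 1)).app U b = 0 →
        (φ.f m).app U b = (L.d n m).app U a →
        ∃ (x : Γ(K.X n, U)) (y : Γ(L.X p, U)), b = (K.d n m).app U x ∧
          a = (φ.f n).app U x + (L.d p n).app U y) : QuasiIso φ := by
  rw [← acyclic_mappingCone_iff]
  intro n
  rw [HomologicalComplex.exactAt_iff' _ (n - 1) n (n + 1) (by simp) (by simp)]
  refine exact_of_sections _ fun U (c : Γ((CochainComplex.mappingCone φ).X n, U))
    (hc : ((CochainComplex.mappingCone φ).d n (n + 1)).app U c = 0) x hx => ⟨U, le_rfl, hx, ?_⟩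
  let F {i j : ℤ} (h : i + 1 = j) := (CochainComplex.mappingCone.fst φ).1.v i j h
  let S (i : ℤ) := (CochainComplex.mappingCone.snd φ).v i i (add_zero i)
  have h1 : (K.d (n + 1) (n + 1 + 1)).app U ((F rfl).app U c) = 0 := by
    have := app_eq_of_eq (CochainComplex.mappingCone.d_fst_v φ n (n + 1) (n + 1 + 1) rfl rfl) c
    rw [comp_app_apply, hc, map_zero] at this
    exact zero_eq_neg.1 this
  have h2 : (φ.f (n + 1)).app U ((F rfl).app U c) = (L.d n (n + 1)).app U (-(S n).app U c) := by
    have := app_eq_of_eq (CochainComplex.mappingCone.d_snd_v φ n (n + 1) rfl) c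
    rw [comp_app_apply, hc, map_zero, add_app_apply, comp_app_apply, comp_app_apply] at this
    rw [map_neg]
    exact (neg_eq_of_add_eq_zero_left this.symm).symm
  obtain ⟨x, y, hx, hy⟩ := H U n (n + 1) (n - 1) rfl (by simp) _ _ h1 h2
  refine ⟨((CochainComplex.mappingCone.inl φ).v n (n - 1) rfl).app U (-x) +
    ((CochainComplex.mappingCone.inr φ).f (n - 1)).app U (-y), ?_⟩
  change ((CochainComplex.mappingCone φ).d (n - 1) n).app U _ =
    res ((CochainComplex.mappingCone φ).X n) le_rfl c
  have hy' : (S n).app U c = -((φ.f n).app U x + (L.d (n - 1) n).app U y) := by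
    rw [← hy, neg_neg]
  have e1 := app_eq_of_eq (CochainComplex.mappingCone.inl_v_d φ n (n - 1) (n + 1) rfl (by lia)) (-x)
  have e2 := app_eq_of_eq (CochainComplex.mappingCone.inr_f_d φ (n - 1) n) (-y)
  have e3 := app_eq_of_eq (CochainComplex.mappingCone.id_X φ n (n + 1) rfl) c
  rw [comp_app_apply, sub_app_apply, comp_app_apply, comp_app_apply] at e1
  rw [comp_app_apply, comp_app_apply] at e2
  change (F rfl ≫ (CochainComplex.mappingCone.inl φ).v (n + 1) n (by lia) +
    S n ≫ (CochainComplex.mappingCone.inr φ).f n).app U c = c at e3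
  rw [add_app_apply, comp_app_apply, comp_app_apply, hx, hy'] at e3
  rw [map_add, e1, e2, res_self]
  refine Eq.trans ?_ e3
  simp only [map_neg, map_add]
  abel

variable {ι : Type} (F : ι → X.Modules) {U : X.Opens}

/-- The product of a family of sheaves of modules, with products of sections. It serves to describe
the sections of the categorical product. -/
def piSheaf : X.Modules :=
  Data.toModules
  { sec := fun U => ∀ i, Γ(F i, U)
    rs := fun h => AddMonoidHom.mk' (fun s i => res (F i) h (s i))
      (fun s t => funext fun i => map_add (res (F i) h) (s i) (t i))
    rs_self := fun h s => funext fun i => res_self (F i) h (s i)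
    rs_rs := fun h h' s => funext fun i => res_res (F i) h h' (s i)
    rs_smul := fun h a s => funext fun i => res_smul (F i) h a (s i)
    rs_glue := by
      intro κ U s hs
      choose t ht ht' using fun i => glue (F i) U (fun j => le_iSup U j) le_rfl (fun j => s j i)
        (fun j j' => congr_fun (hs j j') i)
      exact ⟨t, fun j => funext fun i => ht i j, fun t' h' => funext fun i =>
        ht' i _ fun j => congr_fun (h' j) i⟩ }

/-- The projections of the product. -/
def piProj (i : ι) : piSheaf F ⟶ F i :=
  mkHom (M := piSheaf F) (fun _ => Pi.evalAddMonoidHom _ i) (fun _ _ _ => rfl) (fun _ _ => rfl)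

/-- Families of sections are sections of the categorical product. -/
lemma exists_pi_section (s : ∀ i, Γ(F i, U)) : ∃ t : Γ(∏ᶜ F, U), ∀ i, (Pi.π F i).app U t = s i := by
  let s' : Γ(piSheaf F, U) := s
  exact ⟨(Pi.lift (piProj F)).app U s', fun i =>
    (comp_app_apply _ _ _).symm.trans (app_eq_of_eq (Pi.lift_π _ _) s')⟩

lemma pi_section_ext {s t : Γ(∏ᶜ F, U)} (h : ∀ i, (Pi.π F i).app U s = (Pi.π F i).app U t) :
    s = t := by
  let q : ∏ᶜ F ⟶ piSheaf F := mkHom (N := piSheaf F)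
    (fun U => AddMonoidHom.mk' (fun s => (fun i => (Pi.π F i).app U s : ∀ i, Γ(F i, U)))
      (fun s t => funext fun i => map_add ((Pi.π F i).app U).hom s t))
    (fun U a s => funext fun i => Scheme.Modules.Hom.app_smul (Pi.π F i) a s)
    (fun h s => funext fun i => app_res (Pi.π F i) h s)
  have hq : q ≫ Pi.lift (piProj F) = 𝟙 _ := Pi.hom_ext _ _ fun i => by
    rw [Category.assoc, Pi.lift_π, Category.id_comp]
    rfl
  have h' : q.app U s = q.app U t := funext h
  rw [← id_app_apply s, ← id_app_apply t, ← hq, comp_app_apply, comp_app_apply, h']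

end sections

/-! ### The complex of sheaves of homomorphisms to an injective resolution -/

section homComplex
variable {X : Scheme.{u}} {G A B I : CochainComplex X.Modules ℤ} {U : X.Opens}

open CochainComplex CochainComplex.HomComplex

variable (G U) in
/-- The termwise extension by zero of a complex. -/
abbrev extZeroComplex : CochainComplex X.Modules ℤ :=
  ((extZero U).mapHomologicalComplex (ComplexShape.up ℤ)).obj G

/-- The adjunction between extension by zero and restriction, for the terms of complexes. -/
def extZeroComplexEquiv (p q : ℤ) :
    ((extZeroComplex G U).X p ⟶ I.X q) ≃+ Γ(ihom (G.X p) (I.X q), U) := extZeroEquiv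

lemma extZeroComplexEquiv_comp_d (p q q' : ℤ) (g : (extZeroComplex G U).X p ⟶ I.X q) :
    extZeroComplexEquiv p q' (g ≫ I.d q q') =
      (ihomMap (𝟙 _) (I.d q q')).app U (extZeroComplexEquiv p q g) := rfl

lemma extZeroComplexEquiv_d_comp (p p' q : ℤ) (g : (extZeroComplex G U).X p' ⟶ I.X q) :
    extZeroComplexEquiv p q ((extZeroComplex G U).d p p' ≫ g) =
      (ihomMap (G.d p p') (𝟙 _)).app U (extZeroComplexEquiv p' q g) := rfl

lemma extZeroComplexEquiv_map_comp (s : A ⟶ B) (p q : ℤ) (g : (extZeroComplex B U).X p ⟶ I.X q) :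
    extZeroComplexEquiv p q
      ((((extZero U).mapHomologicalComplex (ComplexShape.up ℤ)).map s).f p ≫ g) =
      (ihomMap (s.f p) (𝟙 _)).app U (extZeroComplexEquiv p q g) := rfl

variable (G I) in
/-- The projections of the terms of `Hom(G, I)`. -/
def homComplexπ {n p q : ℤ} (h : p + n = q) : (homComplex G I).X n ⟶ ihom (G.X p) (I.X q) :=
  Pi.π (fun i : HomIdx n => ihom (G.X i.1.1) (I.X i.1.2)) ⟨(p, q), h⟩

lemma homComplex_hom_ext {n : ℤ} {Z : X.Modules} {f g : Z ⟶ (homComplex G I).X n}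
    (H : ∀ (p q : ℤ) (h : p + n = q), f ≫ homComplexπ G I h = g ≫ homComplexπ G I h) : f = g :=
  Pi.hom_ext _ _ fun i => H i.1.1 i.1.2 i.2

/-- The universal property of the terms of `Hom(G, I)`. -/
def homComplexLift {n : ℤ} {Z : X.Modules}
    (f : ∀ (p q : ℤ) (_ : p + n = q), Z ⟶ ihom (G.X p) (I.X q)) : Z ⟶ (homComplex G I).X n :=
  Pi.lift fun i => f i.1.1 i.1.2 i.2

lemma homComplexLift_π {n : ℤ} {Z : X.Modules}
    (f : ∀ (p q : ℤ) (_ : p + n = q), Z ⟶ ihom (G.X p) (I.X q)) {p q : ℤ} (h : p + n = q) :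
    homComplexLift f ≫ homComplexπ G I h = f p q h := Pi.lift_π _ _

lemma homComplex_d_π {n m : ℤ} (hm : n + 1 = m) {p q q₁ : ℤ}
    (h : p + m = q) (h₁ : p + n = q₁) (h₂ : p + 1 + n = q) :
    (homComplex G I).d n m ≫ homComplexπ G I h =
      homComplexπ G I h₁ ≫ ihomMap (𝟙 _) (I.d q₁ q) +
        m.negOnePow • (homComplexπ G I h₂ ≫ ihomMap (G.d p (p + 1)) (𝟙 _)) := by
  obtain rfl : q₁ = q - 1 := by lia
  exact (congr_arg (· ≫ homComplexπ G I h) (dif_pos hm)).trans (Pi.lift_π _ _)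

/-- The component `G^p ⟶ I^q` of a section of the complex `Hom(G, I)`. -/
def component {n : ℤ} (t : Γ((homComplex G I).X n, U)) {p q : ℤ} (h : p + n = q) :
    Γ(ihom (G.X p) (I.X q), U) := (homComplexπ G I h).app U t

lemma component_ext {n : ℤ} {t t' : Γ((homComplex G I).X n, U)}
    (h : ∀ (p q : ℤ) (h : p + n = q), component t h = component t' h) : t = t' :=
  pi_section_ext _ fun i => h i.1.1 i.1.2 i.2

lemma exists_component_eq {n : ℤ}
    (s : ∀ (p q : ℤ) (_ : p + n = q), Γ(ihom (G.X p) (I.X q), U)) :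
    ∃ t : Γ((homComplex G I).X n, U), ∀ (p q : ℤ) (h : p + n = q), component t h = s p q h := by
  obtain ⟨t, ht⟩ := exists_pi_section (fun i : HomIdx n => ihom (G.X i.1.1) (I.X i.1.2)) (U := U)
    fun i => s i.1.1 i.1.2 i.2
  exact ⟨t, fun p q h => ht ⟨(p, q), h⟩⟩

lemma component_add {n : ℤ} (t t' : Γ((homComplex G I).X n, U)) {p q : ℤ} (h : p + n = q) :
    component (t + t') h = component t h + component t' h := map_add _ _ _

lemma component_d {n m : ℤ} (hm : n + 1 = m) (t : Γ((homComplex G I).X n, U)) {p q q₁ : ℤ}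
    (h : p + m = q) (h₁ : p + n = q₁) (h₂ : p + 1 + n = q) :
    component (((homComplex G I).d n m).app U t) h =
      (ihomMap (𝟙 _) (I.d q₁ q)).app U (component t h₁) +
        m.negOnePow • (ihomMap (G.d p (p + 1)) (𝟙 _)).app U (component t h₂) := by
  rw [component, ← comp_app_apply, homComplex_d_π hm h h₁ h₂, add_app_apply, units_smul_app_apply]
  rfl

/-- The cochain from the extension by zero of `G` to `I` given by a section over `U` of the complex
of sheaves `Hom(G, I)`. -/
def toCochain {n : ℤ} (t : Γ((homComplex G I).X n, U)) : Cochain (extZeroComplex G U) I n :=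
  Cochain.mk fun p q h => (extZeroComplexEquiv p q).symm (component t h)

lemma extZeroEquiv_toCochain {n : ℤ} (t : Γ((homComplex G I).X n, U)) {p q : ℤ} (h : p + n = q) :
    extZeroComplexEquiv p q ((toCochain t).v p q h) = component t h :=
  (extZeroComplexEquiv p q).apply_symm_apply (component t h)

lemma toCochain_injective {n : ℤ} {t t' : Γ((homComplex G I).X n, U)}
    (h : toCochain t = toCochain t') : t = t' :=
  component_ext fun p q hpq => by
    rw [← extZeroEquiv_toCochain, ← extZeroEquiv_toCochain, h]

lemma toCochain_surjective {n : ℤ} (z : Cochain (extZeroComplex G U) I n) :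
    ∃ t : Γ((homComplex G I).X n, U), toCochain t = z := by
  obtain ⟨t, ht⟩ := exists_component_eq fun p q h => extZeroComplexEquiv p q (z.v p q h)
  refine ⟨t, Cochain.ext _ _ fun p q h => (extZeroComplexEquiv p q).injective ?_⟩
  rw [extZeroEquiv_toCochain, ht]

lemma toCochain_add {n : ℤ} (t t' : Γ((homComplex G I).X n, U)) :
    toCochain (t + t') = toCochain t + toCochain t' :=
  Cochain.ext _ _ fun p q h => (extZeroComplexEquiv p q).injective <| by
    rw [Cochain.add_v, map_add, extZeroEquiv_toCochain, extZeroEquiv_toCochain,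
      extZeroEquiv_toCochain, component_add]

lemma toCochain_zero {n : ℤ} : toCochain (0 : Γ((homComplex G I).X n, U)) = 0 := by
  have := toCochain_add (0 : Γ((homComplex G I).X n, U)) 0
  rw [add_zero] at this
  exact left_eq_add.1 this

lemma toCochain_d {n m : ℤ} (hm : n + 1 = m) (t : Γ((homComplex G I).X n, U)) :
    toCochain (((homComplex G I).d n m).app U t) = δ n m (toCochain t) :=
  Cochain.ext _ _ fun p q h => (extZeroComplexEquiv p q).injective <| by
    rw [δ_v n m hm _ p q h (q - 1) (p + 1) rfl rfl, map_add, extZeroEquiv_toCochain,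
      component_d hm t h (q₁ := q - 1) (by lia) (by lia), extZeroComplexEquiv_comp_d,
      extZeroEquiv_toCochain, Units.smul_def, Units.smul_def, map_zsmul, extZeroComplexEquiv_d_comp,
      extZeroEquiv_toCochain]

variable (I) in
/-- Functoriality of the complex `Hom(G, I)` in `G`. -/
def homComplexMap (s : A ⟶ B) : homComplex B I ⟶ homComplex A I where
  f n := homComplexLift fun p q h => homComplexπ B I h ≫ ihomMap (s.f p) (𝟙 (I.X q))
  comm' n m (hm : n + 1 = m) := by
    refine homComplex_hom_ext fun p q h => ?_
    rw [Category.assoc, Category.assoc, homComplexLift_π, homComplex_d_π hm h rfl (by lia),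
      ← Category.assoc ((homComplex B I).d n m), homComplex_d_π hm h rfl (by lia)]
    simp only [Preadditive.comp_add, Preadditive.add_comp, Linear.comp_units_smul,
      Linear.units_smul_comp, reassoc_of% (homComplexLift_π (G := A) (I := I) (n := n)
        (Z := (homComplex B I).X n)), Category.assoc, ihomMap_comp, Category.comp_id,
      Category.id_comp, s.comm]

lemma component_homComplexMap (s : A ⟶ B) {n : ℤ} (t : Γ((homComplex B I).X n, U)) {p q : ℤ}
    (h : p + n = q) : component (((homComplexMap I s).f n).app U t) h =
      (ihomMap (s.f p) (𝟙 _)).app U (component t h) := by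
  rw [component, ← comp_app_apply]
  exact app_eq_of_eq (homComplexLift_π _ h) t

lemma toCochain_homComplexMap (s : A ⟶ B) {n : ℤ} (t : Γ((homComplex B I).X n, U)) :
    toCochain (((homComplexMap I s).f n).app U t) = (Cochain.ofHom
      (((extZero U).mapHomologicalComplex (ComplexShape.up ℤ)).map s)).comp (toCochain t)
        (zero_add n) :=
  Cochain.ext _ _ fun p q h => (extZeroComplexEquiv p q).injective <| by
    rw [extZeroEquiv_toCochain, component_homComplexMap, Cochain.zero_cochain_comp_v,
      Cochain.ofHom_v, extZeroComplexEquiv_map_comp, extZeroEquiv_toCochain]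

/-- The complex `Hom(-, I)` preserves quasi-isomorphisms: over each open subset `U` its sections are
the cochains from the extension by zero, which is exact, to a K-injective complex. -/
lemma quasiIso_homComplexMap (s : A ⟶ B) [QuasiIso s] [I.IsKInjective] :
    QuasiIso (homComplexMap I s) := by
  refine quasiIso_of_sections _ fun U n m p hm hp z y hz hy => ?_
  obtain ⟨x, y', hx, hy'⟩ := exists_cochain_of_quasiIso
    (((extZero U).mapHomologicalComplex (ComplexShape.up ℤ)).map s) hm hp (toCochain z)
    (by rw [← toCochain_d rfl, hz, toCochain_zero]) (toCochain y)
    (by rw [← toCochain_homComplexMap, hy, toCochain_d hm])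
  obtain ⟨x, rfl⟩ := toCochain_surjective x
  obtain ⟨y', rfl⟩ := toCochain_surjective y'
  refine ⟨x, y', toCochain_injective ?_, toCochain_injective ?_⟩
  · rw [hx, toCochain_d hm]
  · rw [hy', toCochain_add, toCochain_d hp, toCochain_homComplexMap]

end homComplex

section derivedDual
variable {X : Scheme.{u}} [HasDerivedCategory.{w} X.Modules]

/-- The derived dual depends only on the class of the complex in the derived category. -/
lemma nonempty_derivedDual_iso {G G' : CochainComplex X.Modules ℤ}
    (I : InjectiveResolution (structureSheaf X))
    (e : DerivedCategory.Q.obj G ≅ DerivedCategory.Q.obj G') :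
    Nonempty (derivedDual I G ≅ derivedDual I G') := by
  obtain ⟨Y, s, hs, g, hg⟩ := DerivedCategory.right_fac e.hom
  have hg' : IsIso (DerivedCategory.Q.map g) := by
    have : DerivedCategory.Q.map g = DerivedCategory.Q.map s ≫ e.hom := by
      rw [hg, IsIso.hom_inv_id_assoc]
    rw [this]
    infer_instance
  rw [DerivedCategory.isIso_Q_map_iff_quasiIso] at hs hg'
  have i₁ : IsIso (DerivedCategory.Q.map (homComplexMap I.cochainComplex s)) :=
    (DerivedCategory.isIso_Q_map_iff_quasiIso _ _).2 (quasiIso_homComplexMap s)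
  have i₂ : IsIso (DerivedCategory.Q.map (homComplexMap I.cochainComplex g)) :=
    (DerivedCategory.isIso_Q_map_iff_quasiIso _ _).2 (quasiIso_homComplexMap g)
  exact ⟨@asIso _ _ _ _ _ i₁ ≪≫ (@asIso _ _ _ _ _ i₂).symm⟩

end derivedDual

/-! ### Homomorphisms out of a vector bundle -/

section ihomFunctor
variable {X : Scheme.{u}} {M N P : X.Modules} {U : X.Opens}

/-- Finitely many sections lift along an epimorphism on a common neighbourhood of a point. -/
lemma exists_lifts_of_epi (g : M ⟶ N) [Epi g] {ι : Type*} [Fintype ι] (n : ι → Γ(N, U)) {x : X}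
    (hx : x ∈ U) : ∃ (V : X.Opens) (h : V ≤ U), x ∈ V ∧ ∃ m : ι → Γ(M, V), ∀ i,
      g.app V (m i) = res N h (n i) := by
  choose V hV hxV m hm using fun i => app_locally_surjective_of_epi g (n i) x hx
  have hle : ∀ i, U ⊓ Finset.univ.inf V ≤ V i := fun i =>
    inf_le_right.trans (Finset.inf_le (Finset.mem_univ i))
  refine ⟨U ⊓ Finset.univ.inf V, inf_le_left, ⟨hx, ?_⟩, fun i => res M (hle i) (m i), fun i => ?_⟩
  · rw [Opens.coe_finset_inf, Finset.inf_set_eq_iInter]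
    simpa using hxV
  · rw [app_res, hm, res_res]

variable (P) in
/-- The functor `Hom(P, -)` on sheaves of modules. -/
def ihomFunctor : X.Modules ⥤ X.Modules where
  obj N := ihom P N
  map g := ihomMap (𝟙 P) g

instance : (ihomFunctor P).Additive where
  map_add := rfl

/-- Homomorphisms out of a vector bundle form an exact functor: locally, a homomorphism lifts along
an epimorphism as soon as the images of a frame do. -/
lemma ihomFunctor_shortExact (hP : IsVectorBundle P) {S : ShortComplex X.Modules}
    (hS : S.ShortExact) : (S.map (ihomFunctor P)).ShortExact := by
  have := hS.mono_f
  have := hS.epi_g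
  refine shortExact_of_sections _ ?_ ?_ ?_
  · intro U (φ : Γ(ihom P S.X₁, U)) (hφ : (ihomMap (𝟙 P) S.f).app U φ = 0)
    refine local_ext fun V h e => app_injective_of_mono S.f ?_
    exact (congr_arg (fun ψ : Γ(ihom P S.X₂, U) => ev ψ h e) hφ).trans (map_zero _).symm
  · intro U (φ : Γ(ihom P S.X₂, U)) (hφ : (ihomMap (𝟙 P) S.g).app U φ = 0)
    have h0 : ∀ (V : X.Opens) (h : V ≤ U) (e : Γ(P, V)), S.g.app V (ev φ h e) = 0 := fun V h e =>
      congr_arg (fun ψ : Γ(ihom P S.X₃, U) => ev ψ h e) hφ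
    choose l hl using fun (V : X.Opens) (h : V ≤ U) (e : Γ(P, V)) =>
      exists_app_eq_of_shortExact hS _ (h0 V h e)
    refine ⟨mkLocal (fun V h => AddMonoidHom.mk' (l V h) fun e e' =>
      app_injective_of_mono S.f ?_) (fun V h a e => app_injective_of_mono S.f ?_)
      (fun V W h h' e => app_injective_of_mono S.f ?_), local_ext fun V h e => hl V h e⟩
    · rw [map_add, hl, hl, hl, map_add]
    · change S.f.app V (l V h (a • e)) = S.f.app V (a • l V h e)
      rw [Scheme.Modules.Hom.app_smul, hl, hl, ev_smul_right]
    · change S.f.app W (l W (h'.trans h) (res P h' e)) = S.f.app W (res S.X₁ h' (l V h e))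
      rw [app_res, hl, hl, ev_res_right φ h h']
  · intro U (φ : Γ(ihom P S.X₃, U)) x hx
    obtain ⟨U', hx', n, e, he⟩ := hP x
    have he' := he.res (inf_le_left : U' ⊓ U ≤ U')
    obtain ⟨V, hV, hxV, y, hy⟩ := exists_lifts_of_epi S.g
      (fun i => ev φ (inf_le_right : U' ⊓ U ≤ U) (res P inf_le_left (e i))) ⟨hx', hx⟩
    have he'' := he'.res hV
    refine ⟨V, hV.trans inf_le_right, hxV, ∑ i, rankOne (he''.dualFrame i) (y i), ?_⟩
    refine (map_sum ((ihomMap (𝟙 P) S.g).app V).hom _ _).trans ?_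
    refine Eq.trans (Finset.sum_congr rfl fun i _ => ?_)
      (he''.sum_rankOne (res (ihom P S.X₃) (hV.trans inf_le_right) φ))
    refine local_ext fun W h s => ?_
    rw [ihomMap_app, rankOne_ev, rankOne_ev, Scheme.Modules.Hom.app_smul, app_res, hy, ev_res,
      ← ev_res_right φ inf_le_right hV]
    rfl

lemma ihomFunctor_preservesHomology (hP : IsVectorBundle P) :
    (ihomFunctor P).PreservesHomology := by
  have h := ((ihomFunctor P).exact_tfae.out 0 3).1 fun S hS => ihomFunctor_shortExact hP hS
  have := h.1
  have := h.2
  infer_instance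

lemma eq_zero_of_isZero (h : IsZero M) (m : Γ(M, U)) : m = 0 :=
  app_eq_of_eq (h.eq_of_src (𝟙 M) 0) m

lemma ihom_section_eq_zero_of_isZero (h : IsZero M) (φ : Γ(ihom M N, U)) : φ = 0 :=
  local_ext fun V hV m => by rw [eq_zero_of_isZero h m, map_zero, map_zero]

end ihomFunctor

section homSingle
variable {X : Scheme.{u}}

/-- The one-term complex given by a sheaf of modules, in degree `0`. -/
abbrev oneTerm (P : X.Modules) : CochainComplex X.Modules ℤ :=
  (HomologicalComplex.single X.Modules (ComplexShape.up ℤ) 0).obj P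

/-- Restriction to the only nonzero factor, from the complex of homomorphisms out of a one-term
complex. -/
def homSingleHom (P : X.Modules) (I : CochainComplex X.Modules ℤ) :
    homComplex (oneTerm P) I ⟶
      ((ihomFunctor P).mapHomologicalComplex (ComplexShape.up ℤ)).obj I where
  f n := homComplexπ _ I (zero_add n) ≫
    ihomMap (HomologicalComplex.singleObjXSelf (ComplexShape.up ℤ) 0 P).inv (𝟙 (I.X n))
  comm' n m (hm : n + 1 = m) := by
    have hd : (oneTerm P).d 0 (0 + 1) = 0 := HomologicalComplex.single_obj_d ..
    have h := homComplex_d_π (G := oneTerm P) (I := I) hm (zero_add m) (zero_add n) (by lia)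
    rw [hd, ihomMap_zero_left, comp_zero, smul_zero, add_zero] at h
    refine Eq.trans ?_ ((congr_arg (· ≫ ihomMap (HomologicalComplex.singleObjXSelf
      (ComplexShape.up ℤ) 0 P).inv (𝟙 (I.X m))) h).symm.trans (Category.assoc _ _ _))
    rw [Category.assoc, ihomMap_comp]
    exact Category.assoc _ _ _

instance (P : X.Modules) (I : CochainComplex X.Modules ℤ) (n : ℤ) :
    IsIso ((homSingleHom P I).f n) := by
  let e := HomologicalComplex.singleObjXSelf (ComplexShape.up ℤ) 0 P
  have he : ∀ {U : X.Opens} (t : Γ((homComplex (oneTerm P) I).X n, U)),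
      ((homSingleHom P I).f n).app U t =
        (ihomMap e.inv (𝟙 (I.X n))).app U (component t (zero_add n)) := fun _ => rfl
  have hne : ∀ p : ℤ, p ≠ 0 → IsZero ((oneTerm P).X p) := fun p hp =>
    HomologicalComplex.isZero_single_obj_X _ _ _ _ hp
  have key : ∀ {U : X.Opens} (ψ : Γ(ihom ((oneTerm P).X 0) (I.X n), U)),
      (ihomMap e.hom (𝟙 (I.X n))).app U ((ihomMap e.inv (𝟙 (I.X n))).app U ψ) = ψ := by
    intro U ψ
    rw [← comp_app_apply, ihomMap_comp, e.hom_inv_id]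
    rfl
  refine isIso_of_sections _ ?_ ?_
  · intro U t ht
    rw [he] at ht
    refine component_ext fun p q h => ?_
    by_cases hp : p = 0
    · subst hp
      obtain rfl : q = n := by lia
      refine (key _).symm.trans ((congr_arg _ ht).trans ?_)
      exact (map_zero _).trans (map_zero _).symm
    · exact (ihom_section_eq_zero_of_isZero (hne p hp) _).trans
        (ihom_section_eq_zero_of_isZero (hne p hp) _).symm
  · intro U (φ : Γ(ihom P (I.X n), U)) x hx
    obtain ⟨t, ht⟩ := exists_component_eq
      (G := oneTerm P) (I := I) (n := n) (U := U)
      fun p q h => if hp : p = 0 then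
        (ihomMap (HomologicalComplex.singleObjXIsoOfEq (ComplexShape.up ℤ) 0 P p hp).hom
          (I.XIsoOfEq (show n = q by lia)).hom).app U φ else 0
    refine ⟨U, le_rfl, hx, t, ?_⟩
    rw [he, ht, dif_pos rfl]
    refine Eq.trans ?_ (res_self (ihom P (I.X n)) le_rfl φ).symm
    rw [← comp_app_apply, ihomMap_comp]
    have h1 : e.inv ≫ (HomologicalComplex.singleObjXIsoOfEq (ComplexShape.up ℤ) 0 P 0 rfl).hom =
      𝟙 P := e.inv_hom_id
    have h2 : (I.XIsoOfEq (rfl : n = n)).hom ≫ 𝟙 (I.X n) = 𝟙 (I.X n) := by simp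
    rw [h1, h2]
    rfl

instance (P : X.Modules) (I : CochainComplex X.Modules ℤ) : IsIso (homSingleHom P I) :=
  HomologicalComplex.Hom.isIso_of_components _

/-- The derived dual of a vector bundle is its dual. -/
lemma nonempty_derivedDual_single_iso [HasDerivedCategory.{w} X.Modules]
    (I : InjectiveResolution (structureSheaf X)) {P : X.Modules} (hP : IsVectorBundle P) :
    Nonempty (derivedDual I ((CochainComplex.singleFunctor X.Modules 0).obj P) ≅
      (DerivedCategory.singleFunctor X.Modules 0).obj (dual P)) := by
  have := ihomFunctor_preservesHomology hP
  let ι := ((ihomFunctor P).mapHomologicalComplex (ComplexShape.up ℤ)).map I.ι'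
  have i₁ : IsIso (DerivedCategory.Q.map ι) :=
    (DerivedCategory.isIso_Q_map_iff_quasiIso _ _).2 inferInstance
  let e₁ := asIso (homSingleHom P I.cochainComplex)
  exact ⟨DerivedCategory.Q.mapIso e₁ ≪≫
    (@asIso _ _ _ _ _ i₁).symm ≪≫ DerivedCategory.Q.mapIso
      ((HomologicalComplex.singleMapHomologicalComplex (ihomFunctor P) (ComplexShape.up ℤ) 0).app
        (structureSheaf X)) ≪≫
    ((DerivedCategory.singleFunctorIsoCompQ X.Modules 0).app (dual P)).symm⟩

end homSingle

/-! ### Frames -/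

section frames
variable {X : Scheme.{u}} {E F : X.Modules} {U V : X.Opens}

/-- Sections form a frame if this holds locally. -/
lemma isFrame_of_locally {n : ℕ} (e : Fin n → Γ(E, U))
    (hli : ∀ (V : X.Opens) (h : V ≤ U) (a : Fin n → Γ(X, V)), ∑ i, a i • res E h (e i) = 0 →
      ∀ x ∈ V, ∃ (W : X.Opens) (h' : W ≤ V), x ∈ W ∧ ∀ i, resO X h' (a i) = 0)
    (hsp : ∀ (V : X.Opens) (h : V ≤ U) (s : Γ(E, V)), ∀ x ∈ V, ∃ (W : X.Opens) (h' : W ≤ V),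
      x ∈ W ∧ ∃ a : Fin n → Γ(X, W), ∑ i, a i • res E (h'.trans h) (e i) = res E h' s) :
    IsFrame e := by
  have hli' : ∀ (V : X.Opens) (h : V ≤ U) (a : Fin n → Γ(X, V)),
      ∑ i, a i • res E h (e i) = 0 → a = 0 := by
    intro V h a ha
    funext i
    refine eq_of_locally_eq (structureSheaf X) (U := V) (a i) 0 fun x hx => ?_
    obtain ⟨W, h', hxW, hW⟩ := hli V h a ha x hx
    exact ⟨W, h', hxW, (hW i).trans (map_zero (res (structureSheaf X) h')).symm⟩
  refine ⟨fun V h => Fintype.linearIndependent_iff.2 fun a ha i => congr_fun (hli' V h a ha) i,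
    fun V h => ?_⟩
  rw [eq_top_iff]
  intro s _
  suffices ∃ a : Fin n → Γ(X, V), ∑ i, a i • res E h (e i) = s by
    obtain ⟨a, rfl⟩ := this
    exact Submodule.sum_mem _ fun i _ => Submodule.smul_mem _ _ (Submodule.subset_span ⟨i, rfl⟩)
  suffices H : ∃ a : Fin n → Γ(X, V), ∑ i, a i • res E (le_rfl.trans h) (e i) = res E le_rfl s by
    obtain ⟨a, ha⟩ := H
    exact ⟨a, ha.trans (res_self E _ s)⟩
  -- The coordinates of a section are unique, so they glue to a section of `O_X ^ n`.
  refine exists_of_locally_exists (piSheaf fun _ : Fin n => structureSheaf X) (U := V)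
    (fun W hW (a : Fin n → Γ(X, W)) => ∑ i, a i • res E (hW.trans h) (e i) = res E hW s)
    ?_ ?_ ?_ ?_
  · intro W W' hW hW' (a : Fin n → Γ(X, W)) ha
    change ∑ i, resO X hW' (a i) • _ = _
    have := congr_arg (res E hW') ha
    simpa only [map_sum, res_smul, res_res] using this
  · intro (a : Fin n → Γ(X, V)) ha
    refine eq_of_locally_eq E _ _ fun x hx => ?_
    obtain ⟨W, hW, hxW, hW'⟩ := ha x hx
    refine ⟨W, hW, hxW, ?_⟩
    change ∑ i, resO X hW (a i) • _ = _ at hW'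
    rw [res_self, ← hW']
    simp only [map_sum, res_smul, res_res]
  · intro W hW (a : Fin n → Γ(X, W)) (a' : Fin n → Γ(X, W)) ha ha'
    refine sub_eq_zero.1 (hli' W (hW.trans h) (a - a') ?_)
    simp only [Pi.sub_apply, sub_smul, Finset.sum_sub_distrib]
    exact sub_eq_zero.2 (ha.trans ha'.symm)
  · intro x hx
    exact hsp V h s x hx

/-- Sections indexed by a finite type form, in some order, a frame if this holds locally. -/
lemma exists_frame_of_locally {ι : Type*} [Fintype ι] (e : ι → Γ(E, U))
    (hli : ∀ (V : X.Opens) (h : V ≤ U) (a : ι → Γ(X, V)), ∑ i, a i • res E h (e i) = 0 →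
      ∀ x ∈ V, ∃ (W : X.Opens) (h' : W ≤ V), x ∈ W ∧ ∀ i, resO X h' (a i) = 0)
    (hsp : ∀ (V : X.Opens) (h : V ≤ U) (s : Γ(E, V)), ∀ x ∈ V, ∃ (W : X.Opens) (h' : W ≤ V),
      x ∈ W ∧ ∃ a : ι → Γ(X, W), ∑ i, a i • res E (h'.trans h) (e i) = res E h' s) :
    ∃ (n : ℕ) (e : Fin n → Γ(E, U)), IsFrame e := by
  let σ := Fintype.equivFin ι
  refine ⟨_, e ∘ σ.symm, isFrame_of_locally _ (fun V h a ha x hx => ?_) fun V h s x hx => ?_⟩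
  · obtain ⟨W, h', hxW, hW⟩ := hli V h (a ∘ σ) (by
      rw [← ha]
      exact Fintype.sum_equiv σ _ _ fun i => by simp) x hx
    exact ⟨W, h', hxW, fun i => by simpa using hW (σ.symm i)⟩
  · obtain ⟨W, h', hxW, a, ha⟩ := hsp V h s x hx
    refine ⟨W, h', hxW, a ∘ σ.symm, ?_⟩
    rw [← ha]
    exact Fintype.sum_equiv σ.symm _ _ fun i => by simp

/-- A frame from sections and coordinates. -/
lemma exists_frame_of_coords {ι : Type*} [Fintype ι] [DecidableEq ι] (e : ι → Γ(E, U))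
    (c : ∀ V : X.Opens, V ≤ U → ι → (Γ(E, V) →ₗ[Γ(X, V)] Γ(X, V)))
    (hc : ∀ (V : X.Opens) (h : V ≤ U) (i j : ι), c V h i (res E h (e j)) = if i = j then 1 else 0)
    (hs : ∀ (V : X.Opens) (h : V ≤ U) (s : Γ(E, V)), ∑ i, c V h i s • res E h (e i) = s) :
    ∃ (n : ℕ) (e : Fin n → Γ(E, U)), IsFrame e := by
  refine exists_frame_of_locally e (fun V h a ha x hx => ⟨V, le_rfl, hx, fun i => ?_⟩)
    fun V h s x hx => ⟨V, le_rfl, hx, fun i => c V h i s, ?_⟩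
  · have := congr_arg (c V h i) ha
    simp only [map_sum, map_smul, hc, smul_eq_mul, mul_ite, mul_one, mul_zero,
      Finset.sum_ite_eq, Finset.mem_univ, if_true, map_zero] at this
    rw [this, map_zero]
  · rw [hs, res_self]

variable {n : ℕ} {e : Fin n → Γ(E, U)}

lemma IsFrame.evO_dualFrame_self (he : IsFrame e) (h : V ≤ U) (i j : Fin n) :
    evO (he.dualFrame i) h (AtiyahDual.res E h (e j)) = if i = j then 1 else 0 := by
  rw [he.evO_dualFrame, ← he.basis_apply h j, Module.Basis.coord_apply, Module.Basis.repr_self,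
    Finsupp.single_apply]
  exact if_congr eq_comm rfl rfl

lemma evO_sum {ι : Type*} (t : Finset ι) (l : ι → Γ(dual E, U)) (h : V ≤ U) (s : Γ(E, V)) :
    evO (∑ i ∈ t, l i) h s = ∑ i ∈ t, evO (l i) h s :=
  ev_sum (N := structureSheaf X) t l h s

lemma dual_ext {l l' : Γ(dual E, U)}
    (H : ∀ (V : X.Opens) (h : V ≤ U) (s : Γ(E, V)), evO l h s = evO l' h s) : l = l' :=
  local_ext (N := structureSheaf X) H

lemma IsFrame.expand_dual (he : IsFrame e) (h : V ≤ U) (l : Γ(dual E, V)) :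
    ∑ i, evO l le_rfl (AtiyahDual.res E h (e i)) • AtiyahDual.res (dual E) h (he.dualFrame i) =
      l := by
  refine dual_ext fun W h' s => ?_
  conv_rhs => rw [← he.expand (h'.trans h) s, map_sum]
  rw [evO_sum]
  refine Finset.sum_congr rfl fun i _ => ?_
  rw [evO_smul, evO_res, map_smul, smul_eq_mul, mul_comm, ← evO_res_right l le_rfl h', res_res]

/-- The dual of a vector bundle is a vector bundle. -/
lemma IsVectorBundle.dual (hE : IsVectorBundle E) : IsVectorBundle (dual E) := by
  intro x
  obtain ⟨U, hx, n, e, he⟩ := hE x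
  refine ⟨U, hx, exists_frame_of_coords he.dualFrame
    (fun V h i =>
      { toFun := fun l => evO l le_rfl (AtiyahDual.res E h (e i))
        map_add' := fun l l' => evO_add l l' le_rfl _
        map_smul' := fun a l => by
          rw [evO_smul, resO_self]
          rfl }) (fun V h i j => ?_) fun V h s => he.expand_dual h s⟩
  change evO (AtiyahDual.res (AtiyahDual.dual E) h (he.dualFrame j)) le_rfl _ = _
  rw [evO_res, he.evO_dualFrame_self]
  exact if_congr eq_comm rfl rfl

variable (E) in
/-- The canonical morphism to the double dual. -/
def toDoubleDual : E ⟶ dual (dual E) :=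
  ofBilin (N := dual E) (P := structureSheaf X) (fun _ s l => evO l le_rfl s)
    (fun _ _ _ l => map_add (evO l le_rfl) _ _) (fun _ _ _ _ => rfl)
    (fun _ a s l => map_smul (evO l le_rfl) a s)
    (fun _ a s l => by rw [evO_smul, resO_self]; rfl)
    (fun h s l => by
      rw [evO_res]
      exact evO_res_right l le_rfl h s)

lemma toDoubleDual_app (s : Γ(E, U)) (h : V ≤ U) (l : Γ(dual E, V)) :
    evO ((toDoubleDual E).app U s) h l = evO l le_rfl (res E h s) := rfl

/-- A vector bundle is reflexive. -/
lemma isIso_toDoubleDual (hE : IsVectorBundle E) : IsIso (toDoubleDual E) := by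
  refine isIso_of_sections _ ?_ ?_
  · intro U s hs
    refine eq_of_locally_eq E _ _ fun x hx => ?_
    obtain ⟨U', hx', n, e, he⟩ := hE x
    refine ⟨U' ⊓ U, inf_le_right, ⟨hx', hx⟩, ?_⟩
    rw [map_zero, ← he.expand inf_le_left (res E inf_le_right s)]
    refine Finset.sum_eq_zero fun i _ => ?_
    have := congr_arg (fun Λ : Γ(dual (dual E), U) => evO Λ inf_le_right
      (res (dual E) (inf_le_left : U' ⊓ U ≤ U') (he.dualFrame i))) hs
    simp only [toDoubleDual_app, evO_res] at this
    rw [this]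
    exact zero_smul _ _
  · intro U (Λ : Γ(dual (dual E), U)) x hx
    obtain ⟨U', hx', n, e, he⟩ := hE x
    refine ⟨U' ⊓ U, inf_le_right, ⟨hx', hx⟩, ∑ i, evO Λ inf_le_right
      (res (dual E) inf_le_left (he.dualFrame i)) • res E inf_le_left (e i), ?_⟩
    refine dual_ext fun V h l => ?_
    rw [toDoubleDual_app, evO_res]
    conv_rhs => rw [← he.expand_dual (h.trans inf_le_left) l, map_sum]
    rw [map_sum, map_sum]
    refine Finset.sum_congr rfl fun i _ => ?_
    rw [res_smul, map_smul, map_smul, smul_eq_mul, smul_eq_mul, mul_comm, res_res,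
      ← evO_res_right, res_res]

end frames
/-! ### The sheaf of differentials of a smooth scheme -/

section shf
variable {X : Scheme.{u}} {P : X.PresheafOfModules} {U : X.Opens}

instance : Module Γ(X, U) (P.obj (op U)) :=
  inferInstanceAs (Module (X.ringCatSheaf.obj.obj (op U)) (P.obj (op U)))

/-- Restriction of sections of a presheaf of modules. -/
def resPsh (P : X.PresheafOfModules) {V U : X.Opens} (h : V ≤ U) :
    P.obj (op U) →+ P.obj (op V) := (P.presheaf.map (homOfLE h).op).hom

lemma resPsh_smul {V : X.Opens} (h : V ≤ U) (a : Γ(X, U)) (p : P.obj (op U)) :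
    resPsh P h (a • p) = resO X h a • resPsh P h p :=
  P.map_smul (homOfLE h).op a p

lemma resPsh_resPsh {V W : X.Opens} (h : V ≤ U) (h' : W ≤ V) (p : P.obj (op U)) :
    resPsh P h' (resPsh P h p) = resPsh P (h'.trans h) p :=
  (ConcreteCategory.congr_hom (P.presheaf.map_comp (homOfLE h).op (homOfLE h').op) p).symm

lemma toShf_resPsh {V : X.Opens} (h : V ≤ U) (p : P.obj (op U)) :
    toShf P V (resPsh P h p) = res (shf P) h (toShf P U p) := toShf_res h p

lemma toShf_smul' (a : Γ(X, U)) (p : P.obj (op U)) : toShf P U (a • p) = a • toShf P U p :=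
  toShf_smul a p

/-- A section of a presheaf that vanishes in the associated sheaf vanishes locally. -/
lemma toShf_eq_zero (p : P.obj (op U)) (hp : toShf P U p = 0) : ∀ x ∈ U,
    ∃ (V : X.Opens) (h : V ≤ U), x ∈ V ∧ resPsh P h p = 0 := by
  intro x hx
  obtain ⟨V, i, hi, hxV⟩ := Presheaf.equalizerSieve_mem (Opens.grothendieckTopology X)
    (CategoryTheory.toSheafify (Opens.grothendieckTopology X) P.presheaf) (X := op U) p 0
    (hp.trans (map_zero _).symm) x hx
  exact ⟨V, leOfHom i, hxV, hi.trans (map_zero (P.map (homOfLE (leOfHom i)).op).hom)⟩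

/-- Sections of the associated sheaf are locally sections of the presheaf. -/
lemma toShf_locally_surjective (s : Γ(shf P, U)) : ∀ x ∈ U,
    ∃ (V : X.Opens) (h : V ≤ U), x ∈ V ∧ ∃ p, toShf P V p = res _ h s := by
  intro x hx
  obtain ⟨V, i, hi, hxV⟩ := Presheaf.imageSieve_mem (Opens.grothendieckTopology X)
    (CategoryTheory.toSheafify (Opens.grothendieckTopology X) P.presheaf) (U := op U) s x hx
  obtain ⟨p, hp⟩ := hi
  exact ⟨V, leOfHom i, hxV, p, hp⟩

lemma shf_hom_ext {N : X.Modules} {f g : shf P ⟶ N}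
    (H : ∀ (U : X.Opens) (p : P.obj (op U)), f.app U (toShf P U p) = g.app U (toShf P U p)) :
    f = g := by
  refine hom_ext' fun U s => eq_of_locally_eq N _ _ fun x hx => ?_
  obtain ⟨V, h, hxV, p, hp⟩ := toShf_locally_surjective s x hx
  refine ⟨V, h, hxV, ?_⟩
  rw [← app_res, ← app_res, ← hp, H]

end shf

/-- A basis of differentials remains a basis after localization. -/
lemma kaehlerDifferential_map_basis {K A B : CommRingCat.{u}} {φ : K ⟶ A} {ψ : K ⟶ B} {ρ : A ⟶ B}
    (fac : 𝟙 K ≫ ψ = φ ≫ ρ) (g : A)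
    (hg : @IsLocalization.Away A _ g B _ ρ.hom.toAlgebra) {ι : Type*}
    (b : Module.Basis ι A (CommRingCat.KaehlerDifferential φ)) :
    ∃ b' : Module.Basis ι B (CommRingCat.KaehlerDifferential ψ),
      ∀ i, b' i = (CommRingCat.KaehlerDifferential.map fac).hom (b i) := by
  let _ : Algebra K A := φ.hom.toAlgebra
  let _ : Algebra K B := ψ.hom.toAlgebra
  let _ : Algebra A B := ρ.hom.toAlgebra
  have : IsScalarTower K A B := .of_algebraMap_eq' (congr_arg CommRingCat.Hom.hom fac)
  let b₁ : Module.Basis ι A (Ω[A⁄K]) := b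
  let b' := b₁.ofIsLocalizedModule B (Submonoid.powers g) (KaehlerDifferential.map K K A B)
  exact ⟨b', fun i => b₁.ofIsLocalizedModule_apply B (Submonoid.powers g)
    (KaehlerDifferential.map K K A B) i⟩

lemma exists_basis_kaehlerDifferential {K A : CommRingCat.{u}} {φ : K ⟶ A}
    (h : φ.hom.IsStandardSmooth) :
    ∃ (n : ℕ), Nonempty (Module.Basis (Fin n) A (CommRingCat.KaehlerDifferential φ)) := by
  let _ : Algebra K A := φ.hom.toAlgebra
  have : Algebra.IsStandardSmooth K A := h
  let b := Module.Free.chooseBasis A (Ω[A⁄K])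
  exact ⟨_, ⟨b.reindex (Fintype.equivFin _)⟩⟩

section Omega
variable {k : Type u} [Field k] {X : Scheme.{u}} (f : X ⟶ Spec (CommRingCat.of k))

/-- Every point of a smooth scheme has an affine neighbourhood whose algebra of functions is
standard smooth over the base field. -/
lemma constMap_isStandardSmooth [Smooth f] (x : X) : ∃ V : X.Opens, IsAffineOpen V ∧ x ∈ V ∧
    ((constMap f).app (op V)).hom.IsStandardSmooth := by
  obtain ⟨U, hU, V, hV, hx, e, h⟩ := Smooth.exists_isStandardSmooth f x
  -- The spectrum of a field is a point, so it has only one nonempty open subset.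
  obtain rfl : U = ⊤ := by
    rw [eq_top_iff]
    intro y _
    have : y = f x := Subsingleton.elim _ _
    rw [this]
    exact e hx
  refine ⟨V, hV, hx, ?_⟩
  have : (constMap f).app (op V) = (Scheme.ΓSpecIso (CommRingCat.of k)).inv ≫ f.appLE ⊤ V e :=
    rfl
  rw [this, CommRingCat.hom_comp]
  refine h.comp ?_
  exact (RingHom.IsStandardSmoothOfRelativeDimension.equiv
    (Scheme.ΓSpecIso (CommRingCat.of k)).symm.commRingCatIsoToRingEquiv).isStandardSmooth

/-- A basis of the differentials over an affine open subset restricts to a basis over arbitrarily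
small neighbourhoods of each of its points, namely over basic open subsets. -/
lemma exists_basis_on_basicOpen {V : X.Opens} (hV : IsAffineOpen V) {n : ℕ}
    (b : Module.Basis (Fin n) Γ(X, V) (CommRingCat.KaehlerDifferential ((constMap f).app (op V))))
    {W : X.Opens} (h : W ≤ V) {x : X} (hx : x ∈ W) :
    ∃ (D : X.Opens) (h' : D ≤ W), x ∈ D ∧
      ∃ b' : Module.Basis (Fin n) Γ(X, D)
          (CommRingCat.KaehlerDifferential ((constMap f).app (op D))),
        ∀ i, b' i = resPsh (kaehlerPsh f) (h'.trans h) (b i) := by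
  obtain ⟨g, hg, hxg⟩ := hV.exists_basicOpen_le ⟨x, hx⟩ (h hx)
  exact ⟨X.basicOpen g, hg, hxg, kaehlerDifferential_map_basis
    ((constMap f).naturality (homOfLE (hg.trans h)).op) g
    (hV.isLocalization_of_eq_basicOpen g (homOfLE (hg.trans h)) rfl) b⟩

/-- The sheaf of differentials of a smooth scheme is a vector bundle: on affine opens where the
algebra of functions is standard smooth, its differentials are free, and restriction to basic open
subsets takes bases to bases. -/
lemma isVectorBundle_Omega [Smooth f] : IsVectorBundle (Omega f) := by
  intro x
  obtain ⟨V, hV, hx, hsm⟩ := constMap_isStandardSmooth f x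
  obtain ⟨n, ⟨b⟩⟩ := exists_basis_kaehlerDifferential hsm
  let e : Fin n → (kaehlerPsh f).obj (op V) := fun i => b i
  refine ⟨V, hx, n, fun i => toShf (kaehlerPsh f) V (e i), isFrame_of_locally _ ?_ ?_⟩
  · intro W h a ha x hx
    have h0 : toShf (kaehlerPsh f) W (∑ i, a i • resPsh (kaehlerPsh f) h (e i)) = 0 := by
      refine (map_sum (toShf (kaehlerPsh f) W) _ _).trans (Eq.trans ?_ ha)
      exact Finset.sum_congr rfl fun i _ =>
        (toShf_smul' (P := kaehlerPsh f) _ _).trans (congr_arg _ (toShf_resPsh h (e i)))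
    obtain ⟨W', h', hx', hW'⟩ := toShf_eq_zero _ h0 x hx
    obtain ⟨D, hD, hxD, b', hb'⟩ := exists_basis_on_basicOpen f hV b (h'.trans h) hx'
    refine ⟨D, hD.trans h', hxD, fun i => ?_⟩
    have h1 := congr_arg (resPsh (kaehlerPsh f) hD) hW'
    rw [resPsh_resPsh, map_sum, map_zero] at h1
    refine Fintype.linearIndependent_iff.1 b'.linearIndependent
      (fun i => resO X (hD.trans h') (a i)) ?_ i
    refine Eq.trans (Finset.sum_congr rfl fun i _ => ?_) h1
    rw [resPsh_smul, resPsh_resPsh, hb']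
    rfl
  · intro W h s x hx
    obtain ⟨W', h', hx', p, hp⟩ := toShf_locally_surjective s x hx
    obtain ⟨D, hD, hxD, b', hb'⟩ := exists_basis_on_basicOpen f hV b (h'.trans h) hx'
    refine ⟨D, hD.trans h', hxD, fun i => b'.repr (resPsh (kaehlerPsh f) hD p) i, ?_⟩
    have h1 := congr_arg (toShf (kaehlerPsh f) D) (b'.sum_repr (resPsh (kaehlerPsh f) hD p))
    refine Eq.trans ?_ (h1.trans ((toShf_resPsh hD p).trans ((congr_arg _ hp).trans
      (res_res _ h' hD s))))
    refine Eq.trans (Finset.sum_congr rfl fun i _ => ?_) (map_sum (toShf (kaehlerPsh f) D) _ _).symm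
    refine (congr_arg _ (toShf_resPsh _ (e i)).symm).trans ?_
    refine (toShf_smul' (P := kaehlerPsh f) _ _).symm.trans ?_
    rw [hb']
    rfl

lemma dOmega_const (U : X.Opens) (c : k) : dOmega f U (const f U c) = 0 := by
  have h := (((PresheafOfModules.DifferentialsConstruction.derivation' (constMap f)).app
    (op U)).d_map c)
  exact (congr_arg (toShf (kaehlerPsh f) U) h).trans (map_zero _)

end Omega

/-! ### Differential operators on a vector bundle -/

section diffOpBasics
variable {k : Type u} [Field k] {X : Scheme.{u}} {f : X ⟶ Spec (CommRingCat.of k)}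
  {E : X.Modules} {U V W : X.Opens}

variable (f E) in
/-- The symbol of a differential operator. -/
def symbol : diffOp f E ⟶ dual (Omega f) :=
  mkHom (M := diffOp f E) (fun U => AddMonoidHom.mk' (fun p : diffOpSec f E U => p.1.1)
    fun _ _ => rfl) (fun _ _ _ => rfl) fun _ _ => rfl

/-- The action of a differential operator on sections. -/
def act (p : Γ(diffOp f E, U)) (h : V ≤ U) : Γ(E, V) →+ Γ(E, V) :=
  (show diffOpSec f E U from p).1.2.1 ⟨V, h⟩

lemma act_smul_right (p : Γ(diffOp f E, U)) (h : V ≤ U) (a : Γ(X, V)) (s : Γ(E, V)) :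
    act p h (a • s) = a • act p h s + evO ((symbol f E).app U p) h (dOmega f V a) • s :=
  (show diffOpSec f E U from p).2.2 ⟨V, h⟩ a s

lemma act_res_right (p : Γ(diffOp f E, U)) (h : V ≤ U) (h' : W ≤ V) (s : Γ(E, V)) :
    act p (h'.trans h) (res E h' s) = res E h' (act p h s) :=
  (show diffOpSec f E U from p).1.2.2 ⟨V, h⟩ ⟨W, h'.trans h⟩ h' s

lemma act_res (p : Γ(diffOp f E, U)) (h : V ≤ U) (h' : W ≤ V) (s : Γ(E, W)) :
    act (res (diffOp f E) h p) h' s = act p (h'.trans h) s := rfl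

lemma act_add (p q : Γ(diffOp f E, U)) (h : V ≤ U) (s : Γ(E, V)) :
    act (p + q) h s = act p h s + act q h s := rfl

lemma act_smul (a : Γ(X, U)) (p : Γ(diffOp f E, U)) (h : V ≤ U) (s : Γ(E, V)) :
    act (a • p) h s = resO X h a • act p h s := rfl

lemma act_sum {ι : Type*} (t : Finset ι) (p : ι → Γ(diffOp f E, U)) (h : V ≤ U)
    (s : Γ(E, V)) : act (∑ i ∈ t, p i) h s = ∑ i ∈ t, act (p i) h s :=
  map_sum (AddMonoidHom.mk' (fun p : Γ(diffOp f E, U) => act p h s) fun _ _ => rfl) p t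

lemma diffOp_ext {p q : Γ(diffOp f E, U)}
    (h₁ : (symbol f E).app U p = (symbol f E).app U q)
    (h₂ : ∀ (V : X.Opens) (h : V ≤ U) (s : Γ(E, V)), act p h s = act q h s) : p = q :=
  diffOpSec_ext f E h₁ (funext fun V => AddMonoidHom.ext fun s => h₂ V.1 V.2 s)

/-- Constructor for differential operators. -/
def mkDiffOp (t : Γ(dual (Omega f), U)) (φ : ∀ V : X.Opens, V ≤ U → (Γ(E, V) →+ Γ(E, V)))
    (hr : ∀ (V W : X.Opens) (h : V ≤ U) (h' : W ≤ V) s,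
      φ W (h'.trans h) (res E h' s) = res E h' (φ V h s))
    (hφ : ∀ (V : X.Opens) (h : V ≤ U) (a : Γ(X, V)) s,
      φ V h (a • s) = a • φ V h s + evO t h (dOmega f V a) • s) : Γ(diffOp f E, U) :=
  (⟨(t, ⟨fun V => φ V.1 V.2, fun V W h s => hr V.1 W.1 V.2 h s⟩),
    fun V c s => (hφ V.1 V.2 _ s).trans (by
      rw [dOmega_const, map_zero, zero_smul, add_zero]), fun V a s => hφ V.1 V.2 a s⟩ :
    diffOpSec f E U)

variable (f E) in
/-- Endomorphisms are the differential operators with vanishing symbol. -/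
def endIncl : ihom E E ⟶ diffOp f E :=
  mkHom (N := diffOp f E) (fun U => AddMonoidHom.mk' (fun φ => mkDiffOp (U := U) 0
      (fun _ h => ev φ h) (fun _ _ h h' s => ev_res_right φ h h' s) (fun V h a s => by
        change _ = a • ev φ h s + (0 : Γ(X, V)) • s
        rw [ev_smul_right, zero_smul, add_zero]))
      fun φ ψ => diffOp_ext (zero_add _).symm fun _ _ _ => rfl)
    (fun U a φ => diffOp_ext (show (0 : Γ(dual (Omega f), U)) = a • 0 from (smul_zero a).symm)
      fun _ _ _ => rfl)
    (fun h φ => diffOp_ext (map_zero (res (dual (Omega f)) h)).symm fun _ _ _ => rfl)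

lemma symbol_endIncl (φ : Γ(ihom E E, U)) :
    (symbol f E).app U ((endIncl f E).app U φ) = 0 := rfl

lemma act_endIncl (φ : Γ(ihom E E, U)) (h : V ≤ U) (s : Γ(E, V)) :
    act ((endIncl f E).app U φ) h s = ev φ h s := rfl

lemma exists_endIncl_eq (p : Γ(diffOp f E, U)) (hp : (symbol f E).app U p = 0) :
    ∃ φ, (endIncl f E).app U φ = p := by
  refine ⟨mkLocal (fun V h => act p h) (fun V h a s => ?_)
    (fun V W h h' s => act_res_right p h h' s), diffOp_ext hp.symm fun _ _ _ => rfl⟩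
  rw [act_smul_right, hp]
  exact (congr_arg _ (zero_smul _ s)).trans (add_zero _)

variable {n : ℕ} {e : Fin n → Γ(E, U)}

/-- The flat connection for which the sections of a frame are horizontal: `t` acts by applying
`t ∘ d` to the coordinates. -/
def IsFrame.nabla (he : IsFrame e) (h : V ≤ U) (t : Γ(dual (Omega f), V)) : Γ(diffOp f E, V) :=
  mkDiffOp t (fun W h' => AddMonoidHom.mk' (fun s => ∑ i, evO t h' (dOmega f W
      (evO (he.dualFrame i) (h'.trans h) s)) • AtiyahDual.res E (h'.trans h) (e i))
      fun s s' => by simp only [map_add, add_smul, Finset.sum_add_distrib])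
    (fun W W' h' h'' s => by
      simp only [AddMonoidHom.mk'_apply, map_sum, res_smul, res_res]
      refine Finset.sum_congr rfl fun i _ => ?_
      rw [evO_res_right (he.dualFrame i) (h'.trans h) h'', dOmega_res, evO_res_right t h' h''])
    (fun W h' a s => by
      simp only [AddMonoidHom.mk'_apply, map_smul, smul_eq_mul, dOmega_mul, map_add, add_smul,
        Finset.sum_add_distrib, mul_smul, ← Finset.smul_sum]
      refine congr_arg₂ _ rfl ?_
      conv_rhs => rw [← he.expand (h'.trans h) s, Finset.smul_sum]
      exact Finset.sum_congr rfl fun i _ => smul_comm _ _ _)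

lemma IsFrame.symbol_nabla (he : IsFrame e) (h : V ≤ U) (t : Γ(dual (Omega f), V)) :
    (symbol f E).app V (he.nabla h t) = t := rfl

lemma IsFrame.act_nabla (he : IsFrame e) (h : V ≤ U) (t : Γ(dual (Omega f), V)) (h' : W ≤ V)
    (i : Fin n) : act (he.nabla h t) h' (AtiyahDual.res E (h'.trans h) (e i)) = 0 := by
  change ∑ j, evO t h' (dOmega f W (evO (he.dualFrame j) (h'.trans h)
    (AtiyahDual.res E (h'.trans h) (e i)))) • AtiyahDual.res E (h'.trans h) (e j) = 0
  refine Finset.sum_eq_zero fun j _ => ?_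
  rw [he.evO_dualFrame_self]
  split_ifs
  · rw [dOmega_one, map_zero, zero_smul]
  · rw [map_zero, map_zero, zero_smul]

/-- Differential operators are determined by their symbol and their values on a frame. -/
lemma IsFrame.diffOp_ext (he : IsFrame e) (h : V ≤ U) {p q : Γ(diffOp f E, V)}
    (h₁ : (symbol f E).app V p = (symbol f E).app V q)
    (h₂ : ∀ i, act p le_rfl (AtiyahDual.res E h (e i)) = act q le_rfl (AtiyahDual.res E h (e i))) :
    p = q := by
  refine AtiyahDual.diffOp_ext h₁ fun W h' s => ?_
  have h₃ : ∀ i, act p h' (AtiyahDual.res E (h'.trans h) (e i)) =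
      act q h' (AtiyahDual.res E (h'.trans h) (e i)) := fun i => by
    rw [← res_res E h h']
    exact (act_res_right p le_rfl h' _).trans ((congr_arg _ (h₂ i)).trans
      (act_res_right q le_rfl h' _).symm)
  rw [← he.expand (h'.trans h) s, map_sum, map_sum]
  exact Finset.sum_congr rfl fun i _ => by rw [act_smul_right, act_smul_right, h₁, h₃]

lemma IsFrame.nabla_add (he : IsFrame e) (h : V ≤ U) (t t' : Γ(dual (Omega f), V)) :
    he.nabla h (t + t') = he.nabla h t + he.nabla h t' :=
  he.diffOp_ext h (by rw [map_add, he.symbol_nabla, he.symbol_nabla, he.symbol_nabla])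
    fun i => by rw [act_add, he.act_nabla, he.act_nabla, he.act_nabla, add_zero]

lemma IsFrame.nabla_smul (he : IsFrame e) (h : V ≤ U) (a : Γ(X, V)) (t : Γ(dual (Omega f), V)) :
    he.nabla h (a • t) = a • he.nabla h t :=
  he.diffOp_ext h (by rw [Scheme.Modules.Hom.app_smul, he.symbol_nabla, he.symbol_nabla])
    fun i => by rw [act_smul, he.act_nabla, he.act_nabla, smul_zero]

lemma IsFrame.nabla_res (he : IsFrame e) (h : V ≤ U) (h' : W ≤ V) (t : Γ(dual (Omega f), V)) :
    he.nabla (h'.trans h) (AtiyahDual.res (dual (Omega f)) h' t) =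
      AtiyahDual.res (diffOp f E) h' (he.nabla h t) :=
  he.diffOp_ext (h'.trans h) rfl fun i => by
    rw [act_res, he.act_nabla]
    exact (he.act_nabla h t h' i).symm

/-- Every differential operator is the sum of the covariant derivative along its symbol and of an
endomorphism. -/
lemma IsFrame.exists_nabla_add_endIncl (he : IsFrame e) (h : V ≤ U) (p : Γ(diffOp f E, V)) :
    ∃ φ, p = he.nabla h ((symbol f E).app V p) + (endIncl f E).app V φ := by
  obtain ⟨φ, hφ⟩ := exists_endIncl_eq (p - he.nabla h ((symbol f E).app V p))
    (by rw [map_sub, he.symbol_nabla, sub_self])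
  exact ⟨φ, by rw [hφ, add_sub_cancel]⟩

lemma IsFrame.dualFrame_res (he : IsFrame e) (h : V ≤ U) (i : Fin n) :
    (he.res h).dualFrame i = AtiyahDual.res (dual E) h (he.dualFrame i) := by
  refine dual_ext fun W h' s => ?_
  rw [evO_res, ← he.expand (h'.trans h) s, map_sum, map_sum]
  refine Finset.sum_congr rfl fun j _ => ?_
  rw [map_smul, map_smul, he.evO_dualFrame_self, ← res_res E h h', (he.res h).evO_dualFrame_self]

variable {m : ℕ} {ω : Fin m → Γ(Omega f, U)}

/-- The frame of the sheaf of differential operators given by frames `e` of `E` and `ω` of `Ω`: the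
covariant derivatives along the dual frame of `ω`, and the elementary matrices. -/
def IsFrame.diffOpFrame (he : IsFrame e) (hω : IsFrame ω) :
    Fin m ⊕ Fin n × Fin n → Γ(diffOp f E, U) :=
  Sum.elim (fun i => he.nabla le_rfl (hω.dualFrame i))
    fun j => (endIncl f E).app U (rankOne (he.dualFrame j.1) (e j.2))

/-- The coordinates in the frame of the sheaf of differential operators. -/
def IsFrame.diffOpCoord (he : IsFrame e) (ω : Fin m → Γ(Omega f, U)) (h : V ≤ U) :
    Fin m ⊕ Fin n × Fin n → (Γ(diffOp f E, V) →ₗ[Γ(X, V)] Γ(X, V)) :=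
  Sum.elim (fun i =>
      { toFun := fun p => evO ((symbol f E).app V p) le_rfl (AtiyahDual.res (Omega f) h (ω i))
        map_add' := fun p q => by rw [map_add, evO_add]
        map_smul' := fun a p => by
          rw [Scheme.Modules.Hom.app_smul, evO_smul, resO_self]
          rfl })
    fun j =>
      { toFun := fun p => evO (he.dualFrame j.2) h (act p le_rfl (AtiyahDual.res E h (e j.1)))
        map_add' := fun p q => by rw [act_add, map_add]
        map_smul' := fun a p => by
          rw [act_smul, resO_self, map_smul]
          rfl }

lemma IsFrame.diffOpCoord_diffOpFrame (he : IsFrame e) (hω : IsFrame ω) (h : V ≤ U)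
    (i j : Fin m ⊕ Fin n × Fin n) : he.diffOpCoord ω h i
      (AtiyahDual.res (diffOp f E) h (he.diffOpFrame hω j)) = if i = j then 1 else 0 := by
  obtain i | ⟨a, b⟩ := i <;> obtain j | ⟨c, d⟩ := j
  · refine Eq.trans (hω.evO_dualFrame_self h j i) ?_
    simp only [Sum.inl.injEq, eq_comm]
  · rw [if_neg (by simp)]
    rfl
  · rw [if_neg (by simp)]
    exact (congr_arg (evO (he.dualFrame b) h)
      (he.act_nabla le_rfl (hω.dualFrame j) h a)).trans (map_zero _)
  · change evO (he.dualFrame b) h (evO (he.dualFrame c) h (AtiyahDual.res E h (e a)) •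
      AtiyahDual.res E h (e d)) = _
    rw [map_smul, he.evO_dualFrame_self, he.evO_dualFrame_self]
    simp only [Sum.inr.injEq, Prod.mk.injEq, smul_eq_mul, ite_and, eq_comm (a := a),
      eq_comm (a := b)]
    split_ifs <;> simp

lemma IsFrame.sum_diffOpCoord (he : IsFrame e) (hω : IsFrame ω) (h : V ≤ U)
    (p : Γ(diffOp f E, V)) : ∑ i, he.diffOpCoord ω h i p •
      AtiyahDual.res (diffOp f E) h (he.diffOpFrame hω i) = p := by
  have h₁ : ∑ i, he.diffOpCoord ω h (Sum.inl i) p • AtiyahDual.res (diffOp f E) h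
      (he.diffOpFrame hω (Sum.inl i)) = he.nabla h ((symbol f E).app V p) := by
    refine he.diffOp_ext h ?_ fun a => ?_
    · rw [map_sum, he.symbol_nabla]
      refine Eq.trans (Finset.sum_congr rfl fun i _ => ?_)
        (hω.expand_dual h ((symbol f E).app V p))
      rw [Scheme.Modules.Hom.app_smul, app_res]
      rfl
    · rw [act_sum, he.act_nabla]
      refine Finset.sum_eq_zero fun i _ => ?_
      rw [act_smul, act_res]
      exact (congr_arg _ (he.act_nabla le_rfl (hω.dualFrame i) h a)).trans (smul_zero _)
  obtain ⟨φ, hφ⟩ := he.exists_nabla_add_endIncl h p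
  have h₂ : ∑ j, he.diffOpCoord ω h (Sum.inr j) p • AtiyahDual.res (diffOp f E) h
      (he.diffOpFrame hω (Sum.inr j)) = (endIncl f E).app V φ := by
    have h₃ : ∀ a b, he.diffOpCoord ω h (Sum.inr (a, b)) p =
        evO (he.dualFrame b) h (ev φ le_rfl (AtiyahDual.res E h (e a))) := fun a b => by
      change evO (he.dualFrame b) h (act p le_rfl (AtiyahDual.res E h (e a))) = _
      rw [hφ, act_add, he.act_nabla, zero_add, act_endIncl]
    refine Eq.trans ?_ (congr_arg ((endIncl f E).app V) ((he.res h).sum_rankOne φ))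
    rw [map_sum, Fintype.sum_prod_type]
    refine Finset.sum_congr rfl fun a _ => AtiyahDual.diffOp_ext ?_ fun W h' s => ?_
    · rw [map_sum, symbol_endIncl]
      refine Finset.sum_eq_zero fun b _ => ?_
      rw [Scheme.Modules.Hom.app_smul, app_res]
      exact (congr_arg _ (map_zero _)).trans (smul_zero _)
    · rw [act_sum, act_endIncl, rankOne_ev, ← he.expand h (ev φ le_rfl _), map_sum,
        Finset.smul_sum]
      refine Finset.sum_congr rfl fun b _ => ?_
      rw [h₃, act_smul, act_res, res_smul, smul_comm, res_res, he.dualFrame_res, evO_res]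
      rfl
  rw [Fintype.sum_sum_type, h₁, h₂, ← hφ]

/-- The sheaf of differential operators with diagonal symbol on a vector bundle over a smooth
scheme is a vector bundle. -/
lemma isVectorBundle_diffOp [Smooth f] (hE : IsVectorBundle E) :
    IsVectorBundle (diffOp f E) := by
  intro x
  obtain ⟨U₁, hx₁, n, e, he⟩ := hE x
  obtain ⟨U₂, hx₂, m, ω, hω⟩ := isVectorBundle_Omega f x
  have he' := he.res (inf_le_left : U₁ ⊓ U₂ ≤ U₁)
  have hω' := hω.res (inf_le_right : U₁ ⊓ U₂ ≤ U₂)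
  exact ⟨U₁ ⊓ U₂, ⟨hx₁, hx₂⟩, exists_frame_of_coords (he'.diffOpFrame hω')
    (fun _ h => he'.diffOpCoord _ h) (fun _ h => he'.diffOpCoord_diffOpFrame hω' h)
    fun _ h => he'.sum_diffOpCoord hω' h⟩

end diffOpBasics

/-! ### The trace of an endomorphism -/

section tensor
variable {X : Scheme.{u}} {M N P : X.Modules} {U V : X.Opens}

lemma tensor_hom_ext {f g : tensor M N ⟶ P} (H : ∀ (U : X.Opens) (m : Γ(M, U)) (n : Γ(N, U)),
    f.app U (tmul m n) = g.app U (tmul m n)) : f = g := by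
  refine shf_hom_ext fun U (p : Γ(M, U) ⊗[Γ(X, U)] Γ(N, U)) => ?_
  change (f.app U).hom.comp (toShf (tensorPsh M N) U) p =
    (g.app U).hom.comp (toShf (tensorPsh M N) U) p
  induction p using TensorProduct.induction_on with
  | zero => exact (map_zero _).trans (map_zero _).symm
  | add p q hp hq => exact (map_add _ p q).trans ((congr_arg₂ _ hp hq).trans (map_add _ p q).symm)
  | tmul m n => exact H U m n

/-- The bilinear map corresponding to a morphism out of a tensor product. -/
def tensorCurry (f : tensor M N ⟶ P) : M ⟶ ihom N P :=
  ofBilin (fun U m n => f.app U (tmul m n))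
    (fun U m m' n => by rw [add_tmul, map_add])
    (fun U m n n' => by rw [tmul_add, map_add])
    (fun U a m n => by rw [smul_tmul, Scheme.Modules.Hom.app_smul])
    (fun U a m n => by rw [tmul_smul, Scheme.Modules.Hom.app_smul])
    (fun h m n => by rw [← res_tmul, app_res])

lemma tensorCurry_ev (f : tensor M N ⟶ P) (m : Γ(M, U)) (h : V ≤ U) (n : Γ(N, V)) :
    ev ((tensorCurry f).app U m) h n = f.app V (tmul (res M h m) n) := rfl

lemma ihom_tensor_ext {φ ψ : Γ(ihom (tensor M N) P, U)}
    (H : ∀ (V : X.Opens) (h : V ≤ U) (m : Γ(M, V)) (n : Γ(N, V)),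
      ev φ h (tmul m n) = ev ψ h (tmul m n)) : φ = ψ := by
  refine local_ext fun V h z => eq_of_locally_eq P _ _ fun x hx => ?_
  obtain ⟨W, h', hxW, p, hp⟩ := toShf_locally_surjective z x hx
  refine ⟨W, h', hxW, ?_⟩
  rw [← ev_res_right φ h h', ← ev_res_right ψ h h']
  refine (congr_arg _ hp).symm.trans (Eq.trans ?_ (congr_arg _ hp))
  let p' : Γ(M, W) ⊗[Γ(X, W)] Γ(N, W) := p
  change (ev φ (h'.trans h)).comp (toShf (tensorPsh M N) W) p' =
    (ev ψ (h'.trans h)).comp (toShf (tensorPsh M N) W) p'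
  induction p' using TensorProduct.induction_on with
  | zero => exact (map_zero _).trans (map_zero _).symm
  | add p q hp hq => exact (map_add _ p q).trans ((congr_arg₂ _ hp hq).trans (map_add _ p q).symm)
  | tmul m n => exact H W _ m n

end tensor

section endTrace
variable {X : Scheme.{u}} {E : X.Modules} (hE : IsVectorBundle E) {U V W : X.Opens}

/-- The trace `Hom(E, E) ⟶ O_X`, that is, the evaluation `Hom(E, O_X) ⊗ E ⟶ O_X`. -/
def endTraceHom : ihom E E ⟶ structureSheaf X :=
  haveI := isIso_dualTensorHom hE E
  inv (dualTensorHom E E) ≫ tensorLift (𝟙 (dual E))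

/-- The trace of an endomorphism. -/
def endTrace : Γ(ihom E E, U) →ₗ[Γ(X, U)] Γ(X, U) where
  toFun φ := (endTraceHom hE).app U φ
  map_add' := map_add ((endTraceHom hE).app U).hom
  map_smul' a φ := Scheme.Modules.Hom.app_smul (endTraceHom hE) a φ

lemma endTrace_res (h : V ≤ U) (φ : Γ(ihom E E, U)) :
    endTrace hE (res (ihom E E) h φ) = resO X h (endTrace hE φ) :=
  app_res (endTraceHom hE) h φ

lemma endTrace_rankOne (l : Γ(dual E, U)) (s : Γ(E, U)) :
    endTrace hE (rankOne l s) = evO l le_rfl s := by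
  have : IsIso (dualTensorHom E E) := isIso_dualTensorHom hE E
  have h₁ : (dualTensorHom E E).app U (tmul l s) = rankOne l s := by
    rw [dualTensorHom, tensorLift_tmul, rankOneHom, ofBilin_app, res_self]
  have h₂ : dualTensorHom E E ≫ endTraceHom hE = tensorLift (𝟙 (dual E)) := by
    rw [endTraceHom, IsIso.hom_inv_id_assoc]
  refine (congr_arg _ h₁.symm).trans ((app_eq_of_eq h₂ (tmul l s)).trans ?_)
  exact tensorLift_tmul (P := structureSheaf X) _ l s

variable {n : ℕ} {e : Fin n → Γ(E, U)}

lemma IsFrame.sum_rankOne_of_le (he : IsFrame e) (h : V ≤ U) (φ : Γ(ihom E E, V)) :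
    ∑ i, rankOne (AtiyahDual.res (dual E) h (he.dualFrame i))
      (ev φ le_rfl (AtiyahDual.res E h (e i))) = φ := by
  conv_rhs => rw [← (he.res h).sum_rankOne φ]
  simp only [he.dualFrame_res]

lemma IsFrame.endTrace_eq (he : IsFrame e) (h : V ≤ U) (φ : Γ(ihom E E, V)) :
    endTrace hE φ = ∑ i, evO (he.dualFrame i) h (ev φ le_rfl (AtiyahDual.res E h (e i))) := by
  conv_lhs => rw [← he.sum_rankOne_of_le h φ]
  simp only [map_sum, endTrace_rankOne, evO_res]

/-- Composition of endomorphisms. -/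
def endComp (φ θ : Γ(ihom E E, U)) : Γ(ihom E E, U) :=
  mkLocal (fun _ h => (ev φ h).comp (ev θ h))
    (fun V h a s => by
      rw [AddMonoidHom.comp_apply, ev_smul_right, ev_smul_right, AddMonoidHom.comp_apply])
    (fun V W h h' s => by
      rw [AddMonoidHom.comp_apply, ev_res_right θ h, ev_res_right φ h, AddMonoidHom.comp_apply])

lemma endComp_ev (φ θ : Γ(ihom E E, U)) (h : V ≤ U) (s : Γ(E, V)) :
    ev (endComp φ θ) h s = ev φ h (ev θ h s) := rfl

/-- The trace pairing `(θ, φ) ↦ tr(φ θ)` on endomorphisms. -/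
def traceForm : ihom E E ⟶ dual (ihom E E) :=
  ofBilin (P := structureSheaf X) (fun U θ φ => endTrace hE (endComp φ θ))
    (fun U θ θ' φ => by
      refine Eq.trans ?_ (map_add (endTrace hE) _ _)
      exact congr_arg _ (local_ext fun V h s => map_add (ev φ h) _ _))
    (fun U θ φ φ' => by
      refine Eq.trans ?_ (map_add (endTrace hE) _ _)
      exact congr_arg _ (local_ext fun V h s => rfl))
    (fun U a θ φ => by
      refine Eq.trans ?_ (map_smul (endTrace hE) a _)
      exact congr_arg _ (local_ext fun V h s => ev_smul_right φ h _ _))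
    (fun U a θ φ => by
      refine Eq.trans ?_ (map_smul (endTrace hE) a _)
      exact congr_arg _ (local_ext fun V h s => rfl))
    (fun h θ φ => endTrace_res hE h (endComp φ θ))

lemma traceForm_apply (θ : Γ(ihom E E, U)) (h : V ≤ U) (φ : Γ(ihom E E, V)) :
    evO ((traceForm hE).app U θ) h φ = endTrace hE (endComp φ (res (ihom E E) h θ)) := rfl

/-- The trace pairing is nondegenerate: pairing `θ` with elementary matrices gives the matrix
entries of `θ`. -/
lemma IsFrame.eq_zero_of_traceForm (he : IsFrame e) (θ : Γ(ihom E E, U))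
    (H : ∀ φ : Γ(ihom E E, U), endTrace hE (endComp φ θ) = 0) : θ = 0 := by
  have h0 : ∀ b, ev θ le_rfl (e b) = 0 := fun b => by
    rw [← he.expand le_rfl (ev θ le_rfl (e b))]
    refine Finset.sum_eq_zero fun a _ => ?_
    suffices evO (he.dualFrame a) le_rfl (ev θ le_rfl (e b)) = 0 by rw [this, zero_smul]
    have h1 := H (rankOne (he.dualFrame a) (e b))
    rw [he.endTrace_eq hE le_rfl, Finset.sum_eq_single b] at h1
    · rwa [endComp_ev, rankOne_ev, map_smul, he.evO_dualFrame_self, if_pos rfl, smul_eq_mul,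
        mul_one, res_self] at h1
    · intro c _ hc
      rw [endComp_ev, rankOne_ev, map_smul, he.evO_dualFrame_self, if_neg hc, smul_zero]
    · intro hb
      exact absurd (Finset.mem_univ b) hb
  rw [← he.sum_rankOne θ]
  refine Finset.sum_eq_zero fun b _ => local_ext fun V h s => ?_
  rw [h0, rankOne_ev, map_zero, smul_zero]
  rfl

/-- Every functional on endomorphisms is a trace pairing with an endomorphism, the matrix entries of
which are the values of the functional at elementary matrices. -/
lemma IsFrame.exists_traceForm_eq (he : IsFrame e) (Λ : Γ(dual (ihom E E), U)) :
    ∃ θ, (traceForm hE).app U θ = Λ := by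
  let y : Fin n → Γ(E, U) := fun b => ∑ a, evO Λ le_rfl (rankOne (he.dualFrame a) (e b)) • e a
  let θ : Γ(ihom E E, U) := ∑ b, rankOne (he.dualFrame b) (y b)
  have hθ : ∀ (V : X.Opens) (h : V ≤ U) (b : Fin n),
      ev θ h (AtiyahDual.res E h (e b)) = AtiyahDual.res E h (y b) := fun V h b => by
    rw [ev_sum, Finset.sum_eq_single b]
    · rw [rankOne_ev, he.evO_dualFrame_self, if_pos rfl, one_smul]
    · intro c _ hc
      rw [rankOne_ev, he.evO_dualFrame_self, if_neg hc, zero_smul]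
    · intro hb
      exact absurd (Finset.mem_univ b) hb
  refine ⟨θ, dual_ext fun V h φ => ?_⟩
  have h1 : ∀ b a, evO Λ h (rankOne (AtiyahDual.res (dual E) h (he.dualFrame a))
      (AtiyahDual.res E h (e b))) =
        resO X h (evO Λ le_rfl (rankOne (he.dualFrame a) (e b))) := fun b a => by
    rw [← evO_res_right Λ le_rfl h]
    refine congr_arg _ (local_ext fun W h' s => ?_)
    rw [rankOne_ev, ev_res, rankOne_ev, evO_res, res_res]
  have h2 : ∀ a, rankOne (AtiyahDual.res (dual E) h (he.dualFrame a))
      (ev φ le_rfl (AtiyahDual.res E h (e a))) =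
      ∑ b, evO (he.dualFrame b) h (ev φ le_rfl (AtiyahDual.res E h (e a))) •
        rankOne (AtiyahDual.res (dual E) h (he.dualFrame a)) (AtiyahDual.res E h (e b)) := by
    intro a
    refine local_ext fun W h' s => ?_
    conv_lhs => rw [← he.expand h (ev φ le_rfl (AtiyahDual.res E h (e a)))]
    rw [rankOne_ev, ev_sum, map_sum, Finset.smul_sum]
    refine Finset.sum_congr rfl fun b _ => ?_
    rw [ev_smul, rankOne_ev, res_smul, smul_comm]
  conv_rhs => rw [← he.sum_rankOne_of_le h φ, map_sum]
  rw [traceForm_apply, he.endTrace_eq hE h]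
  simp only [endComp_ev, ev_res, hθ, h2, map_sum, map_smul, h1, y, res_smul, ev_smul_right]
  rw [Finset.sum_comm]
  refine Finset.sum_congr rfl fun a _ => Finset.sum_congr rfl fun b _ => ?_
  rw [smul_eq_mul, smul_eq_mul, mul_comm]

/-- The trace pairing on the endomorphisms of a vector bundle is perfect. -/
lemma isIso_traceForm : IsIso (traceForm hE) := by
  refine isIso_of_sections _ ?_ ?_
  · intro U θ hθ
    refine eq_of_locally_eq (ihom E E) _ _ fun x hx => ?_
    obtain ⟨U', hx', n, e, he⟩ := hE x
    have he' := he.res (inf_le_left : U' ⊓ U ≤ U')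
    refine ⟨U' ⊓ U, inf_le_right, ⟨hx', hx⟩, ?_⟩
    rw [map_zero]
    refine he'.eq_zero_of_traceForm hE _ fun φ => ?_
    exact congr_arg (fun Λ : Γ(dual (ihom E E), U) => evO Λ (inf_le_right : U' ⊓ U ≤ U) φ) hθ
  · intro U (Λ : Γ(dual (ihom E E), U)) x hx
    obtain ⟨U', hx', n, e, he⟩ := hE x
    have he' := he.res (inf_le_left : U' ⊓ U ≤ U')
    exact ⟨U' ⊓ U, inf_le_right, ⟨hx', hx⟩, he'.exists_traceForm_eq hE _⟩

end endTrace

/-! ### The dual of the sheaf of differential operators as an extension -/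

section dualSeq
variable {k : Type u} [Field k] {X : Scheme.{u}} (f : X ⟶ Spec (CommRingCat.of k))
  {E : X.Modules} {U V W : X.Opens}

lemma ev_neg {M N : X.Modules} (φ : Γ(ihom M N, U)) (h : V ≤ U) (s : Γ(M, V)) :
    ev (-φ) h s = -ev φ h s :=
  eq_neg_of_add_eq_zero_left (by rw [← ev_add, neg_add_cancel, ev_zero])

lemma evO_neg (l : Γ(dual E, U)) (h : V ≤ U) (s : Γ(E, V)) : evO (-l) h s = -evO l h s :=
  ev_neg (N := structureSheaf X) l h s

/-- The contraction of a section of `Ω ⊗ E` with a vector field: `t` sends `s ⊗ e` to `t(s) e`. -/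
def contract (E : X.Modules) : dual (Omega f) ⟶ ihom (tensor (Omega f) E) E :=
  flip (tensorLift (ofBilin (N := E) (P := ihom (dual (Omega f)) E) (fun _ s e => evalAt e s)
    (fun U s s' e => local_ext fun V h l => by
      simp only [evalAt_ev, ev_add, map_add, add_smul])
    (fun U s e e' => local_ext fun V h l => by
      simp only [evalAt_ev, ev_add, map_add, smul_add])
    (fun U a s e => local_ext fun V h l => by
      simp only [evalAt_ev, ev_smul, res_smul, map_smul, smul_assoc])
    (fun U a s e => local_ext fun V h l => by
      simp only [evalAt_ev, ev_smul, res_smul]; rw [smul_comm])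
    (fun h s e => local_ext fun V h' l => by
      simp only [evalAt_ev, ev_res, res_res])))

variable {f}

lemma contract_tmul (t : Γ(dual (Omega f), U)) (h : V ≤ U) (s : Γ(Omega f, V)) (e : Γ(E, V)) :
    ev ((contract f E).app U t) h (tmul s e) = evO t h s • e := by
  rw [contract, flip_app, tensorLift_tmul, ofBilin_app, evalAt_ev, res_self, res_self, res_self]
  rfl

/-- The second component of a section of the Atiyah extension. -/
def atiyahSnd : Γ(atiyahExt f E, U) →+ Γ(tensor (Omega f) E, U) :=
  AddMonoidHom.mk' (fun s : AtiyahSec f E U => s.snd) fun _ _ => rfl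

lemma atiyahSnd_smul (a : Γ(X, U)) (s : Γ(atiyahExt f E, U)) :
    atiyahSnd (a • s) = a • atiyahSnd s + tmul (dOmega f U a) ((atiyahProj f E).app U s) := rfl

lemma atiyahSnd_res (h : V ≤ U) (s : Γ(atiyahExt f E, U)) :
    atiyahSnd (res (atiyahExt f E) h s) = res (tensor (Omega f) E) h (atiyahSnd s) := rfl

/-- The endomorphism `(t ⊗ 1) ∘ h₂ - φ ∘ h₁` attached to a local homomorphism `h = (h₁, h₂)` from
`E` to the Atiyah extension and a differential operator `φ` with symbol `t`; the failures of
`h₂` and `φ` to be linear cancel. -/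
def atiyahPairing (g : Γ(ihom E (atiyahExt f E), U)) (p : Γ(diffOp f E, U)) : Γ(ihom E E, U) :=
  mkLocal (fun V h => AddMonoidHom.mk' (fun s =>
      ev ((contract f E).app U ((symbol f E).app U p)) h (atiyahSnd (ev g h s)) -
        act p h ((atiyahProj f E).app V (ev g h s)))
      fun s s' => by
        simp only [map_add]
        abel)
    (fun V h a s => by
      simp only [AddMonoidHom.mk'_apply, ev_smul_right, atiyahSnd_smul, map_add, contract_tmul,
        Scheme.Modules.Hom.app_smul, act_smul_right, smul_sub]
      abel)
    (fun V W h h' s => by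
      simp only [AddMonoidHom.mk'_apply]
      rw [ev_res_right g h h', atiyahSnd_res, app_res, act_res_right p h h', map_sub,
        ev_res_right _ h h'])

lemma atiyahPairing_ev (g : Γ(ihom E (atiyahExt f E), U)) (p : Γ(diffOp f E, U)) (h : V ≤ U)
    (s : Γ(E, V)) : ev (atiyahPairing g p) h s =
      ev ((contract f E).app U ((symbol f E).app U p)) h (atiyahSnd (ev g h s)) -
        act p h ((atiyahProj f E).app V (ev g h s)) := rfl

/-- The morphism `Hom(E, E_A) ⟶ Hom(D(E), O_X)` given by the trace of the pairing. -/
def homAtiyahToDual (hE : IsVectorBundle E) : ihom E (atiyahExt f E) ⟶ dual (diffOp f E) :=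
  ofBilin (P := structureSheaf X) (fun _ g p => endTrace hE (atiyahPairing g p))
    (fun U g g' p => by
      refine Eq.trans (congr_arg _ (local_ext fun V h s => ?_)) (map_add (endTrace hE) _ _)
      simp only [ev_add, atiyahPairing_ev, map_add]
      abel)
    (fun U g p p' => by
      refine Eq.trans (congr_arg _ (local_ext fun V h s => ?_)) (map_add (endTrace hE) _ _)
      simp only [ev_add, atiyahPairing_ev, map_add, act_add]
      abel)
    (fun U a g p => by
      refine Eq.trans (congr_arg _ (local_ext fun V h s => ?_)) (map_smul (endTrace hE) a _)
      simp only [ev_smul, atiyahPairing_ev, atiyahSnd_smul, map_add, ev_smul_right, contract_tmul,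
        Scheme.Modules.Hom.app_smul, act_smul_right, smul_sub]
      abel)
    (fun U a g p => by
      refine Eq.trans (congr_arg _ (local_ext fun V h s => ?_)) (map_smul (endTrace hE) a _)
      simp only [ev_smul, atiyahPairing_ev, act_smul, Scheme.Modules.Hom.app_smul, smul_sub])
    (fun h g p => by
      refine (congr_arg _ (local_ext fun V h' s => ?_)).trans (endTrace_res hE h _)
      rw [atiyahPairing_ev, ev_res, ev_res, act_res, atiyahPairing_ev, app_res, app_res, ev_res])

lemma homAtiyahToDual_apply (hE : IsVectorBundle E) (g : Γ(ihom E (atiyahExt f E), U)) (h : V ≤ U)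
    (p : Γ(diffOp f E, V)) : evO ((homAtiyahToDual hE).app U g) h p =
      endTrace hE (atiyahPairing (res (ihom E (atiyahExt f E)) h g) p) := rfl

variable (f E) in
/-- The morphism `Ω ⟶ Hom(D(E), O_X)` dual to the symbol. -/
def omegaToDual : Omega f ⟶ dual (diffOp f E) := flip (symbol f E)

lemma omegaToDual_apply (s : Γ(Omega f, U)) (h : V ≤ U) (p : Γ(diffOp f E, V)) :
    evO ((omegaToDual f E).app U s) h p =
      evO ((symbol f E).app V p) le_rfl (res (Omega f) h s) := rfl

variable (f E) in
/-- The restriction of functionals from differential operators to endomorphisms. -/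
def dualToDualEnd : dual (diffOp f E) ⟶ dual (ihom E E) := ihomMap (endIncl f E) (𝟙 _)

lemma dualToDualEnd_apply (Λ : Γ(dual (diffOp f E), U)) (h : V ≤ U) (φ : Γ(ihom E E, V)) :
    evO ((dualToDualEnd f E).app U Λ) h φ = evO Λ h ((endIncl f E).app V φ) := rfl

/-- The morphism `Hom(D(E), O_X) ⟶ Hom(E, E)`: up to sign, the restriction of functionals to
endomorphisms, which are identified with endomorphisms by the trace pairing. -/
def dualToEnd (hE : IsVectorBundle E) : dual (diffOp f E) ⟶ ihom E E :=
  haveI := isIso_traceForm hE; -(dualToDualEnd f E ≫ inv (traceForm hE))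

lemma dualToEnd_traceForm (hE : IsVectorBundle E) :
    dualToEnd hE ≫ traceForm hE = -dualToDualEnd f E := by
  have := isIso_traceForm hE
  rw [dualToEnd, Preadditive.neg_comp, Category.assoc, IsIso.inv_hom_id, Category.comp_id]

lemma omegaToDual_dualToDualEnd : omegaToDual f E ≫ dualToDualEnd f E = 0 :=
  hom_ext' fun U s => dual_ext fun V h φ => by
    rw [comp_app_apply, dualToDualEnd_apply, omegaToDual_apply, symbol_endIncl]
    rfl

lemma omegaToDual_dualToEnd (hE : IsVectorBundle E) : omegaToDual f E ≫ dualToEnd hE = 0 := by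
  have := isIso_traceForm hE
  rw [← cancel_mono (traceForm hE), Category.assoc, dualToEnd_traceForm, Preadditive.comp_neg,
    omegaToDual_dualToDualEnd, neg_zero, zero_comp]

variable (f) in
/-- The sequence `0 ⟶ Ω ⟶ Hom(D(E), O_X) ⟶ Hom(E, E) ⟶ 0`. -/
def dualSeq (hE : IsVectorBundle E) : ShortComplex X.Modules :=
  ShortComplex.mk (omegaToDual f E) (dualToEnd hE) (omegaToDual_dualToEnd hE)

/-- The comparison with the dual of differential operators is the identity on `Hom(E, E)`: if `φ` is
an endomorphism, its symbol vanishes, and the trace of the pairing of `(h₁, h₂)` with `φ` is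
`-tr(φ h₁)`. -/
lemma homAtiyahToDual_dualToEnd (hE : IsVectorBundle E) :
    homAtiyahToDual hE ≫ dualToEnd hE = ihomMap (𝟙 E) (atiyahProj f E) := by
  have := isIso_traceForm hE
  rw [← cancel_mono (traceForm hE), Category.assoc, dualToEnd_traceForm]
  refine hom_ext' fun U g => dual_ext fun V h φ => ?_
  rw [comp_app_apply, comp_app_apply, traceForm_apply, neg_app_apply]
  refine (evO_neg _ h φ).trans ?_
  rw [dualToDualEnd_apply, homAtiyahToDual_apply, ← map_neg]
  refine congr_arg _ (local_ext fun W h' s => ?_)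
  rw [ev_neg, atiyahPairing_ev, symbol_endIncl, map_zero, act_endIncl, ev_res, endComp_ev, ev_res,
    ihomMap_app]
  change -(0 - _) = _
  rw [zero_sub, neg_neg]
  rfl

/-- The comparison with the dual of differential operators is the trace on `Hom(E, Ω ⊗ E)`: the
pairing of `(0, l ⊗ (s ⊗ e))` with an operator of symbol `t` is `l ⊗ t(s) e`, and its trace is
`t(l(e) s)`. -/
lemma trace_omegaToDual (hE : IsVectorBundle E) : trace hE (Omega f) ≫ omegaToDual f E =
    ihomMap (𝟙 E) (atiyahIncl f E) ≫ homAtiyahToDual hE := by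
  have := isIso_dualTensorHom hE (tensor (Omega f) E)
  rw [← cancel_epi (dualTensorHom E (tensor (Omega f) E))]
  refine tensor_hom_ext fun U l w => ?_
  suffices H : (tensorCurry (dualTensorHom E (tensor (Omega f) E) ≫ trace hE (Omega f) ≫
      omegaToDual f E)).app U l = (tensorCurry (dualTensorHom E (tensor (Omega f) E) ≫
        ihomMap (𝟙 E) (atiyahIncl f E) ≫ homAtiyahToDual hE)).app U l by
    have := congr_arg (fun φ : Γ(ihom (tensor (Omega f) E) (dual (diffOp f E)), U) =>
      ev φ le_rfl w) H
    simpa only [tensorCurry_ev, res_self] using this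
  refine ihom_tensor_ext fun V h s e => dual_ext fun W h' p => ?_
  have h₁ : (dualTensorHom E (tensor (Omega f) E)).app V (tmul (res (dual E) h l) (tmul s e)) =
      rankOne (res (dual E) h l) (tmul s e) := by
    rw [dualTensorHom, tensorLift_tmul, rankOneHom, ofBilin_app, res_self]
  rw [tensorCurry_ev, tensorCurry_ev, comp_app_apply, comp_app_apply, comp_app_apply,
    comp_app_apply, h₁, trace_rankOne, omegaToDual_apply, homAtiyahToDual_apply]
  have h₂ : atiyahPairing (res (ihom E (atiyahExt f E)) h' ((ihomMap (𝟙 E) (atiyahIncl f E)).app V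
      (rankOne (res (dual E) h l) (tmul s e)))) p = rankOne (res (dual E) (h'.trans h) l)
        (evO ((symbol f E).app W p) le_rfl (res (Omega f) h' s) • res E h' e) := by
    refine local_ext fun W' h'' x => ?_
    have h₃ : ev (res (ihom E (atiyahExt f E)) h' ((ihomMap (𝟙 E) (atiyahIncl f E)).app V
        (rankOne (res (dual E) h l) (tmul s e)))) h'' x = (atiyahIncl f E).app W'
          (evO l (h''.trans (h'.trans h)) x • tmul (res (Omega f) (h''.trans h') s)
            (res E (h''.trans h') e)) := by
      rw [← res_tmul]
      rfl
    rw [atiyahPairing_ev, h₃, rankOne_ev, res_smul, res_res, evO_res]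
    have h₄ : ∀ z, (atiyahProj f E).app W' ((atiyahIncl f E).app W' z) = 0 := fun _ => rfl
    have h₅ : ∀ z, atiyahSnd ((atiyahIncl f E).app W' z) = z := fun _ => rfl
    rw [h₄, h₅, map_zero, sub_zero, ev_smul_right, contract_tmul, ← evO_res_right _ le_rfl h'',
      res_res]
  rw [h₂, endTrace_rankOne, res_smul, LinearMap.map_smul, LinearMap.map_smul, smul_eq_mul,
    smul_eq_mul, evO_res, evO_res, evO_res_right l h h', mul_comm]

/-- The comparison of `Hom(E, -)` of the Atiyah sequence with the extension of `Hom(E, E)` by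
`Ω` given by the dual of the sheaf of differential operators. -/
def homAtiyahSeqToDualSeq (hE : IsVectorBundle E) : homAtiyahSeq f E ⟶ dualSeq f hE where
  τ₁ := trace hE (Omega f)
  τ₂ := homAtiyahToDual hE
  τ₃ := 𝟙 _
  comm₁₂ := trace_omegaToDual hE
  comm₂₃ := (homAtiyahToDual_dualToEnd hE).trans (Category.comp_id _).symm

variable {n m : ℕ} {e : Fin n → Γ(E, U)} {ω : Fin m → Γ(Omega f, U)}

lemma IsFrame.nabla_sum (he : IsFrame e) (h : V ≤ U) {ι : Type*} (s : Finset ι)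
    (t : ι → Γ(dual (Omega f), V)) : he.nabla h (∑ i ∈ s, t i) = ∑ i ∈ s, he.nabla h (t i) :=
  map_sum (AddMonoidHom.mk' (he.nabla h) (he.nabla_add h)) t s

lemma IsFrame.eq_zero_of_omegaToDual (he : IsFrame e) (hω : IsFrame ω) (s : Γ(Omega f, U))
    (hs : (omegaToDual f E).app U s = 0) : s = 0 := by
  rw [← hω.expand le_rfl s]
  refine Finset.sum_eq_zero fun i _ => ?_
  have := congr_arg (fun Λ : Γ(dual (diffOp f E), U) => evO Λ le_rfl
    (he.nabla le_rfl (hω.dualFrame i))) hs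
  simp only [omegaToDual_apply, he.symbol_nabla, res_self] at this
  exact (congr_arg (· • AtiyahDual.res (Omega f) le_rfl (ω i)) this).trans (zero_smul Γ(X, U) _)

/-- A functional `Λ` on differential operators that vanishes on endomorphisms comes from a
differential form, with coordinates the values of `Λ` at covariant derivatives. -/
lemma IsFrame.exists_omegaToDual_eq (he : IsFrame e) (hω : IsFrame ω)
    (Λ : Γ(dual (diffOp f E), U)) (hΛ : (dualToDualEnd f E).app U Λ = 0) :
    ∃ s, (omegaToDual f E).app U s = Λ := by
  refine ⟨∑ i, evO Λ le_rfl (he.nabla le_rfl (hω.dualFrame i)) • ω i, dual_ext fun V h p => ?_⟩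
  obtain ⟨φ, hφ⟩ := he.exists_nabla_add_endIncl h p
  have h₁ : evO Λ h ((endIncl f E).app V φ) = 0 :=
    congr_arg (fun Λ' : Γ(dual (ihom E E), U) => evO Λ' h φ) hΛ
  conv_rhs => rw [hφ, map_add, h₁, add_zero, ← hω.expand_dual h ((symbol f E).app V p),
    he.nabla_sum, map_sum]
  rw [omegaToDual_apply, map_sum, map_sum]
  refine Finset.sum_congr rfl fun i _ => ?_
  rw [res_smul, map_smul, he.nabla_smul, map_smul, he.nabla_res le_rfl h, evO_res_right Λ le_rfl h,
    smul_eq_mul, smul_eq_mul, mul_comm]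

/-- The extension of `Hom(E, E)` by `Ω` is exact. -/
lemma dualSeq_shortExact [Smooth f] (hE : IsVectorBundle E) : (dualSeq f hE).ShortExact where
  exact := by
    refine exact_of_sections _ ?_
    intro U (Λ : Γ(dual (diffOp f E), U)) (hΛ : (dualToEnd hE).app U Λ = 0) x hx
    have h0 : (dualToDualEnd f E).app U Λ = 0 := by
      have := app_eq_of_eq (dualToEnd_traceForm (f := f) hE) Λ
      rw [comp_app_apply, hΛ, map_zero, neg_app_apply] at this
      exact neg_eq_zero.1 this.symm
    obtain ⟨U₁, hx₁, n, e, he⟩ := hE x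
    obtain ⟨U₂, hx₂, m, ω, hω⟩ := isVectorBundle_Omega f x
    refine ⟨U₁ ⊓ U₂ ⊓ U, inf_le_right, ⟨⟨hx₁, hx₂⟩, hx⟩,
      (he.res (inf_le_left.trans inf_le_left)).exists_omegaToDual_eq
        (hω.res (inf_le_left.trans inf_le_right)) (res (dual (diffOp f E)) inf_le_right Λ) ?_⟩
    rw [app_res, h0, map_zero]
  mono_f := by
    refine mono_of_sections _ ?_
    intro U (s : Γ(Omega f, U)) (hs : (omegaToDual f E).app U s = 0)
    refine eq_of_locally_eq (Omega f) _ _ fun x hx => ?_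
    obtain ⟨U₁, hx₁, n, e, he⟩ := hE x
    obtain ⟨U₂, hx₂, m, ω, hω⟩ := isVectorBundle_Omega f x
    refine ⟨U₁ ⊓ U₂ ⊓ U, inf_le_right, ⟨⟨hx₁, hx₂⟩, hx⟩, ?_⟩
    refine ((he.res (inf_le_left.trans inf_le_left)).eq_zero_of_omegaToDual
        (hω.res (inf_le_left.trans inf_le_right)) _ ?_).trans (map_zero _).symm
    rw [app_res, hs, map_zero]
  epi_g :=
    -- The projection of the sequence `Hom(E, E_A)` factors through the last morphism.
    have : Epi (ihomMap (𝟙 E) (atiyahProj f E)) := (homAtiyahSeq_shortExact f hE).epi_g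
    @epi_of_epi_fac _ _ _ _ _ _ _ _ this (homAtiyahToDual_dualToEnd (f := f) hE)

end dualSeq

/-! ### The cone of the Atiyah class -/

section cone
variable {k : Type u} [Field k] {X : Scheme.{u}} (f : X ⟶ Spec (CommRingCat.of k)) {E : X.Modules}
  [HasDerivedCategory.{w} X.Modules]

/-- The Atiyah class is the class of the extension dual to the sheaf of differential operators. -/
lemma atiyahClass_eq_singleδ [Smooth f] (hE : IsVectorBundle E) :
    atiyahClass f hE = (dualSeq_shortExact (f := f) hE).singleδ := by
  have h := (ShortComplex.ShortExact.singleTriangle.map (homAtiyahSeq_shortExact f hE)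
    (dualSeq_shortExact (f := f) hE) (homAtiyahSeqToDualSeq hE)).comm₃
  refine h.trans ?_
  refine Eq.trans (congr_arg (· ≫ _) ((DerivedCategory.singleFunctor X.Modules 0).map_id _)) ?_
  exact Category.id_comp _

/-- The cone of the Atiyah class is the dual of the sheaf of differential operators. -/
lemma nonempty_iso_of_isAtiyahCone [Smooth f] (hE : IsVectorBundle E)
    {G : CochainComplex X.Modules ℤ} (hG : IsAtiyahCone f hE G) :
    Nonempty (DerivedCategory.Q.obj G ≅
      (DerivedCategory.singleFunctor X.Modules 0).obj (dual (diffOp f E))) := by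
  obtain ⟨i, p, hT⟩ := hG
  let T := (dualSeq_shortExact (f := f) hE).singleTriangle
  have hT' := Pretriangulated.inv_rot_of_distTriang T
    (dualSeq_shortExact (f := f) hE).singleTriangle_distinguished
  -- The inverse rotation introduces a sign, which is absorbed by the isomorphism `-1`.
  let e₁ : ((DerivedCategory.singleFunctor X.Modules 0).obj (ihom E E))⟦(-1 : ℤ)⟧ ≅
      ((DerivedCategory.singleFunctor X.Modules 0).obj (ihom E E))⟦(-1 : ℤ)⟧ :=
    ⟨-𝟙 _, -𝟙 _, by simp, by simp⟩
  have comm : atiyahMap f hE ≫ 𝟙 _ = e₁.hom ≫ T.invRotate.mor₁ := by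
    refine (Category.comp_id _).trans ?_
    have h : T.invRotate.mor₁ = -atiyahMap f hE := by
      rw [atiyahMap, atiyahClass_eq_singleδ]
      rfl
    rw [h]
    change _ = (-𝟙 _) ≫ (-atiyahMap f hE)
    rw [Preadditive.neg_comp_neg, Category.id_comp]
  exact ⟨Pretriangulated.Triangle.π₃.mapIso
    (Pretriangulated.isoTriangleOfIso₁₂ _ _ hT hT' e₁ (Iso.refl _) comm)⟩

end cone

end

end AtiyahDual

theorem lemma4p1 {k : Type u} [Field k] [IsAlgClosed k] [CharZero k] {X : Scheme.{u}}
    (f : X ⟶ Spec (CommRingCat.of k)) [Smooth f] [HasDerivedCategory.{w} X.Modules]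
    (E : X.Modules) (hE : AtiyahDual.IsVectorBundle E) :
    AtiyahDual.IsVectorBundle (AtiyahDual.diffOp f E) ∧
    ∀ (G : CochainComplex X.Modules ℤ), AtiyahDual.IsAtiyahCone f hE G →
      ∀ I : InjectiveResolution (AtiyahDual.structureSheaf X),
        Nonempty (AtiyahDual.derivedDual I G ≅
          (DerivedCategory.singleFunctor X.Modules 0).obj (AtiyahDual.diffOp f E)) := by
  have hD := AtiyahDual.isVectorBundle_diffOp (f := f) hE
  refine ⟨hD, fun G hG I => ?_⟩
  obtain ⟨e⟩ := AtiyahDual.nonempty_iso_of_isAtiyahCone f hE hG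
  obtain ⟨e₁⟩ := AtiyahDual.nonempty_derivedDual_iso I
    (e ≪≫ (DerivedCategory.singleFunctorIsoCompQ X.Modules 0).app _)
  obtain ⟨e₂⟩ := AtiyahDual.nonempty_derivedDual_single_iso I hD.dual
  have := AtiyahDual.isIso_toDoubleDual hD
  exact ⟨e₁ ≪≫ e₂ ≪≫ (DerivedCategory.singleFunctor X.Modules 0).mapIso
    (asIso (AtiyahDual.toDoubleDual (AtiyahDual.diffOp f E))).symm⟩
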